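/- **Setting.** Let $A\in\mathbb R^{n\times d}$ and $1\le k\le \operatorname{rank}(A)$. Let $\sigma_1\ge\sigma_2\ge\cdots$ be the singular values of $A$ (with $\sigma_i=0$ for $i>\min(n,d)$), and assume $\sigma_k>\sigma_{k+1}$. Put $\mathrm{gap}_k(A)=(\sigma_k^2-\sigma_{k+1}^2)/\sigma_1^2$ and $\mathrm{sr}(A)=\|A\|_F^2/\|A\|_2^2$. For a thin SVD $X=U_X\Sigma_XV_X^{T}$ (singular values in decreasing order), $V_{X,k}$ denotes the first $k$ columns of $V_X$ and $V_{X,k+}$ the remaining ones; statements are meant for every choice of thin SVD. $X^+$ is the Moore–Penrose pseudo-inverse. For $b\in\mathbb R^n$ the PCR solution $x_k$ is the minimizer of $\|Ax-b\|_2$ over $x\in\operatorname{range}(V_{A,k})$. A vector $\tilde x$ is an $(\epsilon,\upsilon)$-approximate PCR of rank $k$ for $b$ if $\bigl|\|A\tilde x-b\|_2-\|Ax_k-b\|_2\bigr|\le\epsilon\|b\|_2$ and $\|V_{A,k+}^{T}\tilde x\|_2\le\upsilon\|b\|_2$. For $R\in\mathbb R^{d\times k}$ put $x_R=R(AR)^+b$.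 In the fixed design model, $b=f+\xi$ with $f\in\mathbb R^n$ fixed and $\xi_1,\dots,\xi_n$ independent with mean $0$ and variance $\sigma^2$; $x^\star$ is the minimizer of minimum norm of $x\mapsto\mathbb E_\xi[\|Ax-b\|_2^2/n]$, and the excess risk of an estimator $\theta$ is $\mathcal E(\theta)=\mathbb E_\xi[\|A\theta-Ax^\star\|_2^2/n]$ (the expectation is over the noise only). For $\epsilon,\delta\in(0,1/2)$, a distribution $\mathcal D$ on matrices with $n$ columns has the $(\epsilon,\delta)$-approximate Gram property for $A$ if $$\Pr_{S\sim\mathcal D}\bigl(\|A^{T}S^{T}SA-A^{T}A\|_2\ge\epsilon\|A\|_2^2\bigr)\le\delta .$$ **Theorem (Left Sketching).** Let $\nu,\delta\in(0,1/2)$ and $$\epsilon=\frac{\nu(1+\nu^2)^{-1/2}}{1+\nu(1+\nu^2)^{-1/2}}\,\mathrm{gap}_k(A).$$ 1. Suppose that $S\in\mathbb R^{s\times n}$ is sampled from a distribution with the $(\epsilon,\delta)$-approximate Gram property for $A$. Then, with probability at least $1-\delta$ over $S$, we have $k\le\min(s,d)$, and for $R=V_{SA,k}$: for every $b\in\mathbb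 R^n$ the vector $x_R$ is a $\left(\frac{\sigma_{k+1}}{\sigma_k}\nu,\ \frac{\nu}{(\sqrt{1-\nu^2}-\nu)\,\sigma_k}\right)$-approximate PCR of rank $k$; and in every fixed design model as above $\mathcal E(x_R)$ is finite and $$\mathcal E(x_R)\le\frac{(1+\nu)\,\|x^\star\|_2^2\,\sigma_{k+1}^2}{n}+\frac{\sigma^2k}{n}.$$ 2. There is an absolute constant $C>0$ such that, if $S$ is an $s\times n$ CountSketch matrix (independent columns, each a uniformly random identity vector of $\mathbb R^s$ times an independent uniform random sign) with $$s\ge C\,\frac{\mathrm{sr}(A)^2}{\mathrm{gap}_k(A)^2\,\nu^2\,\delta},$$ then its distribution has the $(\epsilon,\delta)$-approximate Gram property for $A$, so that the conclusion of 1 holds. 3. For every $\kappa$ there is a constant $C>0$ depending only on $\kappa$ such that the following holds. Let $\zeta$ be a real random variable with positive variance $v$ and $\mathbb E\,e^{t\zeta}\le e^{\kappa vt^2/2}$ for all $t\in\mathbb R$ (so $\zeta$ is centered and subgaussian), and let $S\in\mathbb R^{s\times n}$ have i.i.d. entries distributed as $\zeta/\sqrt{sv}$ (a subgaussian map). If $$s\ge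 C\,\frac{\mathrm{sr}(A)+\log(1/\delta)}{\mathrm{gap}_k(A)^2\,\nu^2},$$ then the distribution of $S$ has the $(\epsilon,\delta)$-approximate Gram property for $A$, so that the conclusion of 1 holds. -/

import Mathlib

open MeasureTheory ProbabilityTheory
open scoped NNReal Matrix

namespace SketchedPCR

noncomputable section

/-- The `i`-th largest singular value `σ_i(X)` of a real matrix, with indices starting at `1`;
it is `0` for `i > min m n`. -/
def sigma {m n : ℕ} (X : Matrix (Fin m) (Fin n) ℝ) (i : ℕ) : ℝ :=
  (Matrix.toEuclideanLin X).singularValues (i - 1)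

/-- A thin singular value decomposition `X = U Σ Vᵀ`, with the singular values on the diagonal of
`Σ` in decreasing order. -/
structure ThinSVD {m n : ℕ} (X : Matrix (Fin m) (Fin n) ℝ) where
  U : Matrix (Fin m) (Fin (min m n)) ℝ
  V : Matrix (Fin n) (Fin (min m n)) ℝ
  U_orthonormal : Uᵀ * U = 1
  V_orthonormal : Vᵀ * V = 1
  eq_mul : X = U * Matrix.diagonal (fun i : Fin (min m n) => sigma X ((i : ℕ) + 1)) * Vᵀ

theorem ThinSVD.exists {m n : ℕ} (X : Matrix (Fin m) (Fin n) ℝ) : Nonempty (ThinSVD X) := by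
  set T := Matrix.toEuclideanLin X with hT
  have hs := T.isSymmetric_adjoint_comp_self
  have hn : Module.finrank ℝ (EuclideanSpace ℝ (Fin n)) = n := finrank_euclideanSpace_fin
  have hm : Module.finrank ℝ (EuclideanSpace ℝ (Fin m)) = m := finrank_euclideanSpace_fin
  set v := hs.eigenvectorBasis hn with hv
  have hin : ∀ i j, inner ℝ (T (v i)) (T (v j))
      = if i = j then T.singularValues i ^ 2 else 0 := by
    intro i j
    rw [← LinearMap.adjoint_inner_left]
    have h1 : T.adjoint (T (v i)) = (T.singularValues i ^ 2) • v i := by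
      have := hs.apply_eigenvectorBasis hn i
      rw [T.sq_singularValues_fin hn i]
      exact this
    rw [h1, inner_smul_left, v.inner_eq_ite]
    simp
  have hzero : ∀ i : Fin n, T.singularValues i = 0 → T (v i) = 0 := by
    intro i hi
    have := hin i i
    rw [if_pos rfl, hi] at this
    simpa using this
  have hm0 : ∀ i : ℕ, m ≤ i → T.singularValues i = 0 := by
    intro i hi
    by_contra h
    have := T.singularValues_pos_iff_lt_finrank_range.1
      ((T.singularValues_pos_iff_ne_zero i).2 h)
    have h2 := Submodule.finrank_le T.range
    omega
  have hlt : ∀ i : ℕ, 0 < T.singularValues i → i < n := by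
    intro i hi
    by_contra h
    rw [T.singularValues_of_finrank_le (by omega)] at hi
    exact lt_irrefl _ hi
  let w : Fin m → EuclideanSpace ℝ (Fin m) := fun i =>
    if h : (i : ℕ) < n then (T.singularValues i)⁻¹ • T (v ⟨i, h⟩) else 0
  let s : Set (Fin m) := {i | 0 < T.singularValues i}
  have how : Orthonormal ℝ (s.domRestrict w) := by
    rw [orthonormal_iff_ite]
    rintro ⟨i, hi⟩ ⟨j, hj⟩
    have hi' : 0 < T.singularValues i := hi
    have hj' : 0 < T.singularValues j := hj
    simp only [Set.domRestrict_apply, w, dif_pos (hlt _ hi'), dif_pos (hlt _ hj'),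
      inner_smul_left, inner_smul_right, hin]
    by_cases hij : i = j
    · subst hij
      simp
      field_simp
    · have : ¬ ((i : ℕ) = j) := fun h => hij (Fin.ext h)
      simp [this, hij]
  obtain ⟨u, hu⟩ := how.exists_orthonormalBasis_extension_of_card_eq (by simp [hm])
  have hTv : ∀ (i : Fin (min m n)), T (v (Fin.castLE (min_le_right m n) i))
      = T.singularValues i • u (Fin.castLE (min_le_left m n) i) := by
    intro i
    by_cases hi : T.singularValues i = 0
    · rw [hi, zero_smul]
      exact hzero _ hi
    · have hp : 0 < T.singularValues i := (T.singularValues_pos_iff_ne_zero i).2 hi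
      rw [hu _ hp]
      have : ((Fin.castLE (min_le_left m n) i : Fin m) : ℕ) < n := hlt _ hp
      simp only [w, dif_pos this, smul_smul]
      simp only [Fin.val_castLE]
      rw [mul_inv_cancel₀ hi, one_smul]
      rfl
  refine ⟨⟨Matrix.of fun a j => u (Fin.castLE (min_le_left m n) j) a,
    Matrix.of fun a j => v (Fin.castLE (min_le_right m n) j) a, ?_, ?_, ?_⟩⟩
  · ext i j
    have := u.inner_eq_ite (Fin.castLE (min_le_left m n) i) (Fin.castLE (min_le_left m n) j)
    rw [PiLp.inner_apply] at this
    simp only [Matrix.mul_apply, Matrix.transpose_apply, Matrix.one_apply, Matrix.of_apply]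
    simpa [mul_comm] using this
  · ext i j
    have := v.inner_eq_ite (Fin.castLE (min_le_right m n) i) (Fin.castLE (min_le_right m n) j)
    rw [PiLp.inner_apply] at this
    simp only [Matrix.mul_apply, Matrix.transpose_apply, Matrix.one_apply, Matrix.of_apply]
    simpa [mul_comm] using this
  · ext a b
    have h1 : X a b = T (EuclideanSpace.single b 1) a := by
      simp [hT, Matrix.toLpLin_apply]
    have h2 := congrArg (fun y => T y a) (v.sum_repr' (EuclideanSpace.single b (1 : ℝ)))
    simp only [map_sum, map_smul] at h2
    rw [h1, ← h2]
    rw [Matrix.mul_apply]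
    simp only [Matrix.mul_diagonal, Matrix.transpose_apply, Matrix.of_apply,
      WithLp.ofLp_sum,
      Finset.sum_apply, PiLp.smul_apply]
    symm
    refine Finset.sum_of_injOn (Fin.castLE (min_le_right m n)) ?_ ?_ ?_ ?_
    · exact (Fin.castLE_injective _).injOn
    · intro _ _; simp
    · intro i _ hi
      have hi' : m ≤ (i : ℕ) := by
        by_contra h
        exact hi ⟨⟨i, by omega⟩, by simp, rfl⟩
      rw [hzero i (hm0 _ hi')]
      simp
    · intro i _
      rw [hTv]
      simp [sigma, hT, EuclideanSpace.inner_single_right]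
      ring

theorem le_min_of_le_rank {n d k : ℕ} {A : Matrix (Fin n) (Fin d) ℝ} (h : k ≤ A.rank) :
    k ≤ min n d :=
  le_min (h.trans A.rank_le_height) (h.trans A.rank_le_width)

/-- The Euclidean norm of a vector. -/
def l2 {ι : Type*} [Fintype ι] (x : ι → ℝ) : ℝ := ‖WithLp.toLp 2 x‖

open scoped Matrix.Norms.L2Operator in
/-- The spectral norm of a matrix. -/
def specNorm {m n : ℕ} (X : Matrix (Fin m) (Fin n) ℝ) : ℝ := ‖X‖

/-- The stable rank `‖X‖_F² / ‖X‖₂²`. -/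
def stableRank {m n : ℕ} (X : Matrix (Fin m) (Fin n) ℝ) : ℝ :=
  (∑ i, ∑ j, X i j ^ 2) / specNorm X ^ 2

/-- The `k`-th relative gap `(σ_k² - σ_{k+1}²) / σ_1²`. -/
def relGap {m n : ℕ} (X : Matrix (Fin m) (Fin n) ℝ) (k : ℕ) : ℝ :=
  (sigma X k ^ 2 - sigma X (k + 1) ^ 2) / sigma X 1 ^ 2

/-- The matrix of the first `k` columns. -/
def firstCols {d r k : ℕ} (V : Matrix (Fin d) (Fin r) ℝ) (hk : k ≤ r) :
    Matrix (Fin d) (Fin k) ℝ :=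
  V.submatrix id (Fin.castLE hk)

/-- The matrix of all columns after the first `k`. -/
def lastCols {d r : ℕ} (V : Matrix (Fin d) (Fin r) ℝ) (k : ℕ) :
    Matrix (Fin d) {i : Fin r // k ≤ (i : ℕ)} ℝ :=
  V.submatrix id Subtype.val

/-- The pseudo-inverse `V Σ⁺ Uᵀ` computed from a thin singular value decomposition; here
`a⁺ = a⁻¹`, with `0⁺ = 0`. -/
def ThinSVD.pinv {m n : ℕ} {X : Matrix (Fin m) (Fin n) ℝ} (svd : ThinSVD X) :
    Matrix (Fin n) (Fin m) ℝ :=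
  svd.V * Matrix.diagonal (fun i : Fin (min m n) => (sigma X ((i : ℕ) + 1))⁻¹) * svd.Uᵀ

/-- The Moore-Penrose pseudo-inverse (all thin singular value decompositions of `X` give the same
matrix). -/
def pinv {m n : ℕ} (X : Matrix (Fin m) (Fin n) ℝ) : Matrix (Fin n) (Fin m) ℝ :=
  (Classical.choice (ThinSVD.exists X)).pinv

/-- `x` is the rank-`k` principal component regression solution: a minimizer of `‖A x - b‖₂` over
the range of `V_{A,k}`. -/
def IsPCRSolution {n d k : ℕ} {A : Matrix (Fin n) (Fin d) ℝ} (svd : ThinSVD A)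
    (hk : k ≤ min n d) (b : Fin n → ℝ) (x : Fin d → ℝ) : Prop :=
  x ∈ LinearMap.range (firstCols svd.V hk).mulVecLin ∧
    ∀ y ∈ LinearMap.range (firstCols svd.V hk).mulVecLin, l2 (A *ᵥ x - b) ≤ l2 (A *ᵥ y - b)

/-- `x` is an `(ε, υ)`-approximate principal component regression of rank `k`. -/
def IsApproxPCR {n d k : ℕ} {A : Matrix (Fin n) (Fin d) ℝ} (svd : ThinSVD A)
    (hk : k ≤ min n d) (b : Fin n → ℝ) (ε υ : ℝ) (x : Fin d → ℝ) : Prop :=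
  (∃ xk, IsPCRSolution svd hk b xk ∧
    |l2 (A *ᵥ x - b) - l2 (A *ᵥ xk - b)| ≤ ε * l2 b) ∧
  l2 ((lastCols svd.V k)ᵀ *ᵥ x) ≤ υ * l2 b

/-- The estimator `x_R = R (A R)⁺ b`. -/
def compressedLS {n d k : ℕ} (A : Matrix (Fin n) (Fin d) ℝ) (R : Matrix (Fin d) (Fin k) ℝ)
    (b : Fin n → ℝ) : Fin d → ℝ :=
  R *ᵥ (pinv (A * R) *ᵥ b)

/-- Independent noise terms with mean zero and variance `τ²`. -/
structure IsNoise {Ω : Type*} [MeasurableSpace Ω] (P : Measure Ω) {n : ℕ} (ξ : Fin n → Ω → ℝ)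
    (τ : ℝ) : Prop where
  memLp : ∀ i, MemLp (ξ i) 2 P
  mean : ∀ i, ∫ ω, ξ i ω ∂P = 0
  variance : ∀ i, variance (ξ i) P = τ ^ 2
  indep : iIndepFun ξ P

/-- The random right hand side `b = f + ξ` of the fixed design model. -/
def response {Ω : Type*} {n : ℕ} (f : Fin n → ℝ) (ξ : Fin n → Ω → ℝ) (ω : Ω) : Fin n → ℝ :=
  fun i => f i + ξ i ω

/-- The expected loss `E[‖A x - b‖₂² / n]` of a fixed vector `x`. -/
def expectedLoss {Ω : Type*} [MeasurableSpace Ω] (P : Measure Ω) {n d : ℕ}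
    (A : Matrix (Fin n) (Fin d) ℝ) (b : Ω → Fin n → ℝ) (x : Fin d → ℝ) : ℝ :=
  ∫ ω, l2 (A *ᵥ x - b ω) ^ 2 / n ∂P

/-- `x` is the minimizer `x⋆` of the expected loss that has minimum norm. -/
def IsOptimalPredictor {Ω : Type*} [MeasurableSpace Ω] (P : Measure Ω) {n d : ℕ}
    (A : Matrix (Fin n) (Fin d) ℝ) (b : Ω → Fin n → ℝ) (x : Fin d → ℝ) : Prop :=
  (∀ y, expectedLoss P A b x ≤ expectedLoss P A b y) ∧
    ∀ y, (∀ z, expectedLoss P A b y ≤ expectedLoss P A b z) → l2 x ≤ l2 y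

/-- The excess risk `E[‖A θ - A x⋆‖₂² / n]` of a random estimator `θ` of `x⋆`. -/
def excessRisk {Ω : Type*} [MeasurableSpace Ω] (P : Measure Ω) {n d : ℕ}
    (A : Matrix (Fin n) (Fin d) ℝ) (xstar : Fin d → ℝ) (θ : Ω → Fin d → ℝ) : ℝ :=
  ∫ ω, l2 (A *ᵥ θ ω - A *ᵥ xstar) ^ 2 / n ∂P

/-- Matrices carry the product `σ`-algebra of their entries. -/
instance matrixMeasurableSpace {m n : ℕ} : MeasurableSpace (Matrix (Fin m) (Fin n) ℝ) :=
  inferInstanceAs (MeasurableSpace (Fin m → Fin n → ℝ))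

/-- The `(ε, δ)`-approximate Gram matrix property of a distribution `D` on matrices, for the fixed
matrix `X`. -/
def HasApproxGram {s m n : ℕ} (D : Measure (Matrix (Fin s) (Fin m) ℝ))
    (X : Matrix (Fin m) (Fin n) ℝ) (ε δ : ℝ) : Prop :=
  D {S | ε * specNorm X ^ 2 ≤ specNorm (Xᵀ * Sᵀ * S * X - Xᵀ * X)} ≤ ENNReal.ofReal δ

/-- The accuracy `ν (1 + ν²)^{-1/2} / (1 + ν (1 + ν²)^{-1/2}) · gap_k(A)`. -/
def sketchAccuracy {n d : ℕ} (A : Matrix (Fin n) (Fin d) ℝ) (k : ℕ) (ν : ℝ) : ℝ :=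
  (ν / √(1 + ν ^ 2)) / (1 + ν / √(1 + ν ^ 2)) * relGap A k

/-- The matrix whose `j`-th column is the `h j`-th identity vector times the sign `e j`. -/
def countSketchMatrix {s m : ℕ} (q : (Fin m → Fin s) × (Fin m → ℤˣ)) :
    Matrix (Fin s) (Fin m) ℝ :=
  Matrix.of fun i j => if q.1 j = i then (((q.2 j : ℤˣ) : ℤ) : ℝ) else 0

/-- The distribution of a CountSketch matrix: the columns are independent, each of them a uniformly
random identity vector multiplied by an independent random sign. -/
def countSketch (s m : ℕ) [NeZero s] : Measure (Matrix (Fin s) (Fin m) ℝ) :=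
  ((PMF.uniformOfFintype ((Fin m → Fin s) × (Fin m → ℤˣ))).map countSketchMatrix).toMeasure

/-- The distribution of an `s × m` matrix with i.i.d. entries from `D`, scaled by
`(s · Var D)^{-1/2}`. -/
def iidSketch (s m : ℕ) (D : Measure ℝ) : Measure (Matrix (Fin s) (Fin m) ℝ) :=
  (Measure.pi fun _ : Fin s × Fin m => D).map fun Z =>
    Matrix.of fun i j => Z (i, j) / √(s * variance id D)

/-- A subgaussian distribution of positive variance: it is centered and its moment generating
function at `t` is at most `exp (κ · Var D · t² / 2)`. -/
structure IsSubgaussian (D : Measure ℝ) (κ : ℝ≥0) : Prop where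
  prob : IsProbabilityMeasure D
  variance_pos : 0 < variance id D
  mgf : HasSubgaussianMGF id (κ * (variance id D).toNNReal) D

end

end SketchedPCR

open SketchedPCR

/-! Statement 1 is deterministic once the Gram error `e = ‖AᵀSᵀSA - AᵀA‖` is small. Write `g = σ_k²
- σ_{k+1}²`. Weyl's inequality gives `σ_k(SA)² ≥ σ_k² - e`. The sin Θ bound
`IsSplit.norm_orthogonal_part_le` then shows that the sine of the largest angle between the top
right singular spaces of `SA` and `A` is at most `e / (g - e)`. The prescribed accuracy is the value
of `e` at which this equals `ν/√(1+ν²)`, the sine of `arctan ν`. So the range of `R` is a graph of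
slope at most `ν` over the range of `V_{A,k}` (`slope_top_le`). On that space `A` stretches by at
least `σ_k`, on its complement by at most `σ_{k+1}`, and the two images are orthogonal. Exchanging a
vector of one space for its partner in the other therefore changes the fit by a relative error `ν
σ_{k+1}/σ_k` at most. The excess risk follows from a bias-variance split, since `A x_R` is the
orthogonal projection of `b` onto a space of dimension at most `k`.

For CountSketch, the expected squared Frobenius norm of the Gram error is at most `2‖A‖_F⁴/s`, and
Chebyshev's inequality finishes.

For subgaussian maps the bound must involve the stable rank but not the dimension. The singular
directions are grouped into blocks of `m ≈ sr(A) + log(1/δ)`. The squared leading singular values of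
the blocks sum to at most `2‖A‖²` (`sum_block_weight_le`). On a pair of blocks, the form `⟪Sx,Sy⟫ -
⟪x,y⟫` is controlled by nets of `5^m` points. The pairs are combined by Jensen's inequality with
weights of total mass 1 instead of a union bound, so the number of blocks does not matter. Markov's
inequality for the moment of order `2m` gives failure probability at most `δ`. -/

namespace SketchedPCR

/-! ### Perturbation of dominant singular subspaces. -/

section Splitting

variable {E F G : Type*} [NormedAddCommGroup E] [InnerProductSpace ℝ E]
  [NormedAddCommGroup F] [InnerProductSpace ℝ F] [NormedAddCommGroup G] [InnerProductSpace ℝ G]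

/-- `W` is spanned by right singular vectors of `T` with singular values at least `a`, and the
remaining singular values are at most `a'`. -/
structure IsSplit (T : E →ₗ[ℝ] F) (W : Submodule ℝ E) (a a' : ℝ) : Prop where
  orth : ∀ w ∈ W, ∀ y ∈ Wᗮ, inner ℝ (T w) (T y) = 0
  lower : ∀ w ∈ W, a * ‖w‖ ≤ ‖T w‖
  upper : ∀ y ∈ Wᗮ, ‖T y‖ ≤ a' * ‖y‖

/-- Weyl's inequality by a dimension count: `W ⊓ W'ᗮ` contains a nonzero vector, on which both
stretching bounds apply. -/
theorem sq_le_of_perturbation [FiniteDimensional ℝ E] {T : E →ₗ[ℝ] F} {T' : E →ₗ[ℝ] G}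
    {W W' : Submodule ℝ E} {a a' e : ℝ}
    (hW : ∀ w ∈ W, a * ‖w‖ ≤ ‖T w‖) (hW' : ∀ w ∈ W'ᗮ, ‖T' w‖ ≤ a' * ‖w‖) (ha : 0 ≤ a)
    (hc : Module.finrank ℝ W' < Module.finrank ℝ W)
    (he : ∀ x, ‖T x‖ ^ 2 ≤ ‖T' x‖ ^ 2 + e * ‖x‖ ^ 2) : a ^ 2 ≤ a' ^ 2 + e := by
  have h1 : 0 < Module.finrank ℝ (W ⊓ W'ᗮ : Submodule ℝ E) := by
    have h := Submodule.finrank_sup_add_finrank_inf_eq W W'ᗮ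
    have h2 := Submodule.finrank_add_finrank_orthogonal W'
    have h3 := Submodule.finrank_le (W ⊔ W'ᗮ)
    omega
  obtain ⟨⟨w, hw⟩, hw0⟩ := Module.finrank_pos_iff_exists_ne_zero.1 h1
  have hw0 : 0 < ‖w‖ := norm_pos_iff.2 fun h => hw0 (Subtype.ext h)
  have h4 := hW w hw.1
  have h5 := hW' w hw.2
  have h6 := he w
  have h7 : (a * ‖w‖) ^ 2 ≤ (a' * ‖w‖) ^ 2 + e * ‖w‖ ^ 2 := by
    have := pow_le_pow_left₀ (by positivity) h4 2
    have := pow_le_pow_left₀ (norm_nonneg _) h5 2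
    linarith
  have h8 : a ^ 2 * ‖w‖ ^ 2 ≤ (a' ^ 2 + e) * ‖w‖ ^ 2 := by linarith
  exact le_of_mul_le_mul_right h8 (by positivity)

/-- A `sin Θ` theorem: the part of `W'` orthogonal to `W` is small. -/
theorem IsSplit.norm_orthogonal_part_le [FiniteDimensional ℝ E] [FiniteDimensional ℝ G]
    {T : E →ₗ[ℝ] F} {T' : E →ₗ[ℝ] G} {W W' : Submodule ℝ E} {a a' b b' e : ℝ}
    (hT : IsSplit T W a a') (hT' : IsSplit T' W' b b') (hb : 0 < b) (ha' : 0 ≤ a') (he0 : 0 ≤ e)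
    (hab : a' < b)
    (he : ∀ x y, |inner ℝ (T' x) (T' y) - inner ℝ (T x) (T y)| ≤ e * ‖x‖ * ‖y‖)
    {r : E} (hr : r ∈ W') :
    ‖Wᗮ.starProjection r‖ ≤ e / (b ^ 2 - a' ^ 2) * ‖r‖ := by
  set Q := Wᗮ.starProjection with hQ
  -- `c` is the sine of the largest angle from `W'` to `W`. It will be bounded by an affine function
  -- of itself.
  set c := ‖Q ∘L W'.starProjection‖ with hc
  have hcle : ∀ z ∈ W', ‖Q z‖ ≤ c * ‖z‖ := by
    intro z hz
    have := (Q ∘L W'.starProjection).le_opNorm z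
    rwa [ContinuousLinearMap.comp_apply, Submodule.starProjection_eq_self_iff.2 hz] at this
  -- `N` compresses the Gram operator of `T'` to `W'`. The split makes `W'` invariant, so no
  -- information is lost, and `b > 0` makes `N` invertible: every `r` in `W'` is the Gram operator
  -- applied to some `z` in `W'`.
  let N : W' →ₗ[ℝ] W' := W'.orthogonalProjectionOnto.toLinearMap ∘ₗ
    (LinearMap.adjoint T' ∘ₗ T') ∘ₗ W'.subtype
  have hN : ∀ (z : W') (y : E), inner ℝ (N z : E) y = inner ℝ (T' z) (T' y) := by
    intro z y
    obtain ⟨p, hp, q, hq, rfl⟩ := W'.exists_add_mem_mem_orthogonal y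
    have h1 : inner ℝ (T' z) (T' q) = 0 := hT'.orth _ z.2 _ hq
    have h2 : inner ℝ (N z : E) q = 0 := hq _ (N z).2
    rw [map_add, inner_add_right, inner_add_right, h1, h2, add_zero, add_zero]
    have h3 : inner ℝ (N z : E) p = inner ℝ (LinearMap.adjoint T' (T' z)) p := by
      have := Submodule.inner_orthogonalProjectionOnto_eq_of_mem_right ⟨p, hp⟩ (LinearMap.adjoint T' (T' z))
      exact this
    rw [h3, LinearMap.adjoint_inner_left]
  have hNlow : ∀ z : W', b ^ 2 * ‖z‖ ≤ ‖N z‖ := by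
    intro z
    have h1 : (b * ‖(z : E)‖) ^ 2 ≤ ‖T' z‖ ^ 2 :=
      pow_le_pow_left₀ (by positivity) (hT'.lower _ z.2) 2
    rw [← real_inner_self_eq_norm_sq, ← hN] at h1
    have h2 := real_inner_le_norm (N z : E) z
    rcases eq_or_lt_of_le (norm_nonneg (z : E)) with h0 | h0
    · have : ‖z‖ = 0 := h0.symm
      rw [this]; simp
    · have : b ^ 2 * ‖(z : E)‖ * ‖(z : E)‖ ≤ ‖(N z : E)‖ * ‖(z : E)‖ := by linarith
      exact le_of_mul_le_mul_right this h0
  have hNinj : Function.Injective N := by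
    rw [injective_iff_map_eq_zero]
    intro z hz
    have := hNlow z
    rw [hz, norm_zero] at this
    have h2 : ‖z‖ ≤ 0 := by
      by_contra h
      push Not at h
      have : 0 < b ^ 2 * ‖z‖ := by positivity
      linarith
    exact norm_le_zero_iff.1 h2
  have hNsurj : Function.Surjective N := LinearMap.injective_iff_surjective.1 hNinj
  have key : ∀ r ∈ W', ‖Q r‖ ≤ (a' ^ 2 * c + e) / b ^ 2 * ‖r‖ := by
    intro r hr
    obtain ⟨z, hz⟩ := hNsurj ⟨r, hr⟩
    have hz' : (N z : E) = r := congrArg Subtype.val hz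
    -- Passing from `T'` to `T` costs `e`; after that only `Q z` contributes, because `T` maps `W`
    -- and `Wᗮ` to orthogonal spaces.
    have h1 : ‖Q r‖ ^ 2 ≤ a' ^ 2 * ‖Q z‖ * ‖Q r‖ + e * ‖z‖ * ‖Q r‖ := by
      have e1 : ‖Q r‖ ^ 2 = inner ℝ r (Q r) := by
        rw [← real_inner_self_eq_norm_sq, hQ, Submodule.inner_starProjection_left_eq_right,
          Submodule.starProjection_eq_self_iff.2 (Submodule.starProjection_apply_mem _ _)]
      have e2 : inner ℝ r (Q r) = inner ℝ (T' z) (T' (Q r)) := by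
        rw [← hN, hz']
      have e3 := (abs_le.1 (he z (Q r))).2
      have e4 : inner ℝ (T z) (T (Q r)) = inner ℝ (T (Q z)) (T (Q r)) := by
        have : (z : E) = W.starProjection z + Q z := by
          rw [hQ]; exact (Submodule.starProjection_add_starProjection_orthogonal (K := W) (z : E)).symm
        conv_lhs => rw [this]
        rw [map_add, inner_add_left, hT.orth _ (Submodule.starProjection_apply_mem _ _) _
          (Submodule.starProjection_apply_mem _ _), zero_add]
      have e5 : inner ℝ (T (Q z)) (T (Q r)) ≤ a' * ‖Q z‖ * (a' * ‖Q r‖) :=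
        (real_inner_le_norm _ _).trans (mul_le_mul
          (hT.upper _ (Submodule.starProjection_apply_mem _ _))
          (hT.upper _ (Submodule.starProjection_apply_mem _ _)) (norm_nonneg _) (by positivity))
      have e6 : ‖(z : E)‖ = ‖z‖ := rfl
      rw [e6] at e3
      linarith
    have h2 : ‖Q r‖ ≤ a' ^ 2 * ‖Q z‖ + e * ‖z‖ := by
      rcases eq_or_lt_of_le (norm_nonneg (Q r)) with h0 | h0
      · rw [← h0]; positivity
      · have : ‖Q r‖ * ‖Q r‖ ≤ (a' ^ 2 * ‖Q z‖ + e * ‖z‖) * ‖Q r‖ := by linarith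
        exact le_of_mul_le_mul_right this h0
    have h3 := hcle z z.2
    have h4 := hNlow z
    have h5 : ‖N z‖ = ‖r‖ := by rw [hz]; rfl
    rw [h5] at h4
    have h6 : ‖z‖ ≤ ‖r‖ / b ^ 2 := by rw [le_div_iff₀ (by positivity)]; linarith
    have hc0 : 0 ≤ c := norm_nonneg _
    calc ‖Q r‖ ≤ a' ^ 2 * (c * ‖z‖) + e * ‖z‖ := by
          refine h2.trans (add_le_add_left (mul_le_mul_of_nonneg_left h3 (by positivity)) _)
      _ = (a' ^ 2 * c + e) * ‖z‖ := by ring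
      _ ≤ (a' ^ 2 * c + e) * (‖r‖ / b ^ 2) := mul_le_mul_of_nonneg_left h6 (by positivity)
      _ = _ := by ring
  have hc0 : 0 ≤ c := norm_nonneg _
  have hcb : c ≤ (a' ^ 2 * c + e) / b ^ 2 := by
    refine ContinuousLinearMap.opNorm_le_bound _ (by positivity) fun x => ?_
    rw [ContinuousLinearMap.comp_apply]
    refine (key _ (Submodule.starProjection_apply_mem _ _)).trans
      (mul_le_mul_of_nonneg_left ?_ (by positivity))
    exact Submodule.norm_starProjection_apply_le _ _
  have hgap : 0 < b ^ 2 - a' ^ 2 := by nlinarith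
  rw [le_div_iff₀ (by positivity)] at hcb
  have : c ≤ e / (b ^ 2 - a' ^ 2) := by rw [le_div_iff₀ hgap]; linarith
  exact (hcle r hr).trans (mul_le_mul_of_nonneg_right this (norm_nonneg _))

/-- If `W'` is a graph of small slope over `W`, every element of `W` lifts to `W'`. -/
theorem exists_mem_starProjection_eq [FiniteDimensional ℝ E] {W W' : Submodule ℝ E} {ν : ℝ}
    (hdim : Module.finrank ℝ W' = Module.finrank ℝ W)
    (h : ∀ r ∈ W', ‖Wᗮ.starProjection r‖ ≤ ν * ‖W.starProjection r‖) {p : E} (hp : p ∈ W) :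
    ∃ r ∈ W', W.starProjection r = p := by
  let f : W' →ₗ[ℝ] W := W.orthogonalProjectionOnto.toLinearMap ∘ₗ W'.subtype
  have hf : Function.Injective f := by
    rw [injective_iff_map_eq_zero]
    intro z hz
    have h1 : W.starProjection (z : E) = 0 := congrArg Subtype.val hz
    have h2 := h z z.2
    rw [h1, norm_zero, mul_zero, norm_le_zero_iff] at h2
    have h3 := Submodule.starProjection_add_starProjection_orthogonal (K := W) (z : E)
    rw [h1, h2, add_zero] at h3
    exact Subtype.ext h3.symm
  have hs : Function.Surjective f := (LinearMap.injective_iff_surjective_of_finrank_eq_finrank hdim).1 hf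
  obtain ⟨r, hr⟩ := hs ⟨p, hp⟩
  exact ⟨r, r.2, congrArg Subtype.val hr⟩

theorem norm_sq_starProjection_add [FiniteDimensional ℝ E] (W : Submodule ℝ E) (x : E) :
    ‖x‖ ^ 2 = ‖W.starProjection x‖ ^ 2 + ‖Wᗮ.starProjection x‖ ^ 2 := by
  have h := Submodule.starProjection_add_starProjection_orthogonal (K := W) x
  conv_lhs => rw [← h]
  have h0 : inner ℝ (W.starProjection x) (Wᗮ.starProjection x) = 0 :=
    (Submodule.starProjection_apply_mem Wᗮ x) _ (Submodule.starProjection_apply_mem W x)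
  have := norm_add_sq_eq_norm_sq_add_norm_sq_of_inner_eq_zero _ _ h0
  nlinarith

/-- `ν/√(1+ν²)` is the sine of `arctan ν`, so a bound on the sine becomes the bound `ν` on the
tangent. -/
theorem slope_le_of_sin_le [FiniteDimensional ℝ E] {W : Submodule ℝ E} {ν : ℝ} (hν : 0 < ν) {r : E}
    (h : ‖Wᗮ.starProjection r‖ ≤ ν / √(1 + ν ^ 2) * ‖r‖) :
    ‖Wᗮ.starProjection r‖ ≤ ν * ‖W.starProjection r‖ := by
  have h1 := norm_sq_starProjection_add W r
  have h2 := pow_le_pow_left₀ (norm_nonneg _) h 2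
  rw [mul_pow, div_pow, Real.sq_sqrt (by positivity), h1, div_mul_eq_mul_div,
    le_div_iff₀ (by positivity)] at h2
  refine le_of_sq_le_sq ?_ (by positivity)
  nlinarith

variable [FiniteDimensional ℝ E] {T : E →ₗ[ℝ] F} {W W' : Submodule ℝ E} {a a' ν : ℝ}

theorem IsSplit.norm_sq_map (hT : IsSplit T W a a') (x : E) :
    ‖T x‖ ^ 2 = ‖T (W.starProjection x)‖ ^ 2 + ‖T (Wᗮ.starProjection x)‖ ^ 2 := by
  have h := Submodule.starProjection_add_starProjection_orthogonal (K := W) x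
  conv_lhs => rw [← h, map_add]
  have := norm_add_sq_eq_norm_sq_add_norm_sq_of_inner_eq_zero _ _
    (hT.orth _ (Submodule.starProjection_apply_mem W x) _ (Submodule.starProjection_apply_mem Wᗮ x))
  nlinarith

theorem IsSplit.norm_map_le (hT : IsSplit T W a a') (x : E) :
    ‖T (W.starProjection x)‖ ≤ ‖T x‖ := by
  refine le_of_sq_le_sq ?_ (norm_nonneg _)
  rw [hT.norm_sq_map x]
  nlinarith [sq_nonneg ‖T (Wᗮ.starProjection x)‖]

theorem IsSplit.norm_map_orthogonal_le (hT : IsSplit T W a a') (ha : 0 < a) (ha' : 0 ≤ a')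
    (hν : 0 < ν) {r : E} (h : ‖Wᗮ.starProjection r‖ ≤ ν * ‖W.starProjection r‖) :
    ‖T (Wᗮ.starProjection r)‖ ≤ a' / a * ν * ‖T (W.starProjection r)‖ := by
  have h1 := hT.lower _ (Submodule.starProjection_apply_mem W r)
  have h2 := hT.upper _ (Submodule.starProjection_apply_mem Wᗮ r)
  calc _ ≤ a' * (ν * ‖W.starProjection r‖) := h2.trans (mul_le_mul_of_nonneg_left h ha')
    _ = a' / a * ν * (a * ‖W.starProjection r‖) := by field_simp
    _ ≤ _ := mul_le_mul_of_nonneg_left h1 (by positivity)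

theorem norm_le_of_inner_sub_eq_zero {u b : F} (h : inner ℝ (u - b) u = 0) : ‖u‖ ≤ ‖b‖ := by
  rw [inner_sub_left, sub_eq_zero, real_inner_self_eq_norm_sq] at h
  have := real_inner_le_norm b u
  rcases eq_or_lt_of_le (norm_nonneg u) with h0 | h0
  · rw [← h0]; exact norm_nonneg _
  · exact le_of_mul_le_mul_right (by nlinarith) h0

/-- Each minimizer is compared with a competitor in the other space: `y` is projected to `W`, and
`x` is lifted to `W'`. Either exchange alters the fit by the image of a `Wᗮ`-component, which the
slope bound controls. -/
theorem IsSplit.abs_residual_sub_le (hT : IsSplit T W a a') (ha : 0 < a) (ha' : 0 ≤ a')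
    (hν : 0 < ν) (hdim : Module.finrank ℝ W' = Module.finrank ℝ W)
    (h : ∀ r ∈ W', ‖Wᗮ.starProjection r‖ ≤ ν * ‖W.starProjection r‖) {x y : E} {b : F}
    (hx : x ∈ W) (hy : y ∈ W') (hxo : ∀ z ∈ W, inner ℝ (T x - b) (T z) = 0)
    (hxm : ∀ z ∈ W, ‖T x - b‖ ≤ ‖T z - b‖)
    (hyo : ∀ z ∈ W', inner ℝ (T y - b) (T z) = 0) (hym : ∀ z ∈ W', ‖T y - b‖ ≤ ‖T z - b‖) :
    |‖T y - b‖ - ‖T x - b‖| ≤ a' / a * ν * ‖b‖ := by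
  have hxb : ‖T x‖ ≤ ‖b‖ := norm_le_of_inner_sub_eq_zero (hxo x hx)
  have hyb : ‖T y‖ ≤ ‖b‖ := norm_le_of_inner_sub_eq_zero (hyo y hy)
  have hdec : ∀ r, T r = T (W.starProjection r) + T (Wᗮ.starProjection r) := fun r => by
    rw [← map_add, Submodule.starProjection_add_starProjection_orthogonal (K := W) r]
  rw [abs_le]
  constructor
  · have h1 := hxm _ (Submodule.starProjection_apply_mem W y)
    have h2 := hT.norm_map_orthogonal_le ha ha' hν (h y hy)
    have h3 := (hT.norm_map_le y).trans hyb
    have h4 : ‖T (W.starProjection y) - b‖ ≤ ‖T y - b‖ + ‖T (Wᗮ.starProjection y)‖ := by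
      have : T (W.starProjection y) - b = (T y - b) - T (Wᗮ.starProjection y) := by
        rw [hdec y]; abel
      rw [this]; exact norm_sub_le _ _
    have h5 := mul_le_mul_of_nonneg_left h3 (by positivity : 0 ≤ a' / a * ν)
    linarith
  · obtain ⟨r, hr, hrx⟩ := exists_mem_starProjection_eq hdim h hx
    have h1 := hym r hr
    have h2 := hT.norm_map_orthogonal_le ha ha' hν (h r hr)
    rw [hrx] at h2
    have h4 : ‖T r - b‖ ≤ ‖T x - b‖ + ‖T (Wᗮ.starProjection r)‖ := by
      have : T r - b = (T x - b) + T (Wᗮ.starProjection r) := by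
        rw [hdec r, hrx]; abel
      rw [this]; exact norm_add_le _ _
    have h5 := mul_le_mul_of_nonneg_left hxb (by positivity : 0 ≤ a' / a * ν)
    linarith

/-- The slope bound reduces this to the `W`-component, for which `a ‖P_W y‖ ≤ ‖T y‖ ≤ ‖b‖`. -/
theorem IsSplit.norm_orthogonal_le_div (hT : IsSplit T W a a') (ha : 0 < a) (hν : 0 < ν)
    {y : E} {b : F} (h : ‖Wᗮ.starProjection y‖ ≤ ν * ‖W.starProjection y‖)
    (hyo : inner ℝ (T y - b) (T y) = 0) : ‖Wᗮ.starProjection y‖ ≤ ν / a * ‖b‖ := by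
  have hyb : ‖T y‖ ≤ ‖b‖ := norm_le_of_inner_sub_eq_zero hyo
  have h1 := hT.lower _ (Submodule.starProjection_apply_mem W y)
  have h3 := (hT.norm_map_le y).trans hyb
  have h4 : ‖W.starProjection y‖ ≤ ‖b‖ / a := by rw [le_div_iff₀ ha]; linarith
  calc _ ≤ ν * (‖b‖ / a) := h.trans (mul_le_mul_of_nonneg_left h4 hν.le)
    _ = _ := by ring

/-- Take `r` with the same `W`-component as `x`. The difference then lies in `Wᗮ`, where `T`
stretches by at most `a'`. This will bound the bias. -/
theorem IsSplit.exists_norm_map_sub_sq_le (hT : IsSplit T W a a') (hν : 0 < ν)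
    (hν1 : ν ≤ 1) (hdim : Module.finrank ℝ W' = Module.finrank ℝ W)
    (h : ∀ r ∈ W', ‖Wᗮ.starProjection r‖ ≤ ν * ‖W.starProjection r‖) (x : E) :
    ∃ r ∈ W', ‖T r - T x‖ ^ 2 ≤ (1 + ν) * ‖x‖ ^ 2 * a' ^ 2 := by
  obtain ⟨r, hr, hrx⟩ := exists_mem_starProjection_eq hdim h (Submodule.starProjection_apply_mem W x)
  refine ⟨r, hr, ?_⟩
  set p := W.starProjection x
  set q := Wᗮ.starProjection x
  set q' := Wᗮ.starProjection r
  have hx : p + q = x := Submodule.starProjection_add_starProjection_orthogonal (K := W) x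
  have hr' : p + q' = r := by
    rw [← hrx]; exact Submodule.starProjection_add_starProjection_orthogonal (K := W) r
  have h1 : T r - T x = T (q' - q) := by rw [← map_sub, ← hx, ← hr']; congr 1; abel
  have h2 := hT.upper (q' - q) (Submodule.sub_mem _ (Submodule.starProjection_apply_mem _ _)
    (Submodule.starProjection_apply_mem _ _))
  have h3 : ‖q'‖ ≤ ν * ‖p‖ := by have := h r hr; rwa [hrx] at this
  have h4 := norm_sub_le q' q
  have h5 : ‖x‖ ^ 2 = ‖p‖ ^ 2 + ‖q‖ ^ 2 := norm_sq_starProjection_add W x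
  have h6 : ‖q' - q‖ ^ 2 ≤ (1 + ν) * ‖x‖ ^ 2 := by
    have : ‖q' - q‖ ^ 2 ≤ (ν * ‖p‖ + ‖q‖) ^ 2 :=
      pow_le_pow_left₀ (norm_nonneg _) (by linarith) 2
    -- Cauchy-Schwarz; afterwards `ν ≤ 1` weakens `ν²` to `ν`.
    have h7 : (ν * ‖p‖ + ‖q‖) ^ 2 ≤ (1 + ν ^ 2) * (‖p‖ ^ 2 + ‖q‖ ^ 2) := by
      nlinarith [sq_nonneg (‖p‖ - ν * ‖q‖)]
    rw [h5]
    refine this.trans (h7.trans (mul_le_mul_of_nonneg_right ?_ (by positivity)))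
    nlinarith
  rw [h1]
  calc _ ≤ (a' * ‖q' - q‖) ^ 2 := pow_le_pow_left₀ (norm_nonneg _) h2 2
    _ = ‖q' - q‖ ^ 2 * a' ^ 2 := by ring
    _ ≤ _ := mul_le_mul_of_nonneg_right h6 (by positivity)

end Splitting

/-! ### Thin singular value decompositions, spectral norm and pseudo-inverse. -/

section SVD

variable {m n : ℕ} {X : Matrix (Fin m) (Fin n) ℝ}

theorem orthonormal_toLp_col {ι κ : Type*} [Fintype ι] [DecidableEq κ]
    {V : Matrix ι κ ℝ} (h : Vᵀ * V = 1) :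
    Orthonormal ℝ fun i => WithLp.toLp 2 (V.col i) := by
  rw [orthonormal_iff_ite]
  intro i j
  have := congrFun (congrFun h i) j
  rw [Matrix.mul_apply, Matrix.one_apply] at this
  rw [PiLp.inner_apply, ← this]
  simp [Matrix.transpose_apply, Matrix.col, mul_comm]

/-- The right singular vectors. -/
def ThinSVD.right (svd : ThinSVD X) (i : Fin (min m n)) : EuclideanSpace ℝ (Fin n) :=
  WithLp.toLp 2 (svd.V.col i)

/-- The left singular vectors. -/
def ThinSVD.left (svd : ThinSVD X) (i : Fin (min m n)) : EuclideanSpace ℝ (Fin m) :=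
  WithLp.toLp 2 (svd.U.col i)

theorem ThinSVD.orthonormal_right (svd : ThinSVD X) : Orthonormal ℝ svd.right :=
  orthonormal_toLp_col svd.V_orthonormal

theorem ThinSVD.orthonormal_left (svd : ThinSVD X) : Orthonormal ℝ svd.left :=
  orthonormal_toLp_col svd.U_orthonormal

theorem sigma_nonneg (X : Matrix (Fin m) (Fin n) ℝ) (i : ℕ) : 0 ≤ sigma X i :=
  LinearMap.singularValues_nonneg _ _

theorem sigma_antitone (X : Matrix (Fin m) (Fin n) ℝ) : Antitone (sigma X) := fun _ _ h =>
  LinearMap.singularValues_antitone _ (Nat.sub_le_sub_right h 1)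

theorem ThinSVD.apply_eq_sum (svd : ThinSVD X) (y : EuclideanSpace ℝ (Fin n)) :
    Matrix.toEuclideanLin X y = ∑ i : Fin (min m n), (sigma X (i + 1) * inner ℝ (svd.right i) y) • svd.left i := by
  ext a
  rw [Matrix.toLpLin_apply]
  conv_lhs => rw [svd.eq_mul, ← Matrix.mulVec_mulVec, ← Matrix.mulVec_mulVec]
  simp only [WithLp.ofLp_sum, Finset.sum_apply, PiLp.smul_apply, smul_eq_mul]
  rw [Matrix.mulVec, dotProduct]
  refine Finset.sum_congr rfl fun i _ => ?_
  rw [Matrix.mulVec_diagonal, PiLp.inner_apply]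
  simp only [ThinSVD.left, ThinSVD.right, Matrix.col_apply, Matrix.mulVec, dotProduct,
    Matrix.transpose_apply, RCLike.inner_apply, conj_trivial]
  rw [mul_comm]
  congr 2
  exact Finset.sum_congr rfl fun _ _ => mul_comm _ _

theorem ThinSVD.inner_apply_apply (svd : ThinSVD X) (x y : EuclideanSpace ℝ (Fin n)) :
    inner ℝ (Matrix.toEuclideanLin X x) (Matrix.toEuclideanLin X y)
      = ∑ i : Fin (min m n), sigma X (i + 1) ^ 2 * inner ℝ (svd.right i) x * inner ℝ (svd.right i) y := by
  rw [svd.apply_eq_sum x, svd.apply_eq_sum y, svd.orthonormal_left.inner_sum]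
  refine Finset.sum_congr rfl fun i _ => ?_
  rw [conj_trivial]; ring

theorem ThinSVD.norm_apply_sq (svd : ThinSVD X) (y : EuclideanSpace ℝ (Fin n)) :
    ‖Matrix.toEuclideanLin X y‖ ^ 2
      = ∑ i : Fin (min m n), sigma X (i + 1) ^ 2 * inner ℝ (svd.right i) y ^ 2 := by
  rw [← real_inner_self_eq_norm_sq, svd.inner_apply_apply]
  exact Finset.sum_congr rfl fun i _ => by ring

theorem ThinSVD.sum_inner_sq_le (svd : ThinSVD X) (s : Finset (Fin (min m n)))
    (y : EuclideanSpace ℝ (Fin n)) : ∑ i ∈ s, inner ℝ (svd.right i) y ^ 2 ≤ ‖y‖ ^ 2 := by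
  have := svd.orthonormal_right.sum_inner_products_le (s := s) y
  simpa using this

/-- The span of the first `k` right singular vectors. -/
def ThinSVD.top (svd : ThinSVD X) {k : ℕ} (hk : k ≤ min m n) :
    Submodule ℝ (EuclideanSpace ℝ (Fin n)) :=
  Submodule.span ℝ (Set.range fun i : Fin k => svd.right (Fin.castLE hk i))

theorem ThinSVD.finrank_top (svd : ThinSVD X) {k : ℕ} (hk : k ≤ min m n) :
    Module.finrank ℝ (svd.top hk) = k := by
  have := (svd.orthonormal_right.comp _ (Fin.castLE_injective hk)).linearIndependent
  exact (finrank_span_eq_card this).trans (Fintype.card_fin k)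

theorem ThinSVD.inner_right_of_mem_top (svd : ThinSVD X) {k : ℕ} (hk : k ≤ min m n)
    {y : EuclideanSpace ℝ (Fin n)} (hy : y ∈ svd.top hk) {i : Fin (min m n)} (hi : k ≤ i) :
    inner ℝ (svd.right i) y = 0 := by
  refine Submodule.span_induction ?_ (inner_zero_right _) ?_ ?_ hy
  · rintro _ ⟨j, rfl⟩
    refine svd.orthonormal_right.2 fun h => ?_
    have := congrArg Fin.val h
    simp at this
    omega
  · intro x y _ _ hx hy
    rw [inner_add_right, hx, hy, add_zero]
  · intro c x _ hx
    rw [inner_smul_right, hx, mul_zero]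

theorem ThinSVD.inner_right_of_mem_top_orthogonal (svd : ThinSVD X) {k : ℕ} (hk : k ≤ min m n)
    {y : EuclideanSpace ℝ (Fin n)} (hy : y ∈ (svd.top hk)ᗮ) {i : Fin (min m n)} (hi : i < k) :
    inner ℝ (svd.right i) y = 0 :=
  hy _ (Submodule.subset_span ⟨⟨i, hi⟩, rfl⟩)

theorem ThinSVD.norm_sq_of_mem_top (svd : ThinSVD X) {k : ℕ} (hk : k ≤ min m n)
    {y : EuclideanSpace ℝ (Fin n)} (hy : y ∈ svd.top hk) :
    ‖y‖ ^ 2 = ∑ i, inner ℝ (svd.right i) y ^ 2 := by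
  have hmem : y ∈ Submodule.span ℝ (Set.range svd.right) :=
    Submodule.span_mono (by rintro _ ⟨i, rfl⟩; exact ⟨_, rfl⟩) hy
  obtain ⟨c, rfl⟩ := (Submodule.mem_span_range_iff_exists_fun ℝ).1 hmem
  rw [← real_inner_self_eq_norm_sq, svd.orthonormal_right.inner_sum]
  refine Finset.sum_congr rfl fun i _ => ?_
  rw [svd.orthonormal_right.inner_right_fintype, conj_trivial]; ring

/-- The case `k = 0` is meaningful: the top space is trivial and `σ_1` bounds the whole map. It
gives the spectral norm, and Weyl's inequality for `k = 1`. -/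
theorem ThinSVD.isSplit (svd : ThinSVD X) {k : ℕ} (hk : k ≤ min m n) :
    IsSplit (Matrix.toEuclideanLin X) (svd.top hk) (sigma X k) (sigma X (k + 1)) where
  orth w hw y hy := by
    rw [svd.inner_apply_apply]
    refine Finset.sum_eq_zero fun i _ => ?_
    rcases lt_or_ge (i : ℕ) k with h | h
    · rw [svd.inner_right_of_mem_top_orthogonal hk hy h, mul_zero]
    · rw [svd.inner_right_of_mem_top hk hw h, mul_zero, zero_mul]
  lower w hw := by
    refine le_of_sq_le_sq ?_ (norm_nonneg _)
    rw [mul_pow, svd.norm_apply_sq, svd.norm_sq_of_mem_top hk hw, Finset.mul_sum]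
    refine Finset.sum_le_sum fun i _ => ?_
    rcases lt_or_ge (i : ℕ) k with h | h
    · exact mul_le_mul_of_nonneg_right (pow_le_pow_left₀ (sigma_nonneg _ _)
        (sigma_antitone X (by omega)) 2) (sq_nonneg _)
    · rw [svd.inner_right_of_mem_top hk hw h]; simp
  upper y hy := by
    refine le_of_sq_le_sq ?_ (mul_nonneg (sigma_nonneg _ _) (norm_nonneg _))
    rw [mul_pow, svd.norm_apply_sq]
    refine (?_ : _ ≤ sigma X (k + 1) ^ 2 * ∑ i, inner ℝ (svd.right i) y ^ 2).trans (mul_le_mul_of_nonneg_left (svd.sum_inner_sq_le Finset.univ y) (sq_nonneg _))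
    rw [Finset.mul_sum]
    refine Finset.sum_le_sum fun i _ => ?_
    rcases lt_or_ge (i : ℕ) k with h | h
    · rw [svd.inner_right_of_mem_top_orthogonal hk hy h]; simp
    · exact mul_le_mul_of_nonneg_right (pow_le_pow_left₀ (sigma_nonneg _ _)
        (sigma_antitone X (by omega)) 2) (sq_nonneg _)

theorem toLp_mem_top_iff (svd : ThinSVD X) {k : ℕ} (hk : k ≤ min m n) (x : Fin n → ℝ) :
    WithLp.toLp 2 x ∈ svd.top hk ↔ x ∈ LinearMap.range (firstCols svd.V hk).mulVecLin := by
  rw [ThinSVD.top, Submodule.mem_span_range_iff_exists_fun]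
  have : ∀ c : Fin k → ℝ, (∑ i, c i • svd.right (Fin.castLE hk i) = WithLp.toLp 2 x) ↔
      (firstCols svd.V hk).mulVecLin c = x := by
    intro c
    rw [← (WithLp.ofLp_injective 2).eq_iff, WithLp.ofLp_sum]
    have : ∑ i, (c i • svd.right (Fin.castLE hk i)).ofLp = (firstCols svd.V hk).mulVecLin c := by
      ext a
      simp [firstCols, Matrix.mulVec, dotProduct, ThinSVD.right, mul_comm]
    rw [this]
  simp only [this]
  rfl

/-- Only an inequality: if `n < d`, the columns of the thin `V` do not span the space and the later
ones can miss part of the complement. -/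
theorem l2_lastCols_le (svd : ThinSVD X) {k : ℕ} (hk : k ≤ min m n) (x : Fin n → ℝ) :
    l2 ((lastCols svd.V k)ᵀ *ᵥ x) ≤ ‖(svd.top hk)ᗮ.starProjection (WithLp.toLp 2 x)‖ := by
  set y := (svd.top hk)ᗮ.starProjection (WithLp.toLp 2 x)
  refine le_of_sq_le_sq ?_ (norm_nonneg _)
  rw [l2, EuclideanSpace.norm_sq_eq]
  refine le_trans (le_of_eq ?_)
    (svd.sum_inner_sq_le (Finset.univ.filter fun i : Fin (min m n) => k ≤ (i : ℕ)) y)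
  rw [Finset.sum_subtype (Finset.univ.filter fun i : Fin (min m n) => k ≤ (i : ℕ))
    (p := fun i : Fin (min m n) => k ≤ (i : ℕ)) (by simp) (fun i => inner ℝ (svd.right i) y ^ 2)]
  refine Finset.sum_congr rfl fun i _ => ?_
  have h1 : inner ℝ (svd.right i) (WithLp.toLp 2 x) = inner ℝ (svd.right i) y := by
    have h := Submodule.starProjection_add_starProjection_orthogonal (K := svd.top hk)
      (WithLp.toLp 2 x)
    conv_lhs => rw [← h]
    rw [inner_add_right, svd.inner_right_of_mem_top hk (Submodule.starProjection_apply_mem _ _) i.2,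
      zero_add]
  rw [← h1, Real.norm_eq_abs, sq_abs, PiLp.inner_apply]
  congr 1
  simp only [ThinSVD.right, Matrix.mulVec, dotProduct, lastCols, Matrix.transpose_apply,
    Matrix.submatrix_apply, id, Matrix.col_apply, RCLike.inner_apply, conj_trivial]
  exact Finset.sum_congr rfl fun _ _ => mul_comm _ _

open scoped Matrix.Norms.L2Operator in
theorem specNorm_nonneg (X : Matrix (Fin m) (Fin n) ℝ) : 0 ≤ specNorm X := norm_nonneg X

theorem norm_toEuclideanLin_le (X : Matrix (Fin m) (Fin n) ℝ) (y : EuclideanSpace ℝ (Fin n)) :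
    ‖Matrix.toEuclideanLin X y‖ ≤ specNorm X * ‖y‖ :=
  Matrix.l2_opNorm_mulVec X y

theorem specNorm_le {c : ℝ} (hc : 0 ≤ c)
    (h : ∀ y : EuclideanSpace ℝ (Fin n), ‖Matrix.toEuclideanLin X y‖ ≤ c * ‖y‖) :
    specNorm X ≤ c :=
  ContinuousLinearMap.opNorm_le_bound _ hc h

theorem specNorm_eq_sigma (X : Matrix (Fin m) (Fin n) ℝ) : specNorm X = sigma X 1 := by
  obtain ⟨svd⟩ := ThinSVD.exists X
  apply le_antisymm
  · refine specNorm_le (sigma_nonneg _ _) fun y => ?_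
    have h := svd.isSplit (Nat.zero_le _)
    refine h.upper y ?_
    intro w hw
    have : w = 0 := by
      have h0 : svd.top (Nat.zero_le (min m n)) = ⊥ := by
        rw [ThinSVD.top, Set.range_eq_empty, Submodule.span_empty]
      rw [h0] at hw
      exact hw
    rw [this, inner_zero_left]
  · by_cases h : 1 ≤ min m n
    · have h1 := (svd.isSplit h).lower (svd.right ⟨0, h⟩) (Submodule.subset_span ⟨0, rfl⟩)
      have h2 := norm_toEuclideanLin_le X (svd.right ⟨0, h⟩)
      rw [svd.orthonormal_right.1, mul_one] at h1 h2
      exact h1.trans h2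
    · have h0 : sigma X 1 = 0 := by
        by_contra hne
        have h1 := (LinearMap.singularValues_pos_iff_lt_finrank_range _).1
          ((LinearMap.singularValues_pos_iff_ne_zero _ 0).2 hne)
        have h2 := Submodule.finrank_le (LinearMap.range (Matrix.toEuclideanLin X))
        have h3 := LinearMap.finrank_range_le (Matrix.toEuclideanLin X)
        simp only [finrank_euclideanSpace_fin] at h2 h3
        omega
      rw [h0]; exact specNorm_nonneg X

theorem sigma_pos_of_le_rank {k : ℕ} (hk : 1 ≤ k) (h : k ≤ X.rank) : 0 < sigma X k := by
  refine (LinearMap.singularValues_pos_iff_lt_finrank_range _).2 ?_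
  rw [Matrix.rank_eq_finrank_range_toLin X (EuclideanSpace.basisFun _ ℝ).toBasis
    (EuclideanSpace.basisFun _ ℝ).toBasis, ← Matrix.toEuclideanLin_eq_toLin_orthonormal] at h
  omega

/-- The diagonal entries `σ σ⁻¹` are 1 or 0, since `0⁻¹ = 0`. So `X X⁺` is an orthogonal projection;
its symmetry, the identity `X X⁺ X = X` and the trace bound are read off this form. -/
theorem ThinSVD.mul_pinv (svd : ThinSVD X) : X * svd.pinv = svd.U *
    Matrix.diagonal (fun i : Fin (min m n) => sigma X ((i : ℕ) + 1) * (sigma X ((i : ℕ) + 1))⁻¹)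
      * svd.Uᵀ := by
  have h : X * svd.pinv = svd.U * (Matrix.diagonal fun i : Fin (min m n) => sigma X ((i : ℕ) + 1))
      * svd.Vᵀ * svd.pinv := congrArg (· * svd.pinv) svd.eq_mul
  rw [h, ThinSVD.pinv, ← Matrix.diagonal_mul_diagonal]
  simp only [← Matrix.mul_assoc]
  congr 2
  rw [Matrix.mul_assoc (svd.U * _), svd.V_orthonormal, Matrix.mul_one]

theorem transpose_mul_pinv (X : Matrix (Fin m) (Fin n) ℝ) : (X * pinv X)ᵀ = X * pinv X := by
  rw [pinv, ThinSVD.mul_pinv]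
  simp [Matrix.transpose_mul, Matrix.mul_assoc]

theorem mul_pinv_mul (X : Matrix (Fin m) (Fin n) ℝ) : X * pinv X * X = X := by
  rw [pinv, ThinSVD.mul_pinv]
  set svd := Classical.choice (ThinSVD.exists X)
  have h : X = svd.U * (Matrix.diagonal fun i : Fin (min m n) => sigma X ((i : ℕ) + 1)) * svd.Vᵀ :=
    svd.eq_mul
  conv_lhs => enter [2]; rw [h]
  conv_rhs => rw [h]
  simp only [← Matrix.mul_assoc]
  rw [Matrix.mul_assoc _ svd.Uᵀ, svd.U_orthonormal, Matrix.mul_one, Matrix.mul_assoc svd.U,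
    Matrix.diagonal_mul_diagonal]
  congr 3
  ext i
  by_cases h : sigma X ((i : ℕ) + 1) = 0
  · simp [h]
  · field_simp

theorem trace_mul_pinv_le (X : Matrix (Fin m) (Fin n) ℝ) : (X * pinv X).trace ≤ n := by
  rw [pinv, ThinSVD.mul_pinv]
  set svd := Classical.choice (ThinSVD.exists X)
  rw [Matrix.trace_mul_comm, ← Matrix.mul_assoc, svd.U_orthonormal, Matrix.one_mul,
    Matrix.trace_diagonal]
  calc _ ≤ ∑ _i : Fin (min m n), (1 : ℝ) := Finset.sum_le_sum fun i _ => mul_inv_le_one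
    _ ≤ n := by simp

end SVD

/-! ### Second moments of affine functions of the noise. -/

section Noise

variable {Ω : Type*} [MeasurableSpace Ω] {P : Measure Ω} {n : ℕ} {ξ : Fin n → Ω → ℝ} {τ : ℝ}

theorem IsNoise.integrable_mul (h : IsNoise P ξ τ) (i j : Fin n) :
    Integrable (fun ω => ξ i ω * ξ j ω) P :=
  (h.memLp i).integrable_mul (h.memLp j)

theorem IsNoise.integral_mul (h : IsNoise P ξ τ) (i j : Fin n) :
    ∫ ω, ξ i ω * ξ j ω ∂P = if i = j then τ ^ 2 else 0 := by
  split_ifs with hij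
  · subst hij
    rw [← h.variance i, variance_of_integral_eq_zero (h.memLp i).1.aemeasurable (h.mean i)]
    simp only [pow_two]
  · have := (h.indep.indepFun hij).integral_mul_eq_mul_integral (h.memLp i).1 (h.memLp j).1
    rw [h.mean i, zero_mul] at this
    exact this

variable [IsProbabilityMeasure P]

/-- Zero means kill the linear terms and uncorrelatedness kills the mixed ones. Used for the excess
risk and again for the rows of a subgaussian map. -/
theorem IsNoise.affine_sq (h : IsNoise P ξ τ) (c : ℝ) (a : Fin n → ℝ) :
    Integrable (fun ω => (c + ∑ j, a j * ξ j ω) ^ 2) P ∧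
      ∫ ω, (c + ∑ j, a j * ξ j ω) ^ 2 ∂P = c ^ 2 + τ ^ 2 * ∑ j, a j ^ 2 := by
  have e : (fun ω => (c + ∑ j, a j * ξ j ω) ^ 2) = fun ω =>
      (c ^ 2 + ∑ j, 2 * c * a j * ξ j ω) + ∑ j, ∑ k, a j * a k * (ξ j ω * ξ k ω) := by
    funext ω
    have h1 : (∑ j, a j * ξ j ω) ^ 2 = ∑ j, ∑ k, a j * a k * (ξ j ω * ξ k ω) := by
      rw [pow_two, Finset.sum_mul_sum]
      exact Finset.sum_congr rfl fun _ _ => Finset.sum_congr rfl fun _ _ => by ring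
    rw [← h1, add_sq, Finset.mul_sum]
    congr 2
    exact Finset.sum_congr rfl fun _ _ => by ring
  have i1 : ∀ j, Integrable (fun ω => 2 * c * a j * ξ j ω) P := fun j =>
    ((h.memLp j).integrable (by norm_num)).const_mul _
  have i2 : ∀ j k, Integrable (fun ω => a j * a k * (ξ j ω * ξ k ω)) P := fun j k =>
    (h.integrable_mul j k).const_mul _
  have i3 : Integrable (fun ω => c ^ 2 + ∑ j, 2 * c * a j * ξ j ω) P :=
    (integrable_const _).add (integrable_finsetSum _ fun j _ => i1 j)
  have i4 : Integrable (fun ω => ∑ j, ∑ k, a j * a k * (ξ j ω * ξ k ω)) P :=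
    integrable_finsetSum _ fun j _ => integrable_finsetSum _ fun k _ => i2 j k
  rw [e]
  refine ⟨i3.add i4, ?_⟩
  rw [integral_add i3 i4, integral_add (integrable_const _) (integrable_finsetSum _ fun j _ => i1 j),
    integral_finsetSum _ (fun j _ => i1 j),
    integral_finsetSum _ (fun j _ => integrable_finsetSum _ fun k _ => i2 j k)]
  simp only [integral_finsetSum _ (fun k _ => i2 _ k), integral_const_mul, h.mean, h.integral_mul]
  simp [Finset.mul_sum, pow_two, mul_comm, mul_assoc]

theorem l2_sq_eq_sum {ι : Type*} [Fintype ι] (x : ι → ℝ) : l2 x ^ 2 = ∑ i, x i ^ 2 := by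
  rw [l2, EuclideanSpace.norm_sq_eq]
  simp

theorem IsNoise.affine_l2_sq (h : IsNoise P ξ τ) {m : ℕ} (c : Fin m → ℝ)
    (M : Matrix (Fin m) (Fin n) ℝ) :
    Integrable (fun ω => l2 (c + M *ᵥ fun j => ξ j ω) ^ 2) P ∧
      ∫ ω, l2 (c + M *ᵥ fun j => ξ j ω) ^ 2 ∂P = l2 c ^ 2 + τ ^ 2 * (Mᵀ * M).trace := by
  have e : (fun ω => l2 (c + M *ᵥ fun j => ξ j ω) ^ 2) = fun ω =>
      ∑ i, (c i + ∑ j, M i j * ξ j ω) ^ 2 := by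
    funext ω
    rw [l2_sq_eq_sum]
    rfl
  rw [e]
  refine ⟨integrable_finsetSum _ fun i _ => (h.affine_sq (c i) (M i)).1, ?_⟩
  rw [integral_finsetSum _ fun i _ => (h.affine_sq (c i) (M i)).1]
  simp only [(h.affine_sq (c _) (M _)).2]
  rw [Finset.sum_add_distrib, ← l2_sq_eq_sum, ← Finset.mul_sum, Matrix.trace]
  congr 2
  rw [Finset.sum_comm]
  refine Finset.sum_congr rfl fun j _ => ?_
  simp [Matrix.mul_apply, pow_two]

theorem l2_neg {ι : Type*} [Fintype ι] (x : ι → ℝ) : l2 (-x) = l2 x := by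
  rw [l2, l2, WithLp.toLp_neg, norm_neg]

/-- The noise only adds a constant, so `x⋆` is an ordinary least squares solution for `f`. -/
theorem IsNoise.expectedLoss_eq (h : IsNoise P ξ τ) {d : ℕ} (A : Matrix (Fin n) (Fin d) ℝ)
    (f : Fin n → ℝ) (x : Fin d → ℝ) :
    expectedLoss P A (response f ξ) x = (l2 (A *ᵥ x - f) ^ 2 + τ ^ 2 * n) / n := by
  rw [expectedLoss, integral_div]
  have h1 := (h.affine_l2_sq (f - A *ᵥ x) 1).2
  have e : (fun ω => l2 (A *ᵥ x - response f ξ ω) ^ 2) =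
      fun ω => l2 (f - A *ᵥ x + (1 : Matrix (Fin n) (Fin n) ℝ) *ᵥ fun j => ξ j ω) ^ 2 := by
    funext ω
    rw [← l2_neg]
    congr 2
    rw [Matrix.one_mulVec]
    ext i
    simp [response]
    ring
  rw [e, h1, ← l2_neg (A *ᵥ x - f), neg_sub]
  simp

end Noise

/-! ### Least squares over a subspace and orthogonality of residuals. -/

section LeastSquares

variable {E F : Type*} [NormedAddCommGroup E] [InnerProductSpace ℝ E]
  [NormedAddCommGroup F] [InnerProductSpace ℝ F] {T : E →ₗ[ℝ] F} {W : Submodule ℝ E}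

theorem norm_sub_sq_of_residual_orthogonal {x z : E} {b : F} (hx : x ∈ W)
    (h : ∀ z ∈ W, inner ℝ (T x - b) (T z) = 0) (hz : z ∈ W) :
    ‖T z - b‖ ^ 2 = ‖T z - T x‖ ^ 2 + ‖T x - b‖ ^ 2 := by
  have h1 : T z - b = (T z - T x) + (T x - b) := by abel
  have h2 : inner ℝ (T z - T x) (T x - b) = 0 := by
    rw [← map_sub, real_inner_comm]; exact h _ (W.sub_mem hz hx)
  have := norm_add_sq_eq_norm_sq_add_norm_sq_of_inner_eq_zero _ _ h2
  rw [h1]; nlinarith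

theorem norm_le_of_residual_orthogonal {x z : E} {b : F} (hx : x ∈ W)
    (h : ∀ z ∈ W, inner ℝ (T x - b) (T z) = 0) (hz : z ∈ W) : ‖T x - b‖ ≤ ‖T z - b‖ := by
  refine le_of_sq_le_sq ?_ (norm_nonneg _)
  rw [norm_sub_sq_of_residual_orthogonal hx h hz]
  nlinarith [sq_nonneg ‖T z - T x‖]

theorem exists_residual_orthogonal [FiniteDimensional ℝ E] (T : E →ₗ[ℝ] F) (W : Submodule ℝ E)
    (b : F) : ∃ x ∈ W, ∀ z ∈ W, inner ℝ (T x - b) (T z) = 0 := by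
  obtain ⟨x, hx, hxe⟩ := Submodule.starProjection_apply_mem (W.map T) b
  refine ⟨x, hx, fun z hz => ?_⟩
  rw [hxe, ← neg_sub, inner_neg_left, neg_eq_zero]
  exact Submodule.starProjection_inner_eq_zero b (T z) (Submodule.mem_map_of_mem hz)

/-- By Pythagoras, any minimizer has the same image as one obtained from the orthogonal projection
of `b`. -/
theorem residual_orthogonal_of_isMin [FiniteDimensional ℝ E] {x : E} {b : F}
    (h : ∀ z, ‖T x - b‖ ≤ ‖T z - b‖) (z : E) : inner ℝ (T x - b) (T z) = 0 := by
  obtain ⟨y, hy, hyo⟩ := exists_residual_orthogonal T ⊤ b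
  have h1 := norm_sub_sq_of_residual_orthogonal hy hyo (Submodule.mem_top (x := x))
  have h2 := pow_le_pow_left₀ (norm_nonneg _) (h y) 2
  have h3 : ‖T x - T y‖ = 0 := by
    have : ‖T x - T y‖ ^ 2 ≤ 0 := by linarith
    exact pow_eq_zero_iff (two_ne_zero) |>.1 (le_antisymm this (sq_nonneg _))
  rw [sub_eq_zero.1 (norm_eq_zero.1 h3)]
  exact hyo z Submodule.mem_top

end LeastSquares

/-! ### The Gram error as a bilinear form. -/

theorem toLp_mulVec {m n : ℕ} (X : Matrix (Fin m) (Fin n) ℝ) (x : Fin n → ℝ) :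
    WithLp.toLp 2 (X *ᵥ x) = Matrix.toEuclideanLin X (WithLp.toLp 2 x) := rfl

theorem inner_toLp {ι : Type*} [Fintype ι] (x y : ι → ℝ) :
    inner ℝ (WithLp.toLp 2 x) (WithLp.toLp 2 y) = x ⬝ᵥ y := by
  rw [PiLp.inner_apply, dotProduct]
  exact Finset.sum_congr rfl fun _ _ => mul_comm _ _

theorem inner_toEuclideanLin_transpose {m n : ℕ} (X : Matrix (Fin m) (Fin n) ℝ)
    (x : EuclideanSpace ℝ (Fin m)) (y : EuclideanSpace ℝ (Fin n)) :
    inner ℝ (Matrix.toEuclideanLin Xᵀ x) y = inner ℝ x (Matrix.toEuclideanLin X y) := by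
  rw [Matrix.toLpLin_apply, Matrix.toLpLin_apply, ← WithLp.toLp_ofLp 2 x, ← WithLp.toLp_ofLp 2 y,
    inner_toLp, inner_toLp]
  simp only
  rw [Matrix.mulVec_transpose, Matrix.dotProduct_mulVec]

theorem inner_gram {m n : ℕ} (X : Matrix (Fin m) (Fin n) ℝ) (x y : EuclideanSpace ℝ (Fin n)) :
    inner ℝ (Matrix.toEuclideanLin X x) (Matrix.toEuclideanLin X y)
      = inner ℝ (Matrix.toEuclideanLin (Xᵀ * X) x) y := by
  rw [← inner_toEuclideanLin_transpose]
  congr 1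
  rw [Matrix.toLpLin_apply, Matrix.toLpLin_apply, Matrix.toLpLin_apply]
  simp only
  rw [Matrix.mulVec_mulVec]

theorem inner_gram_error {s m n : ℕ} (S : Matrix (Fin s) (Fin m) ℝ) (X : Matrix (Fin m) (Fin n) ℝ)
    (x y : EuclideanSpace ℝ (Fin n)) :
    inner ℝ (Matrix.toEuclideanLin (Xᵀ * Sᵀ * S * X - Xᵀ * X) x) y
      = inner ℝ (Matrix.toEuclideanLin (S * X) x) (Matrix.toEuclideanLin (S * X) y)
        - inner ℝ (Matrix.toEuclideanLin X x) (Matrix.toEuclideanLin X y) := by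
  rw [inner_gram, inner_gram, map_sub, LinearMap.sub_apply, inner_sub_left, Matrix.transpose_mul]
  simp only [Matrix.mul_assoc]

theorem abs_inner_gram_error_le {s m n : ℕ} (S : Matrix (Fin s) (Fin m) ℝ)
    (X : Matrix (Fin m) (Fin n) ℝ) (x y : EuclideanSpace ℝ (Fin n)) :
    |inner ℝ (Matrix.toEuclideanLin (S * X) x) (Matrix.toEuclideanLin (S * X) y)
      - inner ℝ (Matrix.toEuclideanLin X x) (Matrix.toEuclideanLin X y)|
      ≤ specNorm (Xᵀ * Sᵀ * S * X - Xᵀ * X) * ‖x‖ * ‖y‖ := by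
  rw [← inner_gram_error]
  exact (abs_real_inner_le_norm _ _).trans
    (mul_le_mul_of_nonneg_right (norm_toEuclideanLin_le _ _) (norm_nonneg _))

/-! ### The fitted vector `A x_R` as an orthogonal projection. -/

section Compressed

variable {n d k : ℕ} (A : Matrix (Fin n) (Fin d) ℝ) (R : Matrix (Fin d) (Fin k) ℝ)

theorem mulVec_compressedLS (b : Fin n → ℝ) :
    A *ᵥ compressedLS A R b = (A * R * pinv (A * R)) *ᵥ b := by
  rw [compressedLS, Matrix.mulVec_mulVec, Matrix.mulVec_mulVec]

theorem compressedLS_residual_orthogonal (b : Fin n → ℝ) (c : Fin k → ℝ) :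
    (A *ᵥ compressedLS A R b - b) ⬝ᵥ (A *ᵥ (R *ᵥ c)) = 0 := by
  rw [mulVec_compressedLS, Matrix.mulVec_mulVec, sub_dotProduct, sub_eq_zero,
    ← transpose_mul_pinv, Matrix.mulVec_transpose, ← Matrix.dotProduct_mulVec,
    Matrix.mulVec_mulVec, mul_pinv_mul]

/-- A symmetric idempotent `Q` satisfies `QᵀQ = Q`, so this trace is a rank. It is the variance
factor in the excess risk. -/
theorem trace_transpose_mul_self_le :
    ((A * R * pinv (A * R))ᵀ * (A * R * pinv (A * R))).trace ≤ k := by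
  rw [transpose_mul_pinv, ← Matrix.mul_assoc, mul_pinv_mul]
  exact trace_mul_pinv_le _

end Compressed

/-! ### Deterministic consequences of a small Gram error. -/

section LeftSketching

variable {n d k s : ℕ} {A : Matrix (Fin n) (Fin d) ℝ} {S : Matrix (Fin s) (Fin n) ℝ} {ν : ℝ}

theorem sketchAccuracy_mul_specNorm_sq (hk : 1 ≤ k) (hr : k ≤ A.rank) :
    sketchAccuracy A k ν * specNorm A ^ 2 =
      (ν / √(1 + ν ^ 2)) / (1 + ν / √(1 + ν ^ 2)) * (sigma A k ^ 2 - sigma A (k + 1) ^ 2) := by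
  have h1 : 0 < sigma A 1 := sigma_pos_of_le_rank le_rfl (hk.trans hr)
  rw [sketchAccuracy, relGap, specNorm_eq_sigma]
  field_simp

variable (hk : 1 ≤ k) (hr : k ≤ A.rank) (hgap : sigma A (k + 1) < sigma A k)
  (hν : 0 < ν)
  (hS : specNorm (Aᵀ * Sᵀ * S * A - Aᵀ * A) < sketchAccuracy A k ν * specNorm A ^ 2)

include hk hr hgap hν hS

theorem gram_error_lt : specNorm (Aᵀ * Sᵀ * S * A - Aᵀ * A) <
    (ν / √(1 + ν ^ 2)) / (1 + ν / √(1 + ν ^ 2)) * (sigma A k ^ 2 - sigma A (k + 1) ^ 2) ∧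
    specNorm (Aᵀ * Sᵀ * S * A - Aᵀ * A) < sigma A k ^ 2 - sigma A (k + 1) ^ 2 := by
  rw [sketchAccuracy_mul_specNorm_sq hk hr] at hS
  refine ⟨hS, hS.trans_le ?_⟩
  have h0 := sigma_nonneg A (k + 1)
  have h1 : 0 < ν / √(1 + ν ^ 2) := by positivity
  have h2 : 0 ≤ sigma A k ^ 2 - sigma A (k + 1) ^ 2 := by nlinarith
  refine mul_le_of_le_one_left h2 ?_
  rw [div_le_one (by positivity)]
  linarith

/-- A top singular vector `w` with `SAw = 0` would satisfy `σ_k² ‖w‖² ≤ ‖Aw‖² ≤ e ‖w‖²` with `e <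
σ_k²`. So `SA` is injective on a space of dimension `k`, which forces `k ≤ s`. -/
theorem le_min_of_gram_error : k ≤ min s d := by
  refine le_min ?_ (hr.trans A.rank_le_width)
  obtain ⟨svd⟩ := ThinSVD.exists A
  have hkm := le_min_of_le_rank hr
  obtain ⟨-, h2⟩ := gram_error_lt hk hr hgap hν hS
  have hinj : Function.Injective ((Matrix.toEuclideanLin (S * A)).domRestrict (svd.top hkm)) := by
    rw [injective_iff_map_eq_zero]
    rintro ⟨w, hw⟩ hw0
    have hw0 : Matrix.toEuclideanLin (S * A) w = 0 := hw0
    have h3 := abs_inner_gram_error_le S A w w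
    rw [hw0, inner_zero_left, zero_sub, abs_neg, real_inner_self_eq_norm_sq,
      abs_of_nonneg (sq_nonneg _)] at h3
    have h4 := pow_le_pow_left₀ (by have := sigma_nonneg A k; positivity)
      ((svd.isSplit hkm).lower w hw) 2
    ext1
    change w = 0
    by_contra hne
    have h5 : 0 < ‖w‖ := norm_pos_iff.2 hne
    have h6 : sigma A k ^ 2 * ‖w‖ ^ 2 ≤ specNorm (Aᵀ * Sᵀ * S * A - Aᵀ * A) * ‖w‖ ^ 2 := by
      nlinarith
    have h7 := le_of_mul_le_mul_right h6 (by positivity)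
    nlinarith [sq_nonneg (sigma A (k + 1))]
  have := LinearMap.finrank_le_finrank_of_injective hinj
  rwa [svd.finrank_top, finrank_euclideanSpace_fin] at this

theorem slope_top_le (svdA : ThinSVD A) (svdSA : ThinSVD (S * A)) (hs : k ≤ min s d)
    (hkm : k ≤ min n d) {r : EuclideanSpace ℝ (Fin d)} (hmem : r ∈ svdSA.top hs) :
    ‖(svdA.top hkm)ᗮ.starProjection r‖ ≤ ν * ‖(svdA.top hkm).starProjection r‖ := by
  obtain ⟨h1, h2⟩ := gram_error_lt hk hr hgap hν hS
  set e := specNorm (Aᵀ * Sᵀ * S * A - Aᵀ * A) with he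
  have he0 : 0 ≤ e := specNorm_nonneg _
  have ha' := sigma_nonneg A (k + 1)
  have hb0 := sigma_nonneg (S * A) k
  have hweyl : sigma A k ^ 2 ≤ sigma (S * A) k ^ 2 + e := by
    -- Splitting `SA` at `k - 1` makes `σ_k(SA)` the upper bound and leaves the dimension one short
    -- of `k`, as the dimension count requires.
    have h3 := svdSA.isSplit ((Nat.sub_le k 1).trans hs)
    rw [Nat.sub_add_cancel hk] at h3
    refine sq_le_of_perturbation (svdA.isSplit hkm).lower h3.upper (sigma_nonneg _ _)
      ?_ fun x => ?_
    · rw [ThinSVD.finrank_top, ThinSVD.finrank_top]; omega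
    · have := (abs_le.1 (abs_inner_gram_error_le S A x x)).1
      rw [real_inner_self_eq_norm_sq, real_inner_self_eq_norm_sq] at this
      nlinarith
  have hab : sigma A (k + 1) < sigma (S * A) k := by
    refine lt_of_pow_lt_pow_left₀ 2 hb0 ?_
    linarith
  refine slope_le_of_sin_le hν (((svdA.isSplit hkm).norm_orthogonal_part_le (svdSA.isSplit hs)
    (ha'.trans_lt hab) ha' he0 hab (abs_inner_gram_error_le S A) hmem).trans
    (mul_le_mul_of_nonneg_right ?_ (norm_nonneg _)))
  set q := ν / √(1 + ν ^ 2)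
  have hq : 0 < q := by positivity
  rw [div_mul_eq_mul_div, lt_div_iff₀ (by positivity)] at h1
  -- With `g = σ_k² - σ_{k+1}²`, Weyl bounds the denominator below by `g - e`, and `e ≤ q (g - e)`
  -- is a rearrangement of `e (1 + q) ≤ q g`.
  rw [div_le_iff₀ (by nlinarith)]
  nlinarith

theorem isApproxPCR_compressedLS (hν2 : ν < 1 / 2) (svdA : ThinSVD A) (svdSA : ThinSVD (S * A))
    (hs : k ≤ min s d) (b : Fin n → ℝ) :
    IsApproxPCR svdA (le_min_of_le_rank hr) b (sigma A (k + 1) / sigma A k * ν)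
      (ν / ((√(1 - ν ^ 2) - ν) * sigma A k)) (compressedLS A (firstCols svdSA.V hs) b) := by
  have hkm := le_min_of_le_rank hr
  have hslope := fun r hr' => slope_top_le hk hr hgap hν hS svdA svdSA hs hkm (r := r) hr'
  have hA := svdA.isSplit hkm
  have ha := sigma_pos_of_le_rank hk hr
  have ha' := sigma_nonneg A (k + 1)
  set x := compressedLS A (firstCols svdSA.V hs) b
  have hxmem : WithLp.toLp 2 x ∈ svdSA.top hs :=
    (toLp_mem_top_iff svdSA hs x).2 ⟨_, rfl⟩
  have hxo : ∀ z ∈ svdSA.top hs, inner ℝ (Matrix.toEuclideanLin A (WithLp.toLp 2 x)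
      - WithLp.toLp 2 b) (Matrix.toEuclideanLin A z) = 0 := by
    intro z hz
    rw [← WithLp.toLp_ofLp 2 z] at hz ⊢
    obtain ⟨c, hc⟩ := (toLp_mem_top_iff svdSA hs z.ofLp).1 hz
    rw [← toLp_mulVec, ← toLp_mulVec, ← WithLp.toLp_sub, inner_toLp, ← hc]
    exact compressedLS_residual_orthogonal A (firstCols svdSA.V hs) b c
  obtain ⟨y, hy, hyo⟩ := exists_residual_orthogonal (Matrix.toEuclideanLin A) (svdA.top hkm)
    (WithLp.toLp 2 b)
  refine ⟨⟨y.ofLp, ⟨(toLp_mem_top_iff svdA hkm _).1 hy, fun z hz => ?_⟩, ?_⟩, ?_⟩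
  · have h1 := norm_le_of_residual_orthogonal hy hyo ((toLp_mem_top_iff svdA hkm z).2 hz)
    exact h1
  · have h1 := hA.abs_residual_sub_le ha ha' hν
      (by rw [ThinSVD.finrank_top, ThinSVD.finrank_top]) hslope hy hxmem hyo
      (fun z hz => norm_le_of_residual_orthogonal hy hyo hz) hxo
      (fun z hz => norm_le_of_residual_orthogonal hxmem hxo hz)
    exact h1
  · refine (l2_lastCols_le svdA hkm x).trans ((hA.norm_orthogonal_le_div ha hν
      (hslope _ hxmem) (hxo _ hxmem)).trans (mul_le_mul_of_nonneg_right ?_ (norm_nonneg _)))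
    -- The slope argument yields the sharper bound `ν/σ_k`; the factor `√(1-ν²) - ν` lies in `(0,
    -- 1]`, so the stated bound is weaker.
    have h1 : ν < √(1 - ν ^ 2) := Real.lt_sqrt_of_sq_lt (by nlinarith)
    have h2 : √(1 - ν ^ 2) ≤ 1 := Real.sqrt_le_one.2 (by nlinarith)
    refine div_le_div_of_nonneg_left hν.le (mul_pos (by linarith) ha) ?_
    exact mul_le_of_le_one_left ha.le (by linarith)

theorem excessRisk_compressedLS_le (hν2 : ν < 1 / 2) (svdSA : ThinSVD (S * A))
    (hs : k ≤ min s d) {Ω : Type*} [MeasurableSpace Ω] (P : Measure Ω) [IsProbabilityMeasure P]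
    (f : Fin n → ℝ) (ξ : Fin n → Ω → ℝ) (τ : ℝ) (xstar : Fin d → ℝ) (hξ : IsNoise P ξ τ)
    (hx : IsOptimalPredictor P A (response f ξ) xstar) :
    Integrable (fun ω => l2 (A *ᵥ compressedLS A (firstCols svdSA.V hs) (response f ξ ω)
        - A *ᵥ xstar) ^ 2 / n) P ∧
      excessRisk P A xstar (fun ω => compressedLS A (firstCols svdSA.V hs) (response f ξ ω))
        ≤ (1 + ν) * l2 xstar ^ 2 * sigma A (k + 1) ^ 2 / n + τ ^ 2 * k / n := by
  have hn : 0 < n := by have := hr.trans A.rank_le_height; omega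
  have hn' : (0 : ℝ) < n := Nat.cast_pos.2 hn
  obtain ⟨svdA⟩ := ThinSVD.exists A
  have hkm := le_min_of_le_rank hr
  set R := firstCols svdSA.V hs with hR
  set Q := A * R * pinv (A * R) with hQ
  have hopt : ∀ z : EuclideanSpace ℝ (Fin d),
      inner ℝ (Matrix.toEuclideanLin A (WithLp.toLp 2 xstar) - WithLp.toLp 2 f)
        (Matrix.toEuclideanLin A z) = 0 := by
    refine residual_orthogonal_of_isMin fun z => ?_
    have h1 := hx.1 z.ofLp
    rw [hξ.expectedLoss_eq, hξ.expectedLoss_eq, div_le_div_iff_of_pos_right hn'] at h1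
    have h2 : l2 (A *ᵥ xstar - f) ^ 2 ≤ l2 (A *ᵥ z.ofLp - f) ^ 2 := by linarith
    exact le_of_sq_le_sq h2 (norm_nonneg _)
  -- `f - A x⋆` is orthogonal to the range of `A`, so the projection `Q` onto the range of `A R`
  -- annihilates it.
  have hQf : Q *ᵥ f = Q *ᵥ (A *ᵥ xstar) := by
    have h1 : ∀ z : Fin d → ℝ, (A *ᵥ xstar - f) ⬝ᵥ (A *ᵥ z) = 0 := fun z => by
      have := hopt (WithLp.toLp 2 z)
      rwa [← toLp_mulVec, ← toLp_mulVec, ← WithLp.toLp_sub, inner_toLp] at this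
    symm
    rw [← sub_eq_zero, ← Matrix.mulVec_sub]
    refine dotProduct_eq_zero_iff.1 fun w => ?_
    rw [dotProduct_comm, hQ, ← transpose_mul_pinv, Matrix.mulVec_transpose, dotProduct_comm,
      ← Matrix.dotProduct_mulVec, ← Matrix.mulVec_mulVec, ← Matrix.mulVec_mulVec]
    exact h1 _
  -- Bias plus noise: the first term is the residual of the noiseless problem with right hand side
  -- `A x⋆`.
  have e : ∀ ω, A *ᵥ compressedLS A R (response f ξ ω) - A *ᵥ xstar
      = (A *ᵥ compressedLS A R (A *ᵥ xstar) - A *ᵥ xstar) + Q *ᵥ fun j => ξ j ω := by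
    intro ω
    have h1 : response f ξ ω = f + fun j => ξ j ω := rfl
    rw [mulVec_compressedLS, mulVec_compressedLS, ← hQ, h1, Matrix.mulVec_add, hQf]
    abel
  simp only [excessRisk, e]
  obtain ⟨h1, h2⟩ := hξ.affine_l2_sq (A *ᵥ compressedLS A R (A *ᵥ xstar) - A *ᵥ xstar) Q
  refine ⟨h1.div_const _, ?_⟩
  rw [integral_div, h2, ← add_div]
  refine div_le_div_of_nonneg_right (add_le_add ?_ (mul_le_mul_of_nonneg_left
    (trace_transpose_mul_self_le A R) (sq_nonneg _))) hn'.le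
  -- The bias is a minimal residual over the range of `R`, so any competitor bounds it; the one used
  -- shares the top component of `x⋆`.
  obtain ⟨r, hr', hrle⟩ := (svdA.isSplit hkm).exists_norm_map_sub_sq_le (W' := svdSA.top hs) hν
    (by linarith) (by rw [ThinSVD.finrank_top, ThinSVD.finrank_top])
    (fun r hr' => slope_top_le hk hr hgap hν hS svdA svdSA hs hkm hr') (WithLp.toLp 2 xstar)
  refine le_trans (pow_le_pow_left₀ (norm_nonneg _) ?_ 2) hrle
  refine norm_le_of_residual_orthogonal (T := Matrix.toEuclideanLin A) (W := svdSA.top hs)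
    (x := WithLp.toLp 2 (compressedLS A R (A *ᵥ xstar))) (b := WithLp.toLp 2 (A *ᵥ xstar))
    ((toLp_mem_top_iff svdSA hs _).2 ⟨_, rfl⟩) (fun z hz => ?_) hr'
  rw [← WithLp.toLp_ofLp 2 z] at hz ⊢
  obtain ⟨c, hc⟩ := (toLp_mem_top_iff svdSA hs z.ofLp).1 hz
  rw [← toLp_mulVec, ← toLp_mulVec, ← WithLp.toLp_sub, inner_toLp, ← hc]
  exact compressedLS_residual_orthogonal A R _ c

end LeftSketching

/-! ### Measurability of the Gram error and the Frobenius bound. -/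

open scoped Matrix.Norms.L2Operator in
theorem continuous_specNorm_gram_error {s m n : ℕ} (X : Matrix (Fin m) (Fin n) ℝ) :
    Continuous fun S : Matrix (Fin s) (Fin m) ℝ => specNorm (Xᵀ * Sᵀ * S * X - Xᵀ * X) := by
  refine continuous_norm.comp ?_
  fun_prop

theorem measurable_specNorm_gram_error {s m n : ℕ} (X : Matrix (Fin m) (Fin n) ℝ) :
    Measurable fun S : Matrix (Fin s) (Fin m) ℝ => specNorm (Xᵀ * Sᵀ * S * X - Xᵀ * X) := by
  have : BorelSpace (Matrix (Fin s) (Fin m) ℝ) :=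
    inferInstanceAs (BorelSpace (Fin s → Fin m → ℝ))
  exact (continuous_specNorm_gram_error X).measurable

theorem specNorm_sq_le_sum_sq {m n : ℕ} (X : Matrix (Fin m) (Fin n) ℝ) :
    specNorm X ^ 2 ≤ ∑ i, ∑ j, X i j ^ 2 := by
  have h0 : 0 ≤ ∑ i, ∑ j, X i j ^ 2 :=
    Finset.sum_nonneg fun _ _ => Finset.sum_nonneg fun _ _ => sq_nonneg _
  have h : specNorm X ≤ √(∑ i, ∑ j, X i j ^ 2) := by
    refine specNorm_le (Real.sqrt_nonneg _) fun y => le_of_sq_le_sq ?_ (by positivity)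
    rw [mul_pow, Real.sq_sqrt h0, EuclideanSpace.norm_sq_eq, EuclideanSpace.norm_sq_eq,
      Finset.sum_mul]
    refine Finset.sum_le_sum fun i _ => ?_
    simp only [Real.norm_eq_abs, sq_abs]
    exact Finset.sum_mul_sq_le_sq_mul_sq Finset.univ (X i) y
  calc _ ≤ √(∑ i, ∑ j, X i j ^ 2) ^ 2 := pow_le_pow_left₀ (specNorm_nonneg X) h 2
    _ = _ := Real.sq_sqrt h0

/-! ### Second moments for CountSketch, as sums over the finite sample space. -/

section SecondMoment

variable {m s : ℕ}

/-- Adding `c` to the value `h i` permutes the functions and turns the collision event into `h j - h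
i = c`. The `s` choices of `c` partition all functions, so collisions have frequency `1/s`. -/
theorem sum_ite_eq_apply [NeZero s] {i j : Fin m} (hij : i ≠ j) :
    ∑ h : Fin m → Fin s, (if h i = h j then (1 : ℝ) else 0)
      = Fintype.card (Fin m → Fin s) / s := by
  have h1 : ∀ c : Fin s, ∑ h : Fin m → Fin s, (if h i = h j then (1 : ℝ) else 0)
      = ∑ h : Fin m → Fin s, (if c = h j - h i then (1 : ℝ) else 0) := by
    intro c
    rw [← Equiv.sum_comp (Equiv.addRight (Pi.single i c : Fin m → Fin s))]
    refine Finset.sum_congr rfl fun h _ => ?_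
    simp only [Equiv.coe_addRight, Pi.add_apply, Pi.single_eq_same,
      Pi.single_eq_of_ne hij.symm, add_zero]
    congr 1
    rw [eq_sub_iff_add_eq, add_comm]
  have h2 : ∑ _c : Fin s, ∑ h : Fin m → Fin s, (if h i = h j then (1 : ℝ) else 0)
      = Fintype.card (Fin m → Fin s) := by
    rw [Finset.sum_congr rfl fun c _ => h1 c, Finset.sum_comm]
    simp
  rw [Finset.sum_const, Finset.card_univ, Fintype.card_fin, nsmul_eq_mul] at h2
  have hs : (s : ℝ) ≠ 0 := Nat.cast_ne_zero.2 (NeZero.ne s)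
  rw [← h2]; field_simp

/-- The real value of a sign. -/
def signVal (e : Fin m → ℤˣ) (i : Fin m) : ℝ := ((e i : ℤ) : ℝ)

theorem signVal_mul_self (e : Fin m → ℤˣ) (i : Fin m) : signVal e i * signVal e i = 1 := by
  rw [signVal, ← Int.cast_mul, ← Units.val_mul, Int.units_mul_self]; simp

theorem sum_signVal_eq_zero (a : Fin m) (φ : (Fin m → ℤˣ) → ℝ)
    (h : ∀ e, φ (e * Pi.mulSingle a (-1)) = -φ e) : ∑ e, φ e = 0 := by
  have h1 := Equiv.sum_comp (Equiv.mulRight (Pi.mulSingle a (-1) : Fin m → ℤˣ)) φ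
  simp only [Equiv.coe_mulRight, h, Finset.sum_neg_distrib] at h1
  linarith

theorem signVal_flip_same (e : Fin m → ℤˣ) (a : Fin m) :
    signVal (e * Pi.mulSingle a (-1)) a = -signVal e a := by
  simp [signVal]

theorem signVal_flip_ne (e : Fin m → ℤˣ) {a i : Fin m} (h : i ≠ a) :
    signVal (e * Pi.mulSingle a (-1)) i = signVal e i := by
  simp [signVal, Pi.mulSingle_eq_of_ne h]

/-- Unless the pairs `{i, j}` and `{k, l}` coincide, one of `i`, `j` occurs exactly once; flipping
its sign negates the product. -/
theorem sum_signVal_mul_four {i j k l : Fin m} (hij : i ≠ j) (hkl : k ≠ l)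
    (h1 : ¬(k = i ∧ l = j)) (h2 : ¬(k = j ∧ l = i)) :
    ∑ e : Fin m → ℤˣ, signVal e i * signVal e j * (signVal e k * signVal e l) = 0 := by
  by_cases hi : k = i ∨ l = i
  · have hk : j ≠ k := by rintro rfl; rcases hi with h | h <;> simp_all
    have hl : j ≠ l := by rintro rfl; rcases hi with h | h <;> simp_all
    refine sum_signVal_eq_zero j _ fun e => ?_
    rw [signVal_flip_same, signVal_flip_ne e hij, signVal_flip_ne e hk.symm,
      signVal_flip_ne e hl.symm]
    ring
  · push Not at hi
    refine sum_signVal_eq_zero i _ fun e => ?_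
    rw [signVal_flip_same, signVal_flip_ne e hij.symm, signVal_flip_ne e hi.1,
      signVal_flip_ne e hi.2]
    ring

/-- The entries of `Sᵀ S - 1` for a CountSketch matrix `S`. -/
def collision (q : (Fin m → Fin s) × (Fin m → ℤˣ)) (i j : Fin m) : ℝ :=
  if i = j then 0 else (if q.1 i = q.1 j then 1 else 0) * (signVal q.2 i * signVal q.2 j)

theorem countSketchMatrix_gram (q : (Fin m → Fin s) × (Fin m → ℤˣ)) :
    (countSketchMatrix q)ᵀ * countSketchMatrix q = 1 + Matrix.of (collision q) := by
  ext i j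
  rw [Matrix.mul_apply, Matrix.add_apply, Matrix.one_apply, Matrix.of_apply, collision]
  have h : ∀ l, (countSketchMatrix q)ᵀ i l * countSketchMatrix q l j =
      if q.1 j = l then (if q.1 i = l then signVal q.2 i * signVal q.2 j else 0) else 0 := by
    intro l
    simp only [countSketchMatrix, Matrix.transpose_apply, Matrix.of_apply, signVal]
    split_ifs <;> simp
  rw [Finset.sum_congr rfl fun l _ => h l, Finset.sum_ite_eq]
  by_cases hij : i = j
  · subst hij
    simp [signVal_mul_self]
  · simp [hij]

/-- The signs decorrelate the entries of `SᵀS - 1` up to transposition, and the hashing gives the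
off-diagonal ones second moment `1/s`. -/
theorem sum_collision_mul [NeZero s] (i j k l : Fin m) :
    ∑ q : (Fin m → Fin s) × (Fin m → ℤˣ), collision q i j * collision q k l =
      Fintype.card ((Fin m → Fin s) × (Fin m → ℤˣ)) / s *
        (if i = j then 0 else (if k = i ∧ l = j then 1 else 0) + if k = j ∧ l = i then 1 else 0) := by
  by_cases hij : i = j
  · simp [collision, hij]
  by_cases hkl : k = l
  · subst hkl
    have h1 : ¬(k = i ∧ k = j) := fun h => hij (h.1.symm.trans h.2)
    have h2 : ¬(k = j ∧ k = i) := fun h => hij (h.2.symm.trans h.1)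
    simp [collision, h1, h2]
  rw [if_neg hij, Fintype.sum_prod_type]
  simp only [collision, if_neg hij, if_neg hkl]
  by_cases h : (k = i ∧ l = j) ∨ (k = j ∧ l = i)
  · have hone : (if k = i ∧ l = j then (1 : ℝ) else 0) + (if k = j ∧ l = i then 1 else 0) = 1 := by
      rcases h with h | h
      · rw [if_pos h, if_neg fun h' => hij (h.1.symm.trans h'.1), add_zero]
      · rw [if_pos h, if_neg fun h' => hij (h'.1.symm.trans h.1), zero_add]
    have hterm : ∀ (x : Fin m → Fin s) (y : Fin m → ℤˣ),
        (if x i = x j then (1 : ℝ) else 0) * (signVal y i * signVal y j) *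
          ((if x k = x l then 1 else 0) * (signVal y k * signVal y l))
        = if x i = x j then 1 else 0 := by
      intro x y
      have h1 := signVal_mul_self y i
      have h2 := signVal_mul_self y j
      have h3 : signVal y i * signVal y j * (signVal y i * signVal y j) = 1 := by
        calc _ = (signVal y i * signVal y i) * (signVal y j * signVal y j) := by ring
          _ = 1 := by rw [h1, h2, one_mul]
      rcases h with ⟨rfl, rfl⟩ | ⟨rfl, rfl⟩
      · split_ifs
        · rw [one_mul, h3]
        · simp
      · by_cases hx : x l = x k
        · rw [if_pos hx, if_pos hx.symm, one_mul, one_mul, mul_comm (signVal y k), h3]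
        · simp [hx]
    rw [hone]
    simp only [hterm]
    rw [Finset.sum_comm, Finset.sum_const, sum_ite_eq_apply hij, Fintype.card_prod,
      Finset.card_univ, nsmul_eq_mul]
    push_cast
    ring
  · push Not at h
    have h1 : ¬(k = i ∧ l = j) := fun h' => h.1 h'.1 h'.2
    have h2 : ¬(k = j ∧ l = i) := fun h' => h.2 h'.1 h'.2
    rw [if_neg h1, if_neg h2, add_zero, mul_zero]
    refine Finset.sum_eq_zero fun x _ => ?_
    have h3 := congrArg (((if x i = x j then (1 : ℝ) else 0) * (if x k = x l then 1 else 0)) * ·)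
      (sum_signVal_mul_four hij hkl h1 h2)
    simp only [mul_zero, Finset.mul_sum] at h3
    exact (Finset.sum_congr rfl fun _ _ => by ring).trans h3

theorem sum_bilin_collision_sq_le [NeZero s] (a b : Fin m → ℝ) :
    ∑ q : (Fin m → Fin s) × (Fin m → ℤˣ), (∑ i, ∑ j, a i * b j * collision q i j) ^ 2 ≤
      Fintype.card ((Fin m → Fin s) × (Fin m → ℤˣ)) / s * (2 * ∑ i, ∑ j, a i ^ 2 * b j ^ 2) := by
  set N : ℝ := Fintype.card ((Fin m → Fin s) × (Fin m → ℤˣ)) / s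
  have hN : 0 ≤ N := by positivity
  have h1 : ∀ q : (Fin m → Fin s) × (Fin m → ℤˣ), (∑ i, ∑ j, a i * b j * collision q i j) ^ 2
      = ∑ i, ∑ j, ∑ k, ∑ l, a i * b j * (a k * b l) * (collision q i j * collision q k l) := by
    intro q
    rw [pow_two, Finset.sum_mul]
    refine Finset.sum_congr rfl fun i _ => ?_
    rw [Finset.sum_mul]
    refine Finset.sum_congr rfl fun j _ => ?_
    rw [Finset.mul_sum]
    refine Finset.sum_congr rfl fun k _ => ?_
    rw [Finset.mul_sum]
    exact Finset.sum_congr rfl fun l _ => by ring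
  have h2 : ∑ q : (Fin m → Fin s) × (Fin m → ℤˣ), (∑ i, ∑ j, a i * b j * collision q i j) ^ 2
      = ∑ i, ∑ j, ∑ k, ∑ l, a i * b j * (a k * b l) *
        ∑ q : (Fin m → Fin s) × (Fin m → ℤˣ), collision q i j * collision q k l := by
    simp only [h1, Finset.mul_sum]
    rw [Finset.sum_comm]
    refine Finset.sum_congr rfl fun i _ => ?_
    rw [Finset.sum_comm]
    refine Finset.sum_congr rfl fun j _ => ?_
    rw [Finset.sum_comm]
    refine Finset.sum_congr rfl fun k _ => ?_
    rw [Finset.sum_comm]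
  rw [h2]
  simp only [sum_collision_mul]
  have h3 : ∀ i j : Fin m, ∑ k, ∑ l, a i * b j * (a k * b l) * (N *
      (if i = j then 0 else (if k = i ∧ l = j then 1 else 0) + if k = j ∧ l = i then 1 else 0))
      = N * if i = j then 0 else a i * b j * (a i * b j) + a i * b j * (a j * b i) := by
    intro i j
    by_cases hij : i = j
    · simp [hij]
    · simp only [if_neg hij, mul_add, Finset.sum_add_distrib, ite_and, mul_ite, mul_one, mul_zero]
      have : ∀ (x y : Fin m), ∑ k, ∑ l, (if k = x then if l = y then a i * b j * (a k * b l) * N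
          else 0 else 0) = a i * b j * (a x * b y) * N := by
        intro x y
        rw [Finset.sum_eq_single x (fun k _ hk => by simp [hk]) (by simp)]
        simp
      rw [this, this]
      ring
  have h4 : ∑ i, ∑ j, a i ^ 2 * b j ^ 2 = ∑ i, ∑ j, a j ^ 2 * b i ^ 2 := Finset.sum_comm
  calc _ = ∑ i, ∑ j, N * (if i = j then 0 else a i * b j * (a i * b j) + a i * b j * (a j * b i)) :=
        Finset.sum_congr rfl fun i _ => Finset.sum_congr rfl fun j _ => h3 i j
    -- With `x = a i * b j` and `y = a j * b i`, this is `x² + xy ≤ (3/2) x² + (1/2) y²`. The two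
    -- double sums agree after exchanging indices, whence the factor 2.
    _ ≤ ∑ i, ∑ j, N * (3 / 2 * (a i ^ 2 * b j ^ 2) + 1 / 2 * (a j ^ 2 * b i ^ 2)) := by
        refine Finset.sum_le_sum fun i _ => Finset.sum_le_sum fun j _ =>
          mul_le_mul_of_nonneg_left ?_ hN
        split_ifs
        · positivity
        · nlinarith [sq_nonneg (a i * b j - a j * b i)]
    _ = _ := by
        have h5 : ∀ i j, N * (3 / 2 * (a i ^ 2 * b j ^ 2) + 1 / 2 * (a j ^ 2 * b i ^ 2))
            = N * 3 / 2 * (a i ^ 2 * b j ^ 2) + N / 2 * (a j ^ 2 * b i ^ 2) := fun i j => by ring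
        simp only [h5, Finset.sum_add_distrib]
        have h6 : ∀ (c : ℝ) (g : Fin m → Fin m → ℝ), ∑ i, ∑ j, c * g i j = c * ∑ i, ∑ j, g i j :=
          fun c g => by simp only [Finset.mul_sum]
        rw [h6, h6, ← h4]
        ring

end SecondMoment

theorem gram_error_countSketch {m n s : ℕ} (X : Matrix (Fin m) (Fin n) ℝ)
    (q : (Fin m → Fin s) × (Fin m → ℤˣ)) (a b : Fin n) :
    (Xᵀ * (countSketchMatrix q)ᵀ * countSketchMatrix q * X - Xᵀ * X) a b
      = ∑ i, ∑ j, X i a * X j b * collision q i j := by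
  have h : Xᵀ * (countSketchMatrix q)ᵀ * countSketchMatrix q * X - Xᵀ * X
      = Xᵀ * (Matrix.of (collision q) * X) := by
    rw [Matrix.mul_assoc Xᵀ, countSketchMatrix_gram, Matrix.mul_add, Matrix.add_mul, Matrix.mul_one,
      add_sub_cancel_left, Matrix.mul_assoc]
  rw [h, Matrix.mul_apply]
  refine Finset.sum_congr rfl fun i _ => ?_
  rw [Matrix.mul_apply, Finset.mul_sum]
  refine Finset.sum_congr rfl fun j _ => ?_
  rw [Matrix.transpose_apply, Matrix.of_apply]
  ring

theorem sum_specNorm_gram_error_sq_le {m n s : ℕ} [NeZero s] (X : Matrix (Fin m) (Fin n) ℝ) :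
    ∑ q : (Fin m → Fin s) × (Fin m → ℤˣ),
      specNorm (Xᵀ * (countSketchMatrix q)ᵀ * countSketchMatrix q * X - Xᵀ * X) ^ 2 ≤
      Fintype.card ((Fin m → Fin s) × (Fin m → ℤˣ)) / s * (2 * (∑ i, ∑ j, X i j ^ 2) ^ 2) := by
  set N : ℝ := Fintype.card ((Fin m → Fin s) × (Fin m → ℤˣ)) / s
  calc _ ≤ ∑ q : (Fin m → Fin s) × (Fin m → ℤˣ), ∑ a, ∑ b,
        (∑ i, ∑ j, X i a * X j b * collision q i j) ^ 2 := by
        refine Finset.sum_le_sum fun q _ => (specNorm_sq_le_sum_sq _).trans (le_of_eq ?_)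
        simp only [gram_error_countSketch]
    _ = ∑ a, ∑ b, ∑ q : (Fin m → Fin s) × (Fin m → ℤˣ),
        (∑ i, ∑ j, X i a * X j b * collision q i j) ^ 2 := by
        rw [Finset.sum_comm]
        exact Finset.sum_congr rfl fun _ _ => Finset.sum_comm
    _ ≤ ∑ a, ∑ b, N * (2 * ∑ i, ∑ j, X i a ^ 2 * X j b ^ 2) :=
        Finset.sum_le_sum fun a _ => Finset.sum_le_sum fun b _ =>
          sum_bilin_collision_sq_le (fun i => X i a) (fun j => X j b)
    _ = _ := by
        simp only [← Finset.mul_sum]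
        congr 2
        have h1 : ∀ a b : Fin n, ∑ i, X i a ^ 2 * ∑ j, X j b ^ 2
            = (∑ i, X i a ^ 2) * ∑ j, X j b ^ 2 := fun a b => (Finset.sum_mul _ _ _).symm
        simp only [h1]
        rw [← Finset.sum_mul_sum, ← pow_two, Finset.sum_comm]

/-- Chebyshev's inequality, carried out by counting bad samples. -/
theorem countSketch_apply_le {m n s : ℕ} [NeZero s] (X : Matrix (Fin m) (Fin n) ℝ) {t : ℝ}
    (ht : 0 < t) :
    countSketch s m {S | t ≤ specNorm (Xᵀ * Sᵀ * S * X - Xᵀ * X)} ≤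
      ENNReal.ofReal (2 * (∑ i, ∑ j, X i j ^ 2) ^ 2 / (s * t ^ 2)) := by
  have hmeas : MeasurableSet {S : Matrix (Fin s) (Fin m) ℝ |
      t ≤ specNorm (Xᵀ * Sᵀ * S * X - Xᵀ * X)} :=
    measurableSet_le measurable_const (measurable_specNorm_gram_error X)
  have hs : (0 : ℝ) < s := Nat.cast_pos.2 (NeZero.pos s)
  rw [countSketch, PMF.toMeasure_apply_eq_toOuterMeasure_apply _ hmeas,
    PMF.toOuterMeasure_map_apply]
  classical
  rw [PMF.toOuterMeasure_uniformOfFintype_apply]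
  set B := countSketchMatrix ⁻¹' {S : Matrix (Fin s) (Fin m) ℝ |
      t ≤ specNorm (Xᵀ * Sᵀ * S * X - Xᵀ * X)} with hB
  set N := Fintype.card ((Fin m → Fin s) × (Fin m → ℤˣ)) with hN
  have hNpos : (0 : ℝ) < N := Nat.cast_pos.2 Fintype.card_pos
  have h1 : (Fintype.card B : ℝ) * t ^ 2 ≤ N / s * (2 * (∑ i, ∑ j, X i j ^ 2) ^ 2) := by
    refine le_trans ?_ (sum_specNorm_gram_error_sq_le X)
    rw [← Set.toFinset_card, ← nsmul_eq_mul, ← Finset.sum_const]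
    refine le_trans (Finset.sum_le_sum (fun q hq => ?_))
      (Finset.sum_le_sum_of_subset_of_nonneg (Finset.subset_univ B.toFinset)
        fun _ _ _ => sq_nonneg _)
    have hqB : q ∈ B := Set.mem_toFinset.1 hq
    have hq' : t ≤ specNorm (Xᵀ * (countSketchMatrix q)ᵀ * countSketchMatrix q * X - Xᵀ * X) := hqB
    exact pow_le_pow_left₀ ht.le hq' 2
  rw [← ENNReal.ofReal_natCast, ← ENNReal.ofReal_natCast, ← ENNReal.ofReal_div_of_pos hNpos]
  refine ENNReal.ofReal_le_ofReal ?_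
  rw [div_le_div_iff₀ hNpos (by positivity)]
  calc (Fintype.card B : ℝ) * (s * t ^ 2) = s * (Fintype.card B * t ^ 2) := by ring
    _ ≤ s * (N / s * (2 * (∑ i, ∑ j, X i j ^ 2) ^ 2)) := mul_le_mul_of_nonneg_left h1 hs.le
    _ = _ := by field_simp

/-! ### Size of the prescribed accuracy, and the CountSketch bound. -/

section Accuracy

variable {n d k : ℕ} {A : Matrix (Fin n) (Fin d) ℝ} {ν : ℝ}

theorem relGap_pos (hk : 1 ≤ k) (hr : k ≤ A.rank) (hgap : sigma A (k + 1) < sigma A k) :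
    0 < relGap A k := by
  have h0 := sigma_nonneg A (k + 1)
  have h1 : 0 < sigma A 1 := sigma_pos_of_le_rank le_rfl (hk.trans hr)
  exact div_pos (by nlinarith) (by positivity)

theorem relGap_le_one (A : Matrix (Fin n) (Fin d) ℝ) (hk : 1 ≤ k) : relGap A k ≤ 1 := by
  refine div_le_one_of_le₀ ?_ (sq_nonneg _)
  have := pow_le_pow_left₀ (sigma_nonneg A k) (sigma_antitone A hk) 2
  nlinarith [sq_nonneg (sigma A (k + 1))]

/-- The factor equals `ν / (√(1+ν²) + ν)`, whose denominator is below 2 for `ν < 1/2`. -/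
theorem half_mul_le_sketchAccuracy (hν : 0 < ν) (hν2 : ν < 1 / 2) (hg : 0 ≤ relGap A k) :
    ν / 2 * relGap A k ≤ sketchAccuracy A k ν := by
  refine mul_le_mul_of_nonneg_right ?_ hg
  have h1 : (0 : ℝ) < √(1 + ν ^ 2) := by positivity
  have h2 : √(1 + ν ^ 2) ≤ 5 / 4 := Real.sqrt_le_iff.2 ⟨by norm_num, by nlinarith⟩
  have e : ν / √(1 + ν ^ 2) / (1 + ν / √(1 + ν ^ 2)) = ν / (√(1 + ν ^ 2) + ν) := by
    field_simp
  rw [e]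
  exact div_le_div_of_nonneg_left hν.le (by positivity) (by linarith)

end Accuracy

/-- The constant 8 is the 2 of the second moment bound times the 4 from squaring `ν/2 · gap`. -/
theorem hasApproxGram_countSketch {n d k s : ℕ} [NeZero s] {A : Matrix (Fin n) (Fin d) ℝ}
    (hk : 1 ≤ k) (hr : k ≤ A.rank) (hgap : sigma A (k + 1) < sigma A k) {ν δ : ℝ} (hν : 0 < ν)
    (hν2 : ν < 1 / 2) (hδ : 0 < δ)
    (hs : 8 * (stableRank A ^ 2 / (relGap A k ^ 2 * ν ^ 2 * δ)) ≤ s) :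
    HasApproxGram (countSketch s n) A (sketchAccuracy A k ν) δ := by
  have hg := relGap_pos hk hr hgap
  have hε := half_mul_le_sketchAccuracy hν hν2 hg.le
  set ε := sketchAccuracy A k ν
  have hε0 : 0 < ε := lt_of_lt_of_le (by positivity) hε
  have hA : 0 < specNorm A := by
    rw [specNorm_eq_sigma]; exact sigma_pos_of_le_rank le_rfl (hk.trans hr)
  have hs0 : (0 : ℝ) < s := Nat.cast_pos.2 (NeZero.pos s)
  refine (countSketch_apply_le A (by positivity)).trans (ENNReal.ofReal_le_ofReal ?_)
  have h1 : ∑ i, ∑ j, A i j ^ 2 = stableRank A * specNorm A ^ 2 := by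
    rw [stableRank]; field_simp
  rw [h1, div_le_iff₀ (by positivity)]
  have h2 : 8 * stableRank A ^ 2 ≤ s * (relGap A k ^ 2 * ν ^ 2 * δ) := by
    rw [← mul_div_assoc, div_le_iff₀ (by positivity)] at hs
    exact hs
  have h3 : (ν / 2 * relGap A k) ^ 2 ≤ ε ^ 2 := pow_le_pow_left₀ (by positivity) hε 2
  have h4 : 2 * stableRank A ^ 2 ≤ δ * s * ε ^ 2 := by
    calc _ ≤ δ * s * (ν / 2 * relGap A k) ^ 2 := by nlinarith
      _ ≤ _ := mul_le_mul_of_nonneg_left h3 (by positivity)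
  calc 2 * (stableRank A * specNorm A ^ 2) ^ 2 = 2 * stableRank A ^ 2 * specNorm A ^ 4 := by ring
    _ ≤ δ * s * ε ^ 2 * specNorm A ^ 4 := mul_le_mul_of_nonneg_right h4 (by positivity)
    _ = _ := by ring

/-! ### Moments of sums of centered squares of subgaussian variables. -/

section Subgaussian

variable {Ω : Type*} [MeasurableSpace Ω] {μ : Measure Ω} {c : ℝ≥0}

/-- From `x^q / q! ≤ e^x` at `x = θ|Y|`, where `e^{θ|Y|}` is dominated by the sum of the two
one-sided exponentials. -/
theorem pow_mul_lintegral_abs_pow_le {Y : Ω → ℝ} {θ B : ℝ} (hθ : 0 < θ) (q : ℕ)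
    (hp : Integrable (fun ω => Real.exp (θ * Y ω)) μ)
    (hn : Integrable (fun ω => Real.exp (-θ * Y ω)) μ)
    (hpB : ∫ ω, Real.exp (θ * Y ω) ∂μ ≤ B) (hnB : ∫ ω, Real.exp (-θ * Y ω) ∂μ ≤ B) :
    ∫⁻ ω, ENNReal.ofReal (|Y ω| ^ q) ∂μ ≤ ENNReal.ofReal (2 * B * q.factorial / θ ^ q) := by
  have h1 : ∀ ω, |Y ω| ^ q ≤
      q.factorial / θ ^ q * (Real.exp (θ * Y ω) + Real.exp (-θ * Y ω)) := by
    intro ω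
    have h2 := Real.pow_div_factorial_le_exp (θ * |Y ω|) (by positivity) q
    have h3 : Real.exp (θ * |Y ω|) ≤ Real.exp (θ * Y ω) + Real.exp (-θ * Y ω) := by
      rcases abs_choice (Y ω) with h | h <;> rw [h]
      · have := Real.exp_pos (-θ * Y ω); linarith
      · have := Real.exp_pos (θ * Y ω)
        rw [mul_neg, ← neg_mul]; linarith
    have h4 := h2.trans h3
    rw [div_le_iff₀ (by positivity), mul_pow] at h4
    rw [div_mul_eq_mul_div, le_div_iff₀ (by positivity)]
    linarith
  have hi : Integrable (fun ω => q.factorial / θ ^ q *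
      (Real.exp (θ * Y ω) + Real.exp (-θ * Y ω))) μ := (hp.add hn).const_mul _
  refine (lintegral_mono fun ω => ENNReal.ofReal_le_ofReal (h1 ω)).trans ?_
  rw [← ofReal_integral_eq_lintegral_ofReal hi (Filter.Eventually.of_forall fun ω => by positivity)]
  refine ENNReal.ofReal_le_ofReal ?_
  rw [integral_const_mul, integral_add hp hn]
  calc _ ≤ q.factorial / θ ^ q * (B + B) := mul_le_mul_of_nonneg_left (by linarith) (by positivity)
    _ = _ := by ring

theorem factorial_two_mul_le (j : ℕ) : (2 * j).factorial ≤ j.factorial * (2 * j) ^ j := by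
  have h := Nat.factorial_mul_descFactorial (show j ≤ 2 * j by omega)
  rw [show 2 * j - j = j by omega] at h
  rw [← h]
  exact Nat.mul_le_mul_left _ (Nat.descFactorial_le_pow _ _)

theorem lintegral_even_moment_le {g : Ω → ℝ} (hg : HasSubgaussianMGF g c μ) (hc : 0 < c)
    [IsProbabilityMeasure μ] (j : ℕ) :
    ∫⁻ ω, ENNReal.ofReal ((1 / (6 * c) * g ω ^ 2) ^ j / j.factorial) ∂μ
      ≤ ENNReal.ofReal (2 * (1 / 2) ^ j) := by
  rcases Nat.eq_zero_or_pos j with rfl | hj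
  · simp
  have hc' : (0 : ℝ) < c := hc
  have hj' : (0 : ℝ) < j := Nat.cast_pos.2 hj
  -- This `t` minimizes `e^{ct²/2} / t^{2j}`; the exponential becomes `e^j`.
  set t := √(2 * j / c) with ht
  have ht0 : 0 < t := by positivity
  have ht2 : t ^ 2 = 2 * j / c := Real.sq_sqrt (by positivity)
  have hB : Real.exp (c * t ^ 2 / 2) = Real.exp 1 ^ j := by
    rw [ht2, ← Real.exp_nat_mul]
    congr 1
    field_simp
  have h1 := pow_mul_lintegral_abs_pow_le ht0 (2 * j) (hg.integrable_exp_mul t)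
    (hg.integrable_exp_mul (-t)) (hg.mgf_le t) (by have := hg.mgf_le (-t); rwa [neg_sq] at this)
  have e : ∀ ω, (1 / (6 * c) * g ω ^ 2) ^ j / j.factorial
      = (1 / (6 * c)) ^ j / j.factorial * |g ω| ^ (2 * j) := fun ω => by
    rw [mul_pow, pow_mul, sq_abs]; ring
  simp only [e]
  have hpos : (0 : ℝ) ≤ (1 / (6 * c)) ^ j / j.factorial := by positivity
  simp only [ENNReal.ofReal_mul hpos]
  rw [lintegral_const_mul' _ _ ENNReal.ofReal_ne_top]
  refine (mul_le_mul_right h1 _).trans ?_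
  rw [← ENNReal.ofReal_mul hpos]
  refine ENNReal.ofReal_le_ofReal ?_
  rw [hB, pow_mul, ht2]
  have hf : ((2 * j).factorial : ℝ) ≤ j.factorial * (2 * j) ^ j := by
    exact_mod_cast factorial_two_mul_le j
  calc (1 / (6 * (c : ℝ))) ^ j / j.factorial * (2 * Real.exp 1 ^ j * (2 * j).factorial
        / (2 * j / c) ^ j)
      ≤ (1 / (6 * (c : ℝ))) ^ j / j.factorial * (2 * Real.exp 1 ^ j *
        (j.factorial * (2 * j) ^ j) / (2 * j / c) ^ j) := by gcongr
    _ = 2 * (Real.exp 1 / 6) ^ j := by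
        have : (j.factorial : ℝ) ≠ 0 := Nat.cast_ne_zero.2 (Nat.factorial_ne_zero _)
        simp only [div_pow, mul_pow, one_pow]
        field_simp
    -- The 6 in the exponent is there because `e/6 ≤ 1/2`.
    _ ≤ 2 * (1 / 2) ^ j := by
        have h := Real.exp_one_lt_d9
        exact mul_le_mul_of_nonneg_left (pow_le_pow_left₀ (by positivity) (by linarith) j)
          (by norm_num)

/-- The exponential series is integrated term by term, and `2 Σ 2^{-j} = 4`. -/
theorem lintegral_exp_sq_le {g : Ω → ℝ} (hg : HasSubgaussianMGF g c μ) (hc : 0 < c)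
    [IsProbabilityMeasure μ] :
    ∫⁻ ω, ENNReal.ofReal (Real.exp (1 / (6 * c) * g ω ^ 2)) ∂μ ≤ ENNReal.ofReal 4 := by
  have e : ∀ ω, ENNReal.ofReal (Real.exp (1 / (6 * c) * g ω ^ 2)) =
      ∑' j : ℕ, ENNReal.ofReal ((1 / (6 * c) * g ω ^ 2) ^ j / j.factorial) := by
    intro ω
    rw [← ENNReal.ofReal_tsum_of_nonneg (fun j => by positivity)
      (Real.summable_pow_div_factorial _), Real.exp_eq_exp_ℝ, NormedSpace.exp_eq_tsum_div]
  simp only [e]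
  have hm := hg.aemeasurable
  rw [lintegral_tsum fun j => by fun_prop]
  refine (ENNReal.tsum_le_tsum fun j => lintegral_even_moment_le hg hc j).trans ?_
  rw [← ENNReal.ofReal_tsum_of_nonneg (fun j => by positivity)
    (summable_geometric_two.mul_left 2), tsum_mul_left, tsum_geometric_two]
  norm_num

theorem exp_le_quadratic (x : ℝ) : Real.exp x ≤ 1 + x + x ^ 2 * Real.exp |x| := by
  have h := Complex.norm_exp_sub_sum_le_norm_mul_exp (x : ℂ) 2
  simp only [Finset.sum_range_succ, Finset.sum_range_zero] at h
  have e : Complex.exp x - (0 + (x : ℂ) ^ 0 / (Nat.factorial 0 : ℂ) + (x : ℂ) ^ 1 / (Nat.factorial 1 : ℂ))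
      = ((Real.exp x - 1 - x : ℝ) : ℂ) := by
    push_cast; simp; ring
  rw [e, Complex.norm_real, Complex.norm_real, Real.norm_eq_abs, Real.norm_eq_abs, sq_abs] at h
  have := (abs_le.1 h).2
  linarith

/-- Half of the exponent `a|Y|` absorbs `Y²`, the other half absorbs `e^{|θY|}`. -/
theorem exp_mul_le_quadratic {a θ Y : ℝ} (ha : 0 < a) (hθ : |θ| ≤ a / 2) :
    Real.exp (θ * Y) ≤ 1 + θ * Y + 8 * θ ^ 2 / a ^ 2 * Real.exp (a * |Y|) := by
  have h1 := exp_le_quadratic (θ * Y)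
  have h2 : |θ * Y| ≤ a / 2 * |Y| := by rw [abs_mul]; gcongr
  have h3 := Real.quadratic_le_exp_of_nonneg (show 0 ≤ a / 2 * |Y| by positivity)
  have h4 : Y ^ 2 ≤ 8 / a ^ 2 * Real.exp (a / 2 * |Y|) := by
    rw [div_mul_eq_mul_div, le_div_iff₀ (by positivity)]
    have : (a / 2 * |Y|) ^ 2 = a ^ 2 * Y ^ 2 / 4 := by rw [mul_pow, sq_abs]; ring
    have h5 : 0 ≤ a / 2 * |Y| := by positivity
    linarith
  have h5 : (θ * Y) ^ 2 * Real.exp |θ * Y| ≤ 8 * θ ^ 2 / a ^ 2 * Real.exp (a * |Y|) := by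
    calc (θ * Y) ^ 2 * Real.exp |θ * Y| ≤ θ ^ 2 * (8 / a ^ 2 * Real.exp (a / 2 * |Y|)) *
          Real.exp (a / 2 * |Y|) := by
          rw [mul_pow]; gcongr
      _ = 8 * θ ^ 2 / a ^ 2 * (Real.exp (a / 2 * |Y|) * Real.exp (a / 2 * |Y|)) := by ring
      _ = _ := by rw [← Real.exp_add]; ring_nf
  linarith

/-- The normalization of the second moment removes the linear term of the quadratic bound, so only
an error of order `θ²` remains, and `1 + x ≤ e^x`. -/
theorem mgf_sq_sub_one_le {g : Ω → ℝ} (hg : HasSubgaussianMGF g c μ) (hc : 1 ≤ c)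
    [IsProbabilityMeasure μ] (h2 : ∫ ω, g ω ^ 2 ∂μ = 1) {θ : ℝ} (hθ : |θ| ≤ 1 / (12 * c)) :
    Integrable (fun ω => Real.exp (θ * (g ω ^ 2 - 1))) μ ∧
      ∫ ω, Real.exp (θ * (g ω ^ 2 - 1)) ∂μ ≤ Real.exp (1440 * c ^ 2 * θ ^ 2) := by
  have hc0 : 0 < c := zero_lt_one.trans_le hc
  have hc1 : (1 : ℝ) ≤ c := hc
  have hc' : (0 : ℝ) < c := zero_lt_one.trans_le hc1
  have hm := hg.aemeasurable
  set a : ℝ := 1 / (6 * c) with ha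
  have ha0 : 0 < a := by positivity
  have hE := lintegral_exp_sq_le hg hc0
  have hEi : Integrable (fun ω => Real.exp (a * g ω ^ 2)) μ := by
    refine ⟨(by fun_prop : AEMeasurable _ μ).aestronglyMeasurable, ?_⟩
    rw [hasFiniteIntegral_iff_ofReal (Filter.Eventually.of_forall fun ω => (Real.exp_pos _).le)]
    exact hE.trans_lt ENNReal.ofReal_lt_top
  have hEle : ∫ ω, Real.exp (a * g ω ^ 2) ∂μ ≤ 4 := by
    rw [integral_eq_lintegral_of_nonneg_ae (Filter.Eventually.of_forall fun ω => (Real.exp_pos _).le)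
      hEi.1]
    exact ENNReal.toReal_le_of_le_ofReal (by norm_num) hE
  have hbound : ∀ ω, Real.exp (θ * (g ω ^ 2 - 1)) ≤ 1 + θ * (g ω ^ 2 - 1) +
      8 * θ ^ 2 / a ^ 2 * (5 / 4 * Real.exp (a * g ω ^ 2)) := by
    intro ω
    have h1 : |θ| ≤ a / 2 := hθ.trans (le_of_eq (by rw [ha]; ring))
    refine (exp_mul_le_quadratic ha0 h1).trans ?_
    have h3 : Real.exp (a * |g ω ^ 2 - 1|) ≤ 5 / 4 * Real.exp (a * g ω ^ 2) := by
      have h4 : |g ω ^ 2 - 1| ≤ g ω ^ 2 + 1 := by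
        rw [abs_le]; constructor <;> nlinarith [sq_nonneg (g ω)]
      have h5 : a ≤ 1 / 6 := by
        rw [ha]; exact one_div_le_one_div_of_le (by norm_num) (by linarith)
      have h6 : Real.exp a ≤ 5 / 4 := by
        refine (Real.exp_le_exp.2 h5).trans ?_
        have := Real.exp_bound_div_one_sub_of_interval (x := 1 / 6) (by norm_num) (by norm_num)
        refine this.trans (by norm_num)
      calc Real.exp (a * |g ω ^ 2 - 1|) ≤ Real.exp (a + a * g ω ^ 2) := by
            apply Real.exp_le_exp.2; nlinarith
        _ = Real.exp a * Real.exp (a * g ω ^ 2) := Real.exp_add _ _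
        _ ≤ _ := by gcongr
    gcongr
  have hg2 : Integrable (fun ω => g ω ^ 2) μ := (hg.memLp 2).integrable_sq
  have hYi : Integrable (fun ω => θ * (g ω ^ 2 - 1)) μ := (hg2.sub (integrable_const 1)).const_mul _
  have hY1 : Integrable (fun ω => 1 + θ * (g ω ^ 2 - 1)) μ := (integrable_const 1).add hYi
  have hRi : Integrable (fun ω => 1 + θ * (g ω ^ 2 - 1) +
      8 * θ ^ 2 / a ^ 2 * (5 / 4 * Real.exp (a * g ω ^ 2))) μ :=
    hY1.add ((hEi.const_mul _).const_mul _)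
  have hLi : Integrable (fun ω => Real.exp (θ * (g ω ^ 2 - 1))) μ :=
    hRi.mono' (by fun_prop : AEMeasurable _ μ).aestronglyMeasurable
      (Filter.Eventually.of_forall fun ω => by
        rw [Real.norm_eq_abs, Real.abs_exp]; exact hbound ω)
  refine ⟨hLi, (integral_mono hLi hRi hbound).trans ?_⟩
  rw [integral_add hY1 ((hEi.const_mul _).const_mul _),
    integral_add (integrable_const 1) hYi, integral_const_mul, integral_const_mul,
    integral_const_mul, integral_sub hg2 (integrable_const 1), h2]
  simp only [integral_const, probReal_univ, one_smul, sub_self, mul_zero, add_zero]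
  -- The constant is `8 · (5/4) · 4 · 6² = 1440`, with `1/a = 6c`.
  have h7 : 8 * θ ^ 2 / a ^ 2 * (5 / 4 * ∫ ω, Real.exp (a * g ω ^ 2) ∂μ) ≤ 1440 * c ^ 2 * θ ^ 2 := by
    calc _ ≤ 8 * θ ^ 2 / a ^ 2 * (5 / 4 * 4) := by gcongr
      _ = 1440 * c ^ 2 * θ ^ 2 := by rw [ha]; field_simp; ring
  have := Real.add_one_le_exp (1440 * (c : ℝ) ^ 2 * θ ^ 2)
  linarith

/-- Moments of averages of independent centered squares of subgaussian variables. -/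
theorem lintegral_abs_sum_sq_sub_one_pow_le [IsProbabilityMeasure μ] {s : ℕ} {g : Fin s → Ω → ℝ}
    (hg : ∀ l, HasSubgaussianMGF (g l) c μ) (hc : 1 ≤ c) (hm : ∀ l, Measurable (g l))
    (h2 : ∀ l, ∫ ω, g l ω ^ 2 ∂μ = 1) (hind : iIndepFun g μ) {q : ℕ} (hq : 0 < q) (hqs : q ≤ s) :
    ∫⁻ ω, ENNReal.ofReal (|∑ l, (g l ω ^ 2 - 1)| ^ q) ∂μ ≤
      ENNReal.ofReal (2 * (12 * c * Real.exp 10 * √(q * s)) ^ q) := by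
  have hc1 : (1 : ℝ) ≤ c := hc
  have hc' : (0 : ℝ) < c := zero_lt_one.trans_le hc1
  have hq' : (0 : ℝ) < q := Nat.cast_pos.2 hq
  have hs' : (0 : ℝ) < s := Nat.cast_pos.2 (hq.trans_le hqs)
  set Y : Fin s → Ω → ℝ := fun l ω => g l ω ^ 2 - 1 with hY
  have hYm : ∀ l, Measurable (Y l) := fun l => by have := hm l; fun_prop
  have hYind : iIndepFun Y μ :=
    hind.comp (fun _ x => x ^ 2 - 1) fun _ => by fun_prop
  -- This makes the total exponent `s · 1440 c² θ²` equal to `10 q`; the condition `q ≤ s` keeps `θ`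
  -- in the admissible range.
  set θ := 1 / (12 * c) * √(q / s) with hθ
  have hr : √((q : ℝ) / s) ≤ 1 := Real.sqrt_le_one.2 (by
    rw [div_le_one hs']; exact_mod_cast hqs)
  have hθ0 : 0 < θ := by positivity
  have hθ1 : θ ≤ 1 / (12 * c) := mul_le_of_le_one_right (by positivity) hr
  have hexp : ∀ θ' : ℝ, |θ'| = θ → Integrable (fun ω => Real.exp (θ' * ∑ l, Y l ω)) μ ∧
      ∫ ω, Real.exp (θ' * ∑ l, Y l ω) ∂μ ≤ Real.exp 10 ^ q := by
    intro θ' hθ'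
    have h1 := fun l => mgf_sq_sub_one_le (hg l) hc (h2 l) (hθ'.le.trans hθ1)
    have h3 := hYind.integrable_exp_mul_sum hYm (s := Finset.univ) fun l _ => (h1 l).1
    have h4 := hYind.mgf_sum (t := θ') hYm Finset.univ
    simp only [mgf, Finset.sum_apply] at h3 h4
    refine ⟨h3, ?_⟩
    rw [h4]
    calc _ ≤ ∏ _l : Fin s, Real.exp (1440 * c ^ 2 * θ' ^ 2) :=
          Finset.prod_le_prod (fun l _ => integral_nonneg fun _ => (Real.exp_pos _).le)
            fun l _ => (h1 l).2
      _ = Real.exp 10 ^ q := by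
          rw [Finset.prod_const, Finset.card_univ, Fintype.card_fin, ← Real.exp_nat_mul,
            ← Real.exp_nat_mul, ← sq_abs θ', hθ', hθ, mul_pow, Real.sq_sqrt (by positivity)]
          congr 1
          field_simp
          norm_num
  have h5 := hexp θ (abs_of_pos hθ0)
  have h6 := hexp (-θ) (by rw [abs_neg, abs_of_pos hθ0])
  refine (pow_mul_lintegral_abs_pow_le hθ0 q h5.1 h6.1 h5.2 h6.2).trans
    (ENNReal.ofReal_le_ofReal ?_)
  have hfac : (q.factorial : ℝ) ≤ (q : ℝ) ^ q := by exact_mod_cast Nat.factorial_le_pow q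
  have hqθ : (q : ℝ) / θ = 12 * c * √(q * s) := by
    rw [div_eq_iff hθ0.ne', hθ]
    have : √((q : ℝ) * s) * √(q / s) = q := by
      rw [← Real.sqrt_mul (by positivity), show (q : ℝ) * s * (q / s) = q ^ 2 by field_simp,
        Real.sqrt_sq hq'.le]
    calc (q : ℝ) = √((q : ℝ) * s) * √(q / s) := this.symm
      _ = _ := by field_simp
  clear_value θ
  calc 2 * Real.exp 10 ^ q * q.factorial / θ ^ q ≤ 2 * Real.exp 10 ^ q * q ^ q / θ ^ q := by gcongr
    _ = 2 * (Real.exp 10 * (q / θ)) ^ q := by rw [mul_pow, div_pow]; ring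
    _ = _ := by rw [hqθ]; ring

end Subgaussian

/-- From `1 + t E X ≤ E e^{tX} ≤ e^{ct²/2}`, the difference of the outer terms is minimal at `t =
0`, so its derivative `-E X` vanishes there. -/
theorem integral_eq_zero_of_hasSubgaussianMGF {Ω : Type*} [MeasurableSpace Ω] {μ : Measure Ω}
    [IsProbabilityMeasure μ] {X : Ω → ℝ} {c : ℝ≥0} (h : HasSubgaussianMGF X c μ) :
    ∫ ω, X ω ∂μ = 0 := by
  set e := ∫ ω, X ω ∂μ with he
  have h1 : ∀ t : ℝ, t * e + 1 ≤ Real.exp (c * t ^ 2 / 2) := by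
    intro t
    refine le_trans ?_ (h.mgf_le t)
    have hi : Integrable (fun ω => t * X ω) μ := h.integrable.const_mul t
    have h2 : t * e + 1 = ∫ ω, (t * X ω + 1) ∂μ := by
      rw [integral_add hi (integrable_const 1), integral_const_mul]; simp [he]
    rw [h2]
    exact integral_mono (hi.add (integrable_const 1)) (h.integrable_exp_mul t)
      fun ω => Real.add_one_le_exp _
  have hd : HasDerivAt (fun t : ℝ => Real.exp (c * t ^ 2 / 2) - (t * e + 1)) (-e) 0 := by
    have h3 : HasDerivAt (fun t : ℝ => (c : ℝ) * t ^ 2 / 2) 0 0 := by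
      have := (((hasDerivAt_id (0 : ℝ)).pow 2).const_mul (c : ℝ)).div_const 2
      simpa using this
    have h4 : HasDerivAt (fun t : ℝ => Real.exp (c * t ^ 2 / 2) - (t * e + 1))
        (Real.exp (c * 0 ^ 2 / 2) * 0 - 1 * e) 0 :=
      h3.exp.sub (((hasDerivAt_id (0 : ℝ)).mul_const e).add_const 1)
    convert h4 using 1
    simp
  have hmin : IsLocalMin (fun t : ℝ => Real.exp (c * t ^ 2 / 2) - (t * e + 1)) 0 := by
    refine Filter.Eventually.of_forall fun t => ?_
    have := h1 t
    simp
    linarith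
  have := hmin.hasDerivAt_eq_zero hd
  linarith

theorem hasSubgaussianMGF_mono {Ω : Type*} [MeasurableSpace Ω] {μ : Measure Ω}
    {X : Ω → ℝ} {c c' : ℝ≥0} (h : HasSubgaussianMGF X c μ) (hc : c ≤ c') :
    HasSubgaussianMGF X c' μ where
  integrable_exp_mul := h.integrable_exp_mul
  mgf_le t := (h.mgf_le t).trans (Real.exp_le_exp.2 (by
    have : (c : ℝ) ≤ c' := hc
    gcongr))

/-! ### Moments of `‖Sx‖²` and `⟪Sx, Sy⟫` for a subgaussian map. -/

section Sketch

variable {D : Measure ℝ} {κ : ℝ≥0} {m s : ℕ}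

/-- Viewing a row as noise makes `IsNoise.affine_sq` available for its second moments. -/
theorem IsSubgaussian.isNoise (h : IsSubgaussian D κ) (m : ℕ) :
    IsNoise (Measure.pi fun _ : Fin m => D) (fun j w => w j) (√(variance id D)) := by
  have := h.prob
  have hmap : ∀ j, (Measure.pi fun _ : Fin m => D).map (fun w => w j) = D := fun j =>
    (measurePreserving_eval (fun _ : Fin m => D) j).map_eq
  have hmem : MemLp id 2 D := h.mgf.memLp 2
  refine ⟨fun j => ?_, fun j => ?_, fun j => ?_, ?_⟩
  · have h1 : MemLp id 2 ((Measure.pi fun _ : Fin m => D).map (fun w => w j)) := by rwa [hmap]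
    exact h1.comp_of_map (measurable_pi_apply j).aemeasurable
  · have h1 : ∫ x, id x ∂((Measure.pi fun _ : Fin m => D).map (fun w => w j)) = 0 := by
      rw [hmap]; exact integral_eq_zero_of_hasSubgaussianMGF h.mgf
    exact (integral_map (φ := fun w : Fin m → ℝ => w j) (measurable_pi_apply j).aemeasurable
      measurable_id.aestronglyMeasurable).symm.trans h1
  · rw [Real.sq_sqrt h.variance_pos.le, ← variance_id_map (measurable_pi_apply j).aemeasurable,
      hmap]
  · exact iIndepFun_pi fun _ => aemeasurable_id

/-- The normalized inner product of a random row with `x`. -/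
noncomputable def rowInner (D : Measure ℝ) (x : EuclideanSpace ℝ (Fin m)) (w : Fin m → ℝ) : ℝ :=
  ∑ j, x j / √(variance id D) * w j

theorem measurable_rowInner (x : EuclideanSpace ℝ (Fin m)) : Measurable (rowInner D x) := by
  unfold rowInner; fun_prop

theorem IsSubgaussian.integral_rowInner_sq (h : IsSubgaussian D κ)
    (x : EuclideanSpace ℝ (Fin m)) :
    ∫ w, rowInner D x w ^ 2 ∂(Measure.pi fun _ : Fin m => D) = ‖x‖ ^ 2 := by
  have := h.prob
  have h1 := ((h.isNoise m).affine_sq 0 (fun j => x j / √(variance id D))).2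
  simp only [zero_add] at h1
  have hv := h.variance_pos
  simp only [rowInner]
  rw [h1, EuclideanSpace.norm_sq_eq, Real.sq_sqrt hv.le]
  simp only [div_pow, Real.sq_sqrt hv.le, Real.norm_eq_abs, sq_abs]
  rw [← Finset.sum_div]
  field_simp
  simp

theorem IsSubgaussian.hasSubgaussianMGF_rowInner (h : IsSubgaussian D κ)
    {x : EuclideanSpace ℝ (Fin m)} (hx : ‖x‖ = 1) :
    HasSubgaussianMGF (rowInner D x) κ (Measure.pi fun _ : Fin m => D) := by
  have := h.prob
  have hv := h.variance_pos
  have h1 : ∀ j, HasSubgaussianMGF (fun w : Fin m → ℝ => x j / √(variance id D) * w j)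
      (((x j / √(variance id D)) ^ 2).toNNReal * (κ * (variance id D).toNNReal))
      (Measure.pi fun _ : Fin m => D) := by
    intro j
    rw [Real.toNNReal_of_nonneg (sq_nonneg _)]
    refine HasSubgaussianMGF.const_mul ?_ _
    refine HasSubgaussianMGF.of_map (X := id) (Y := fun w : Fin m → ℝ => w j)
      (measurable_pi_apply j).aemeasurable ?_
    rw [(measurePreserving_eval (fun _ : Fin m => D) j).map_eq]
    exact h.mgf
  have hind : iIndepFun (fun j (w : Fin m → ℝ) => x j / √(variance id D) * w j)
      (Measure.pi fun _ : Fin m => D) :=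
    iIndepFun_pi (X := fun j (y : ℝ) => x j / √(variance id D) * y) fun j => by fun_prop
  have h2 := HasSubgaussianMGF.sum_of_iIndepFun hind (s := Finset.univ) fun j _ => h1 j
  refine hasSubgaussianMGF_mono h2 (le_of_eq ?_)
  ext
  push_cast
  have h3 : ∑ j, x j ^ 2 = 1 := by
    have := EuclideanSpace.norm_sq_eq x
    rw [hx, one_pow] at this
    simpa using this.symm
  have h4 : ∀ j, (((x j / √(variance id D)) ^ 2).toNNReal : ℝ) = x j ^ 2 / variance id D :=
    fun j => by rw [Real.coe_toNNReal _ (sq_nonneg _), div_pow, Real.sq_sqrt hv.le]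
  simp only [h4, Real.coe_toNNReal _ hv.le]
  rw [← Finset.sum_mul, ← Finset.sum_div, h3]
  field_simp

/-- Regrouping the entries by rows exposes the independent rows on which the moment bound relies. -/
theorem iidSketch_eq_map_pi (s m : ℕ) (D : Measure ℝ) [IsProbabilityMeasure D] :
    iidSketch s m D = (Measure.pi fun _ : Fin s => Measure.pi fun _ : Fin m => D).map
      fun W => Matrix.of fun i j => W i j / √(s * variance id D) := by
  have h1 : (Measure.pi fun _ : Fin s × Fin m => D) =
      (Measure.pi fun _ : Fin s => Measure.pi fun _ : Fin m => D).map
        fun W (p : Fin s × Fin m) => W p.1 p.2 := by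
    refine Measure.pi_eq fun B hB => ?_
    have hme : Measurable fun (W : Fin s → Fin m → ℝ) (p : Fin s × Fin m) => W p.1 p.2 := by
      fun_prop
    rw [Measure.map_apply hme (MeasurableSet.univ_pi hB)]
    have h2 : (fun (W : Fin s → Fin m → ℝ) (p : Fin s × Fin m) => W p.1 p.2) ⁻¹'
        (Set.univ.pi B) = Set.univ.pi fun i => Set.univ.pi fun j => B (i, j) := by
      ext W
      simp [Set.mem_pi]
    rw [h2, Measure.pi_pi]
    simp only [Measure.pi_pi]
    rw [Fintype.prod_prod_type]
  have hm1 : Measurable fun (W : Fin s → Fin m → ℝ) (p : Fin s × Fin m) => W p.1 p.2 := by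
    fun_prop
  have hm2 : Measurable fun (Z : Fin s × Fin m → ℝ) =>
      (Matrix.of fun i j => Z (i, j) / √(s * variance id D) : Matrix (Fin s) (Fin m) ℝ) :=
    measurable_pi_lambda _ fun i => measurable_pi_lambda _ fun j => by
      change Measurable fun Z : Fin s × Fin m → ℝ => Z (i, j) / √(s * variance id D)
      fun_prop
  rw [iidSketch, h1, Measure.map_map hm2 hm1]
  rfl

theorem measurable_of_div (c : ℝ) : Measurable fun (W : Fin s → Fin m → ℝ) =>
    (Matrix.of fun i j => W i j / c : Matrix (Fin s) (Fin m) ℝ) :=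
  measurable_pi_lambda _ fun i => measurable_pi_lambda _ fun j => by
    change Measurable fun W : Fin s → Fin m → ℝ => W i j / c
    fun_prop

theorem measurable_sketch_apply (x : EuclideanSpace ℝ (Fin m)) (l : Fin s) :
    Measurable fun S : Matrix (Fin s) (Fin m) ℝ => Matrix.toEuclideanLin S x l := by
  have h : ∀ S : Matrix (Fin s) (Fin m) ℝ, Matrix.toEuclideanLin S x l = ∑ j, S l j * x j :=
    fun S => rfl
  simp only [h]
  have h2 : ∀ j, Measurable fun S : Matrix (Fin s) (Fin m) ℝ => S l j := fun j =>
    (measurable_pi_apply j).comp (measurable_pi_apply l)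
  exact Finset.measurable_sum _ fun j _ => (h2 j).mul_const _

theorem measurable_sketch_inner (x y : EuclideanSpace ℝ (Fin m)) :
    Measurable fun S : Matrix (Fin s) (Fin m) ℝ =>
      inner ℝ (Matrix.toEuclideanLin S x) (Matrix.toEuclideanLin S y) := by
  simp only [PiLp.inner_apply, RCLike.inner_apply, conj_trivial]
  exact Finset.measurable_sum _ fun l _ =>
    (measurable_sketch_apply y l).mul (measurable_sketch_apply x l)

theorem measurable_sketch_norm_sq (x : EuclideanSpace ℝ (Fin m)) :
    Measurable fun S : Matrix (Fin s) (Fin m) ℝ => ‖Matrix.toEuclideanLin S x‖ ^ 2 := by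
  simp only [← real_inner_self_eq_norm_sq]
  exact measurable_sketch_inner x x

theorem norm_sketch_sq_sub_one (hv : 0 < variance id D) (hs : 0 < s)
    (x : EuclideanSpace ℝ (Fin m)) (W : Fin s → Fin m → ℝ) :
    ‖Matrix.toEuclideanLin (Matrix.of fun i j => W i j / √(s * variance id D)) x‖ ^ 2 - 1
      = 1 / s * ∑ l, (rowInner D x (W l) ^ 2 - 1) := by
  have hs' : (0 : ℝ) < s := Nat.cast_pos.2 hs
  rw [EuclideanSpace.norm_sq_eq, Finset.sum_sub_distrib, mul_sub]
  congr 1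
  · rw [Finset.mul_sum]
    refine Finset.sum_congr rfl fun l _ => ?_
    rw [Real.norm_eq_abs, sq_abs]
    have h : Matrix.toEuclideanLin (Matrix.of fun i j => W i j / √(s * variance id D)) x l
        = 1 / √s * rowInner D x (W l) := by
      change ∑ j, W l j / √(s * variance id D) * x j = _
      rw [rowInner, Finset.mul_sum]
      refine Finset.sum_congr rfl fun j _ => ?_
      rw [Real.sqrt_mul hs'.le]
      field_simp
    rw [h, mul_pow, div_pow, Real.sq_sqrt hs'.le, one_pow]
  · simp
    field_simp

variable {K : ℝ≥0} {q : ℕ}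

/-- For a unit vector, `s (‖Sx‖² - 1)` is a sum over independent rows of centered squares of
subgaussian variables. -/
theorem IsSubgaussian.lintegral_norm_sq_sub_one_pow_le (h : IsSubgaussian D κ) (hκ : κ ≤ K)
    (hK : 1 ≤ K) (hq : 0 < q) (hqs : q ≤ s) {x : EuclideanSpace ℝ (Fin m)} (hx : ‖x‖ = 1) :
    ∫⁻ S, ENNReal.ofReal (|‖Matrix.toEuclideanLin S x‖ ^ 2 - 1| ^ q) ∂(iidSketch s m D) ≤
      ENNReal.ofReal (2 * (12 * K * Real.exp 10 * √(q / s)) ^ q) := by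
  have := h.prob
  have hs : 0 < s := hq.trans_le hqs
  have hs' : (0 : ℝ) < s := Nat.cast_pos.2 hs
  set ρ := Measure.pi fun _ : Fin m => D with hρ
  rw [iidSketch_eq_map_pi, lintegral_map _ (measurable_of_div _)]
  swap
  · have := measurable_sketch_norm_sq (s := s) x
    fun_prop
  simp only [norm_sketch_sq_sub_one h.variance_pos hs, abs_mul, mul_pow]
  have hpos : (0 : ℝ) ≤ |1 / (s : ℝ)| ^ q := by positivity
  simp only [ENNReal.ofReal_mul hpos]
  rw [lintegral_const_mul' _ _ ENNReal.ofReal_ne_top]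
  have hmap : ∀ l, (Measure.pi fun _ : Fin s => ρ).map (fun W => W l) = ρ := fun l =>
    (measurePreserving_eval (fun _ : Fin s => ρ) l).map_eq
  have hsub : HasSubgaussianMGF (rowInner D x) K ρ :=
    hasSubgaussianMGF_mono (h.hasSubgaussianMGF_rowInner hx) hκ
  have h1 := lintegral_abs_sum_sq_sub_one_pow_le (μ := Measure.pi fun _ : Fin s => ρ) (c := K)
    (g := fun l W => rowInner D x (W l))
    (fun l => HasSubgaussianMGF.of_map (X := rowInner D x) (Y := fun W : Fin s → Fin m → ℝ => W l)
      (measurable_pi_apply l).aemeasurable (by rw [hmap]; exact hsub)) hK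
    (fun l => (measurable_rowInner x).comp (measurable_pi_apply l))
    (fun l => by
      have h2 := h.integral_rowInner_sq x
      rw [← hρ, ← hmap l, integral_map (measurable_pi_apply l).aemeasurable
        ((measurable_rowInner x).pow_const 2).aestronglyMeasurable, hx, one_pow] at h2
      exact h2)
    (iIndepFun_pi fun _ => (measurable_rowInner x).aemeasurable) hq hqs
  refine (mul_le_mul_right h1 _).trans ?_
  rw [← ENNReal.ofReal_mul hpos]
  refine ENNReal.ofReal_le_ofReal (le_of_eq ?_)
  have h3 : √((q : ℝ) / s) = |1 / (s : ℝ)| * √(q * s) := by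
    rw [abs_of_pos (by positivity), show (q : ℝ) / s = (1 / s) ^ 2 * (q * s) by field_simp,
      Real.sqrt_mul (by positivity), Real.sqrt_sq (by positivity)]
  rw [h3]
  ring

theorem IsSubgaussian.lintegral_norm_sq_sub_pow_le (h : IsSubgaussian D κ) (hκ : κ ≤ K)
    (hK : 1 ≤ K) (hq : 0 < q) (hqs : q ≤ s) (x : EuclideanSpace ℝ (Fin m)) :
    ∫⁻ S, ENNReal.ofReal (|‖Matrix.toEuclideanLin S x‖ ^ 2 - ‖x‖ ^ 2| ^ q) ∂(iidSketch s m D) ≤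
      ENNReal.ofReal (2 * (12 * K * Real.exp 10 * ‖x‖ ^ 2 * √(q / s)) ^ q) := by
  by_cases hx : x = 0
  · subst hx
    simp [hq.ne']
  have hx' : 0 < ‖x‖ := norm_pos_iff.2 hx
  have h1 := h.lintegral_norm_sq_sub_one_pow_le hκ hK hq hqs (x := ‖x‖⁻¹ • x)
    (by rw [norm_smul, norm_inv, norm_norm, inv_mul_cancel₀ hx'.ne'])
  have e : ∀ S : Matrix (Fin s) (Fin m) ℝ, |‖Matrix.toEuclideanLin S x‖ ^ 2 - ‖x‖ ^ 2| ^ q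
      = (‖x‖ ^ 2) ^ q * |‖Matrix.toEuclideanLin S (‖x‖⁻¹ • x)‖ ^ 2 - 1| ^ q := by
    intro S
    rw [← mul_pow]
    congr 1
    rw [← abs_of_pos (by positivity : 0 < ‖x‖ ^ 2), ← abs_mul, map_smul, norm_smul, norm_inv,
      norm_norm, abs_of_pos (by positivity : 0 < ‖x‖ ^ 2)]
    congr 1
    field_simp
  simp only [e]
  have hpos : (0 : ℝ) ≤ (‖x‖ ^ 2) ^ q := by positivity
  simp only [ENNReal.ofReal_mul hpos]
  rw [lintegral_const_mul' _ _ ENNReal.ofReal_ne_top]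
  refine (mul_le_mul_right h1 _).trans ?_
  rw [← ENNReal.ofReal_mul hpos]
  refine ENNReal.ofReal_le_ofReal (le_of_eq ?_)
  ring

theorem abs_sub_pow_le (a b : ℝ) (q : ℕ) : |a - b| ^ q ≤ 2 ^ q * (|a| ^ q + |b| ^ q) := by
  calc |a - b| ^ q ≤ (|a| + |b|) ^ q := pow_le_pow_left₀ (abs_nonneg _) (abs_sub a b) q
    _ ≤ 2 ^ (q - 1) * (|a| ^ q + |b| ^ q) := add_pow_le (abs_nonneg _) (abs_nonneg _) q
    _ ≤ _ := by
        refine mul_le_mul_of_nonneg_right (pow_le_pow_right₀ (by norm_num) (Nat.sub_le _ _))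
          (by positivity)

/-- Polarization: the base constant is `24 = 12 · 4 · 2 / 4`, from `‖x ± y‖² ≤ 4`, the splitting of
the power of a difference, and the polarization factor. -/
theorem IsSubgaussian.lintegral_inner_sub_pow_le (h : IsSubgaussian D κ) (hκ : κ ≤ K)
    (hK : 1 ≤ K) (hq : 0 < q) (hqs : q ≤ s) {x y : EuclideanSpace ℝ (Fin m)} (hx : ‖x‖ ≤ 1)
    (hy : ‖y‖ ≤ 1) :
    ∫⁻ S, ENNReal.ofReal (|inner ℝ (Matrix.toEuclideanLin S x) (Matrix.toEuclideanLin S y)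
        - inner ℝ x y| ^ q) ∂(iidSketch s m D) ≤
      ENNReal.ofReal (4 * (24 * K * Real.exp 10 * √(q / s)) ^ q) := by
  have hb : ∀ z : EuclideanSpace ℝ (Fin m), ‖z‖ ≤ 2 →
      ∫⁻ S, ENNReal.ofReal (|‖Matrix.toEuclideanLin S z‖ ^ 2 - ‖z‖ ^ 2| ^ q) ∂(iidSketch s m D) ≤
      ENNReal.ofReal (2 * (12 * K * Real.exp 10 * 4 * √(q / s)) ^ q) := by
    intro z hz
    refine (h.lintegral_norm_sq_sub_pow_le hκ hK hq hqs z).trans (ENNReal.ofReal_le_ofReal ?_)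
    have : ‖z‖ ^ 2 ≤ 4 := by nlinarith [norm_nonneg z]
    gcongr
  have h1 := hb (x + y) ((norm_add_le x y).trans (by linarith))
  have h2 := hb (x - y) ((norm_sub_le x y).trans (by linarith))
  have e : ∀ S : Matrix (Fin s) (Fin m) ℝ,
      |inner ℝ (Matrix.toEuclideanLin S x) (Matrix.toEuclideanLin S y) - inner ℝ x y| ^ q ≤
      (1 / 2) ^ q * (|‖Matrix.toEuclideanLin S (x + y)‖ ^ 2 - ‖x + y‖ ^ 2| ^ q
        + |‖Matrix.toEuclideanLin S (x - y)‖ ^ 2 - ‖x - y‖ ^ 2| ^ q) := by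
    intro S
    have h3 : inner ℝ (Matrix.toEuclideanLin S x) (Matrix.toEuclideanLin S y) - inner ℝ x y
        = 1 / 4 * ((‖Matrix.toEuclideanLin S (x + y)‖ ^ 2 - ‖x + y‖ ^ 2)
          - (‖Matrix.toEuclideanLin S (x - y)‖ ^ 2 - ‖x - y‖ ^ 2)) := by
      rw [map_add, map_sub, norm_add_sq_real, norm_add_sq_real, norm_sub_sq_real, norm_sub_sq_real]
      ring
    rw [h3, abs_mul, mul_pow, abs_of_pos (by norm_num : (0 : ℝ) < 1 / 4)]
    refine (mul_le_mul_of_nonneg_left (abs_sub_pow_le _ _ q) (by positivity)).trans (le_of_eq ?_)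
    rw [← mul_assoc, ← mul_pow]
    norm_num
  refine (lintegral_mono fun S => ENNReal.ofReal_le_ofReal (e S)).trans ?_
  have hpos : (0 : ℝ) ≤ (1 / 2) ^ q := by positivity
  simp only [ENNReal.ofReal_mul hpos]
  rw [lintegral_const_mul' _ _ ENNReal.ofReal_ne_top]
  have h4 : ∀ S : Matrix (Fin s) (Fin m) ℝ,
      ENNReal.ofReal (|‖Matrix.toEuclideanLin S (x + y)‖ ^ 2 - ‖x + y‖ ^ 2| ^ q
        + |‖Matrix.toEuclideanLin S (x - y)‖ ^ 2 - ‖x - y‖ ^ 2| ^ q) =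
      ENNReal.ofReal (|‖Matrix.toEuclideanLin S (x + y)‖ ^ 2 - ‖x + y‖ ^ 2| ^ q)
        + ENNReal.ofReal (|‖Matrix.toEuclideanLin S (x - y)‖ ^ 2 - ‖x - y‖ ^ 2| ^ q) := fun S =>
    ENNReal.ofReal_add (by positivity) (by positivity)
  simp only [h4]
  rw [lintegral_add_left]
  swap
  · have := measurable_sketch_norm_sq (s := s) (x + y)
    fun_prop
  refine (mul_le_mul_right (add_le_add h1 h2) _).trans ?_
  rw [← ENNReal.ofReal_add (by positivity) (by positivity), ← ENNReal.ofReal_mul hpos]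
  refine ENNReal.ofReal_le_ofReal (le_of_eq ?_)
  rw [show 12 * (K : ℝ) * Real.exp 10 * 4 * √(q / s) = 2 * (24 * K * Real.exp 10 * √(q / s)) by ring,
    mul_pow 2]
  have : (1 / 2 : ℝ) ^ q * 2 ^ q = 1 := by rw [← mul_pow]; norm_num
  linear_combination (4 * (24 * K * Real.exp 10 * √(q / s)) ^ q) * this

end Sketch

/-! ### Nets of the unit ball and bilinear forms. -/

section Nets

variable {E F : Type*} [NormedAddCommGroup E] [NormedSpace ℝ E] [FiniteDimensional ℝ E]
  [NormedAddCommGroup F] [NormedSpace ℝ F] [FiniteDimensional ℝ F]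

/-- A largest 1-separated subset of the ball of radius 2 is also a 1-net of it; halving gives the
net, and the packing bound gives its size. -/
theorem exists_half_net {m : ℕ} (hm : Module.finrank ℝ E ≤ m) :
    ∃ T : Finset E, T.card ≤ 5 ^ m ∧ (∀ t ∈ T, ‖t‖ ≤ 1) ∧
      ∀ x : E, ‖x‖ ≤ 1 → ∃ t ∈ T, ‖x - t‖ ≤ 1 / 2 := by
  classical
  let P : Finset E → Prop := fun T => (∀ c ∈ T, ‖c‖ ≤ 2) ∧
    ∀ c ∈ T, ∀ d ∈ T, c ≠ d → 1 ≤ ‖c - d‖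
  have hP : ∀ T, P T → T.card ≤ 5 ^ Module.finrank ℝ E := fun T hT =>
    Besicovitch.card_le_of_separated T hT.1 hT.2
  obtain ⟨T, hT, hmax⟩ : ∃ T, P T ∧ ∀ T', P T' → T'.card ≤ T.card := by
    have hne : {n | ∃ T, P T ∧ T.card = n}.Nonempty := ⟨0, ∅, by simp [P], rfl⟩
    have hbdd : BddAbove {n | ∃ T, P T ∧ T.card = n} :=
      ⟨_, by rintro _ ⟨T, hT, rfl⟩; exact hP T hT⟩
    obtain ⟨T, hT, hc⟩ := Nat.sSup_mem hne hbdd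
    exact ⟨T, hT, fun T' hT' => hc ▸ le_csSup hbdd ⟨T', hT', rfl⟩⟩
  refine ⟨T.image fun c => (1 / 2 : ℝ) • c, ?_, ?_, ?_⟩
  · exact Finset.card_image_le.trans ((hP T hT).trans (Nat.pow_le_pow_right (by norm_num) hm))
  · intro t ht
    obtain ⟨c, hc, rfl⟩ := Finset.mem_image.1 ht
    rw [norm_smul]
    have := hT.1 c hc
    norm_num
    linarith
  · intro x hx
    have h2x : ‖(2 : ℝ) • x‖ ≤ 2 := by rw [norm_smul]; norm_num; linarith
    obtain ⟨c, hc, hcx⟩ : ∃ c ∈ T, ‖(2 : ℝ) • x - c‖ < 1 := by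
      by_contra h
      push Not at h
      have hnot : (2 : ℝ) • x ∉ T := fun hmem => by
        have := h _ hmem
        rw [sub_self, norm_zero] at this
        linarith
      have := hmax (insert ((2 : ℝ) • x) T) ⟨?_, ?_⟩
      · rw [Finset.card_insert_of_notMem hnot] at this; omega
      · intro c hc
        rcases Finset.mem_insert.1 hc with rfl | hc
        · exact h2x
        · exact hT.1 c hc
      · intro c hc d hd hcd
        rcases Finset.mem_insert.1 hc with rfl | hc <;> rcases Finset.mem_insert.1 hd with rfl | hd
        · exact absurd rfl hcd
        · exact h d hd
        · rw [norm_sub_rev]; exact h c hc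
        · exact hT.2 c hc d hd hcd
    refine ⟨(1 / 2 : ℝ) • c, Finset.mem_image_of_mem _ hc, ?_⟩
    have e : x - (1 / 2 : ℝ) • c = (1 / 2 : ℝ) • ((2 : ℝ) • x - c) := by
      rw [smul_sub, smul_smul]; norm_num
    rw [e, norm_smul]
    norm_num
    linarith

/-- Approximating by the net gives `‖f‖ ≤ M + ‖f‖/2`, in which the last term is absorbed. -/
theorem abs_apply_le_of_net {T : Finset E} (hT : ∀ x : E, ‖x‖ ≤ 1 → ∃ t ∈ T, ‖x - t‖ ≤ 1 / 2)
    (φ : E →ₗ[ℝ] ℝ) {M : ℝ} (hM : 0 ≤ M) (h : ∀ t ∈ T, |φ t| ≤ M) (x : E) :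
    |φ x| ≤ 2 * M * ‖x‖ := by
  set f := LinearMap.toContinuousLinearMap φ
  have hf : ∀ x, f x = φ x := fun _ => rfl
  have h1 : ‖f‖ ≤ M + ‖f‖ / 2 := by
    refine ContinuousLinearMap.opNorm_le_of_unit_norm (by positivity) fun x hx => ?_
    obtain ⟨t, ht, hxt⟩ := hT x hx.le
    have h2 : f x = f t + f (x - t) := by rw [← map_add]; congr 1; abel
    rw [h2]
    refine (norm_add_le _ _).trans (add_le_add (h t ht) ((f.le_opNorm _).trans ?_))
    have := mul_le_mul_of_nonneg_left hxt (norm_nonneg f)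
    linarith
  rw [← hf, ← Real.norm_eq_abs]
  exact (f.le_opNorm x).trans (mul_le_mul_of_nonneg_right (by linarith) (norm_nonneg _))

theorem abs_bilin_le_of_net {T : Finset E} {T' : Finset F}
    (hT : ∀ x : E, ‖x‖ ≤ 1 → ∃ t ∈ T, ‖x - t‖ ≤ 1 / 2)
    (hT' : ∀ x : F, ‖x‖ ≤ 1 → ∃ t ∈ T', ‖x - t‖ ≤ 1 / 2)
    (B : E →ₗ[ℝ] F →ₗ[ℝ] ℝ) {M : ℝ} (hM : 0 ≤ M) (h : ∀ t ∈ T, ∀ t' ∈ T', |B t t'| ≤ M)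
    (x : E) (y : F) : |B x y| ≤ 4 * M * ‖x‖ * ‖y‖ := by
  have h1 : ∀ t' ∈ T', |B x t'| ≤ 2 * M * ‖x‖ := fun t' ht' =>
    abs_apply_le_of_net hT (B.flip t') hM (fun t ht => h t ht t' ht') x
  have h2 := abs_apply_le_of_net hT' (B x) (by positivity) h1 y
  linarith

end Nets

/-- A maximum is replaced by a sum of powers, whose expectation can be taken termwise. -/
theorem exists_bound_pow_le_sum {ι : Type*} (s : Finset ι) (f : ι → ℝ) {q : ℕ}
    (hq : 0 < q) : ∃ M, 0 ≤ M ∧ (∀ i ∈ s, |f i| ≤ M) ∧ M ^ q ≤ ∑ i ∈ s, |f i| ^ q := by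
  rcases s.eq_empty_or_nonempty with rfl | hs
  · exact ⟨0, le_rfl, by simp, by simp [hq.ne']⟩
  · obtain ⟨i, hi, hmax⟩ := s.exists_max_image (fun i => |f i|) hs
    exact ⟨|f i|, abs_nonneg _, hmax, Finset.single_le_sum (f := fun i => |f i| ^ q)
      (fun _ _ => by positivity) hi⟩

theorem mul_sum_antitone_le {h : ℕ → ℝ} (hh : Antitone h) (m R : ℕ) :
    m * ∑ b ∈ Finset.range R, h ((b + 1) * m) ≤ ∑ i ∈ Finset.range (R * m), h i := by
  induction R with
  | zero => simp
  | succ R ih =>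
    rw [Finset.sum_range_succ, mul_add, show (R + 1) * m = R * m + m by ring, Finset.sum_range_add]
    refine add_le_add ih ?_
    calc (m : ℝ) * h (R * m + m) = ∑ _j ∈ Finset.range m, h (R * m + m) := by simp
      _ ≤ _ := Finset.sum_le_sum fun j hj => hh (by
          have := Finset.mem_range.1 hj; omega)

/-! ### Blocks of singular directions. -/

section Blocks

variable {n d : ℕ} {A : Matrix (Fin n) (Fin d) ℝ}

theorem sigma_eq_zero_of_min_lt (A : Matrix (Fin n) (Fin d) ℝ) {i : ℕ} (h : min n d < i) :
    sigma A i = 0 := by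
  by_contra hne
  have h1 := (LinearMap.singularValues_pos_iff_lt_finrank_range _).1
    ((LinearMap.singularValues_pos_iff_ne_zero _ (i - 1)).2 hne)
  have h2 := Submodule.finrank_le (LinearMap.range (Matrix.toEuclideanLin A))
  have h3 := LinearMap.finrank_range_le (Matrix.toEuclideanLin A)
  simp only [finrank_euclideanSpace_fin] at h2 h3
  omega

theorem sum_sigma_sq_le (A : Matrix (Fin n) (Fin d) ℝ) (N : ℕ) :
    ∑ i ∈ Finset.range N, sigma A (i + 1) ^ 2 ≤ ∑ i, ∑ j, A i j ^ 2 := by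
  obtain ⟨svd⟩ := ThinSVD.exists A
  have h1 : ∑ i ∈ Finset.range N, sigma A (i + 1) ^ 2
      ≤ ∑ i ∈ Finset.range (min n d), sigma A (i + 1) ^ 2 := by
    calc _ ≤ ∑ i ∈ Finset.range (max N (min n d)), sigma A (i + 1) ^ 2 :=
          Finset.sum_le_sum_of_subset_of_nonneg (Finset.range_mono (le_max_left _ _))
            fun _ _ _ => sq_nonneg _
      _ = _ := by
          refine (Finset.sum_subset (Finset.range_mono (le_max_right _ _)) fun i _ hi => ?_).symm
          rw [sigma_eq_zero_of_min_lt A (by rw [Finset.mem_range] at hi; omega)]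
          simp
  refine h1.trans (le_of_eq ?_)
  have h2 : ∀ j : Fin d, ∑ i, A i j ^ 2 = ∑ i : Fin (min n d), sigma A (i + 1) ^ 2 *
      (svd.right i) j ^ 2 := by
    intro j
    have h3 := svd.norm_apply_sq (EuclideanSpace.single j 1)
    rw [EuclideanSpace.norm_sq_eq] at h3
    simp only [EuclideanSpace.inner_single_right, Real.norm_eq_abs, sq_abs] at h3
    simpa [Matrix.toLpLin_apply] using h3
  rw [Finset.sum_comm]
  simp only [h2]
  rw [Finset.sum_comm, Finset.sum_range fun i => sigma A (i + 1) ^ 2]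
  refine Finset.sum_congr rfl fun i _ => ?_
  rw [← Finset.mul_sum]
  have h4 := svd.orthonormal_right.1 i
  have h5 : ∑ j, svd.right i j ^ 2 = 1 := by
    have := EuclideanSpace.norm_sq_eq (svd.right i)
    rw [h4, one_pow] at this
    simpa using this.symm
  rw [h5, mul_one]

/-- The sum of the leading squared singular values of blocks of `m` singular values. -/
theorem sum_block_weight_le (hA : 0 < specNorm A) {m : ℕ} (hm : stableRank A ≤ m) (R : ℕ) :
    ∑ b ∈ Finset.range R, sigma A (b * m + 1) ^ 2 ≤ 2 * specNorm A ^ 2 := by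
  have hF : ∑ i, ∑ j, A i j ^ 2 = stableRank A * specNorm A ^ 2 := by
    rw [stableRank]; field_simp
  have hsr : 1 ≤ stableRank A := by
    rw [stableRank, one_le_div (by positivity)]; exact specNorm_sq_le_sum_sq A
  have hm0 : (0 : ℝ) < m := by linarith
  rcases R with _ | R
  · rw [Finset.sum_range_zero]; positivity
  rw [Finset.sum_range_succ']
  -- Every block head after the first is at most the average over the preceding block. These heads
  -- contribute at most `‖A‖_F²/m ≤ ‖A‖²`, and the first head equals `‖A‖²`.
  have h1 := mul_sum_antitone_le (h := fun i => sigma A (i + 1) ^ 2) (fun i j hij =>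
    pow_le_pow_left₀ (sigma_nonneg _ _) (sigma_antitone A (by omega)) 2) m R
  have h2 := h1.trans (sum_sigma_sq_le A (R * m))
  rw [hF] at h2
  have h3 : (m : ℝ) * ∑ b ∈ Finset.range R, sigma A ((b + 1) * m + 1) ^ 2 ≤ m * specNorm A ^ 2 :=
    h2.trans (mul_le_mul_of_nonneg_right hm (by positivity))
  have h4 := le_of_mul_le_mul_left h3 hm0
  have h5 : sigma A (0 * m + 1) ^ 2 = specNorm A ^ 2 := by rw [specNorm_eq_sigma]; simp
  rw [h5]
  linarith

/-- The indices of the `b`-th block of `m` singular values. -/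
def block (r m b : ℕ) : Finset (Fin r) := Finset.univ.filter fun i => (i : ℕ) / m = b

theorem card_block_le {r m b : ℕ} (hm : 0 < m) : (block r m b).card ≤ m := by
  have h : ((block r m b).image fun i : Fin r => (i : ℕ)) ⊆ Finset.Ico (b * m) (b * m + m) := by
    intro x hx
    obtain ⟨i, hi, rfl⟩ := Finset.mem_image.1 hx
    have hi : (i : ℕ) / m = b := (Finset.mem_filter.1 hi).2
    rw [Nat.div_eq_iff hm] at hi
    rw [Finset.mem_Ico]
    omega
  have := Finset.card_le_card h
  rw [Finset.card_image_of_injective _ Fin.val_injective, Nat.card_Ico] at this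
  omega

theorem sum_block {β : Type*} [AddCommMonoid β] (r m : ℕ) (f : Fin r → β) :
    ∑ b ∈ Finset.range r, ∑ i ∈ block r m b, f i = ∑ i, f i :=
  Finset.sum_fiberwise_of_maps_to (fun i _ => Finset.mem_range.2
    ((Nat.div_le_self _ _).trans_lt i.2)) f

/-- The part of `A x` in the `b`-th block of singular directions. -/
noncomputable def ThinSVD.part (svd : ThinSVD A) (m b : ℕ) (x : EuclideanSpace ℝ (Fin d)) :
    EuclideanSpace ℝ (Fin n) :=
  ∑ i ∈ block (min n d) m b, (sigma A (i + 1) * inner ℝ (svd.right i) x) • svd.left i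

/-- The span of the left singular vectors in the `b`-th block. -/
noncomputable def ThinSVD.blockSpan (svd : ThinSVD A) (m b : ℕ) :
    Submodule ℝ (EuclideanSpace ℝ (Fin n)) :=
  Submodule.span ℝ ((block (min n d) m b).image svd.left : Finset _)

theorem ThinSVD.part_mem (svd : ThinSVD A) (m b : ℕ) (x : EuclideanSpace ℝ (Fin d)) :
    svd.part m b x ∈ svd.blockSpan m b :=
  Submodule.sum_mem _ fun _ hi => Submodule.smul_mem _ _
    (Submodule.subset_span (Finset.mem_coe.2 (Finset.mem_image_of_mem _ hi)))

theorem ThinSVD.finrank_blockSpan_le (svd : ThinSVD A) {m : ℕ} (hm : 0 < m) (b : ℕ) :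
    Module.finrank ℝ (svd.blockSpan m b) ≤ m :=
  (finrank_span_finset_le_card _).trans (Finset.card_image_le.trans (card_block_le hm))

theorem ThinSVD.sum_part (svd : ThinSVD A) (m : ℕ) (x : EuclideanSpace ℝ (Fin d)) :
    Matrix.toEuclideanLin A x = ∑ b ∈ Finset.range (min n d), svd.part m b x := by
  rw [svd.apply_eq_sum, ← sum_block _ m]
  rfl

theorem ThinSVD.norm_part_le (svd : ThinSVD A) (m b : ℕ) (x : EuclideanSpace ℝ (Fin d)) :
    ‖svd.part m b x‖ ≤ sigma A (b * m + 1) *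
      √(∑ i ∈ block (min n d) m b, inner ℝ (svd.right i) x ^ 2) := by
  have h0 : 0 ≤ ∑ i ∈ block (min n d) m b, inner ℝ (svd.right i) x ^ 2 :=
    Finset.sum_nonneg fun _ _ => sq_nonneg _
  refine le_of_sq_le_sq ?_ (mul_nonneg (sigma_nonneg _ _) (Real.sqrt_nonneg _))
  rw [mul_pow, Real.sq_sqrt h0, ← real_inner_self_eq_norm_sq, ThinSVD.part,
    svd.orthonormal_left.inner_sum, Finset.mul_sum]
  refine Finset.sum_le_sum fun i hi => ?_
  rw [conj_trivial]
  have h1 : b * m ≤ i := by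
    have : (i : ℕ) / m = b := (Finset.mem_filter.1 hi).2
    rw [← this]; exact Nat.div_mul_le_self _ _
  have h2 := pow_le_pow_left₀ (sigma_nonneg A _) (sigma_antitone A (Nat.add_le_add_right h1 1)) 2
  have h3 := mul_le_mul_of_nonneg_right h2 (sq_nonneg (inner ℝ (svd.right i) x : ℝ))
  linarith

theorem ThinSVD.sum_sum_block_le (svd : ThinSVD A) (m : ℕ) (x : EuclideanSpace ℝ (Fin d)) :
    ∑ b ∈ Finset.range (min n d), √(∑ i ∈ block (min n d) m b, inner ℝ (svd.right i) x ^ 2) ^ 2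
      ≤ ‖x‖ ^ 2 := by
  have h : ∀ b, √(∑ i ∈ block (min n d) m b, inner ℝ (svd.right i) x ^ 2) ^ 2
      = ∑ i ∈ block (min n d) m b, inner ℝ (svd.right i) x ^ 2 := fun b =>
    Real.sq_sqrt (Finset.sum_nonneg fun _ _ => sq_nonneg _)
  simp only [h]
  rw [sum_block _ m fun i => inner ℝ (svd.right i) x ^ 2]
  exact svd.sum_inner_sq_le Finset.univ x

end Blocks

/-! ### The Gram error of a subgaussian map. -/

section Chaining

variable {n d s : ℕ} {A : Matrix (Fin n) (Fin d) ℝ}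

/-- The bilinear form `⟪S x, S y⟫ - ⟪x, y⟫`. -/
noncomputable def sketchForm (S : Matrix (Fin s) (Fin n) ℝ) :
    EuclideanSpace ℝ (Fin n) →ₗ[ℝ] EuclideanSpace ℝ (Fin n) →ₗ[ℝ] ℝ :=
  (innerₗ _).compl₁₂ (Matrix.toEuclideanLin S) (Matrix.toEuclideanLin S) - innerₗ _

theorem sketchForm_apply (S : Matrix (Fin s) (Fin n) ℝ) (x y : EuclideanSpace ℝ (Fin n)) :
    sketchForm S x y
      = inner ℝ (Matrix.toEuclideanLin S x) (Matrix.toEuclideanLin S y) - inner ℝ x y := rfl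

theorem measurable_sketchForm (x y : EuclideanSpace ℝ (Fin n)) :
    Measurable fun S : Matrix (Fin s) (Fin n) ℝ => sketchForm S x y :=
  (measurable_sketch_inner x y).sub_const _

theorem toEuclideanLin_mul_apply (S : Matrix (Fin s) (Fin n) ℝ) (A : Matrix (Fin n) (Fin d) ℝ)
    (x : EuclideanSpace ℝ (Fin d)) :
    Matrix.toEuclideanLin (S * A) x = Matrix.toEuclideanLin S (Matrix.toEuclideanLin A x) := by
  rw [Matrix.toLpLin_apply, Matrix.toLpLin_apply, Matrix.toLpLin_apply]
  simp only
  rw [Matrix.mulVec_mulVec]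

theorem inner_gram_error_eq_sketchForm (S : Matrix (Fin s) (Fin n) ℝ)
    (x y : EuclideanSpace ℝ (Fin d)) :
    inner ℝ (Matrix.toEuclideanLin (Aᵀ * Sᵀ * S * A - Aᵀ * A) x) y
      = sketchForm S (Matrix.toEuclideanLin A x) (Matrix.toEuclideanLin A y) := by
  rw [inner_gram_error, sketchForm_apply, toEuclideanLin_mul_apply, toEuclideanLin_mul_apply]

variable (svd : ThinSVD A) {m : ℕ}
  {T : ∀ b, Finset (svd.blockSpan m b)}

/-- The nets bound the form on each pair of blocks. Cauchy-Schwarz over the pairs then separates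
these bounds from the block coordinates of `x` and `y`, whose squares sum to at most `‖x‖²` and
`‖y‖²`. -/
theorem specNorm_gram_error_sq_le_of_block_bound (S : Matrix (Fin s) (Fin n) ℝ)
    (hT : ∀ b, ∀ x : svd.blockSpan m b, ‖x‖ ≤ 1 → ∃ t ∈ T b, ‖x - t‖ ≤ 1 / 2)
    {M : ℕ × ℕ → ℝ} (hM : ∀ p, 0 ≤ M p)
    (h : ∀ p : ℕ × ℕ, ∀ t ∈ T p.1, ∀ t' ∈ T p.2, |sketchForm S t t'| ≤ M p) :
    specNorm (Aᵀ * Sᵀ * S * A - Aᵀ * A) ^ 2 ≤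
      ∑ p ∈ Finset.range (min n d) ×ˢ Finset.range (min n d),
        16 * (sigma A (p.1 * m + 1) ^ 2 * sigma A (p.2 * m + 1) ^ 2) * M p ^ 2 := by
  set R := Finset.range (min n d)
  set V := ∑ p ∈ R ×ˢ R,
        16 * (sigma A (p.1 * m + 1) ^ 2 * sigma A (p.2 * m + 1) ^ 2) * M p ^ 2 with hV
  have hV0 : 0 ≤ V := Finset.sum_nonneg fun p _ => by positivity
  have hform : ∀ x y : EuclideanSpace ℝ (Fin d),
      |sketchForm S (Matrix.toEuclideanLin A x) (Matrix.toEuclideanLin A y)| ≤ √V * ‖x‖ * ‖y‖ := by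
    intro x y
    set ξ : EuclideanSpace ℝ (Fin d) → ℕ → ℝ := fun x b =>
      √(∑ i ∈ block (min n d) m b, inner ℝ (svd.right i) x ^ 2) with hξ
    have h1 : |sketchForm S (Matrix.toEuclideanLin A x) (Matrix.toEuclideanLin A y)| ≤
        ∑ p ∈ R ×ˢ R, (4 * M p * (sigma A (p.1 * m + 1) * sigma A (p.2 * m + 1))) *
          (ξ x p.1 * ξ y p.2) := by
      rw [svd.sum_part m x, svd.sum_part m y]
      simp only [map_sum, LinearMap.sum_apply]
      rw [Finset.sum_comm, ← Finset.sum_product']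
      refine (Finset.abs_sum_le_sum_abs _ _).trans (Finset.sum_le_sum fun p _ => ?_)
      have h2 := abs_bilin_le_of_net (hT p.1) (hT p.2)
        ((sketchForm S).domRestrict₁₂ (svd.blockSpan m p.1) (svd.blockSpan m p.2)) (hM p)
        (fun t ht t' ht' => h p t ht t' ht')
        ⟨svd.part m p.1 x, svd.part_mem m p.1 x⟩ ⟨svd.part m p.2 y, svd.part_mem m p.2 y⟩
      have h3 := svd.norm_part_le m p.1 x
      have h4 := svd.norm_part_le m p.2 y
      have hs1 := sigma_nonneg A (p.1 * m + 1)
      have hs2 := sigma_nonneg A (p.2 * m + 1)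
      have hMp := hM p
      calc _ ≤ 4 * M p * ‖svd.part m p.1 x‖ * ‖svd.part m p.2 y‖ := h2
        _ ≤ 4 * M p * (sigma A (p.1 * m + 1) * ξ x p.1) * (sigma A (p.2 * m + 1) * ξ y p.2) := by
            gcongr
        _ = _ := by ring
    have h5 := Finset.sum_mul_sq_le_sq_mul_sq (R ×ˢ R)
      (fun p => 4 * M p * (sigma A (p.1 * m + 1) * sigma A (p.2 * m + 1)))
      (fun p => ξ x p.1 * ξ y p.2)
    have h6 : ∑ p ∈ R ×ˢ R, (4 * M p * (sigma A (p.1 * m + 1) * sigma A (p.2 * m + 1))) ^ 2 = V :=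
      Finset.sum_congr rfl fun p _ => by ring
    have h7 : ∑ p ∈ R ×ˢ R, (ξ x p.1 * ξ y p.2) ^ 2 ≤ ‖x‖ ^ 2 * ‖y‖ ^ 2 := by
      simp only [mul_pow]
      rw [Finset.sum_product' R R fun b b' => ξ x b ^ 2 * ξ y b' ^ 2, ← Finset.sum_mul_sum]
      exact mul_le_mul (svd.sum_sum_block_le m x) (svd.sum_sum_block_le m y)
        (Finset.sum_nonneg fun _ _ => sq_nonneg _) (sq_nonneg _)
    rw [h6] at h5
    refine le_of_sq_le_sq ?_ (by positivity)
    rw [mul_pow, mul_pow, Real.sq_sqrt hV0]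
    calc _ ≤ _ := pow_le_pow_left₀ (abs_nonneg _) h1 2
      _ ≤ _ := h5
      _ ≤ V * (‖x‖ ^ 2 * ‖y‖ ^ 2) := mul_le_mul_of_nonneg_left h7 hV0
      _ = _ := by ring
  have h8 : specNorm (Aᵀ * Sᵀ * S * A - Aᵀ * A) ≤ √V := by
    refine specNorm_le (Real.sqrt_nonneg _) fun x => ?_
    -- Testing the form of the Gram error against its own value at `x` recovers the norm.
    set z := Matrix.toEuclideanLin (Aᵀ * Sᵀ * S * A - Aᵀ * A) x with hz
    have h9 := hform x z
    rw [← inner_gram_error_eq_sketchForm, ← hz, real_inner_self_eq_norm_sq,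
      abs_of_nonneg (sq_nonneg _)] at h9
    rcases eq_or_lt_of_le (norm_nonneg z) with h0 | h0
    · rw [← h0]; positivity
    · exact le_of_mul_le_mul_right (by linarith [pow_two ‖z‖]) h0
  calc _ ≤ √V ^ 2 := pow_le_pow_left₀ (specNorm_nonneg _) h8 2
    _ = V := Real.sq_sqrt hV0

/-- Jensen's inequality for the weights `σ_b² σ_{b'}² / W²`, which sum to 1. A union bound over
pairs would bring in the number of blocks. -/
theorem specNorm_gram_error_pow_le (S : Matrix (Fin s) (Fin n) ℝ)
    (hT : ∀ b, ∀ x : svd.blockSpan m b, ‖x‖ ≤ 1 → ∃ t ∈ T b, ‖x - t‖ ≤ 1 / 2) {r : ℕ}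
    (hr : 0 < r) {W : ℝ} (hW : W = ∑ b ∈ Finset.range (min n d), sigma A (b * m + 1) ^ 2)
    (hW0 : 0 < W) :
    specNorm (Aᵀ * Sᵀ * S * A - Aᵀ * A) ^ (2 * r) ≤
      ∑ p ∈ Finset.range (min n d) ×ˢ Finset.range (min n d), ∑ t ∈ T p.1 ×ˢ T p.2,
        (4 * W) ^ (2 * r) * (sigma A (p.1 * m + 1) ^ 2 * sigma A (p.2 * m + 1) ^ 2 / W ^ 2) *
          |sketchForm S t.1 t.2| ^ (2 * r) := by
  choose M hM0 hM1 hM2 using fun p : ℕ × ℕ => exists_bound_pow_le_sum (T p.1 ×ˢ T p.2)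
    (fun t => sketchForm S t.1 t.2) (q := 2 * r) (by omega)
  have h1 := specNorm_gram_error_sq_le_of_block_bound svd S hT hM0
    (fun p t ht t' ht' => hM1 p (t, t') (Finset.mem_product.2 ⟨ht, ht'⟩))
  set R := Finset.range (min n d)
  have hβ : ∑ p ∈ R ×ˢ R, sigma A (p.1 * m + 1) ^ 2 * sigma A (p.2 * m + 1) ^ 2 / W ^ 2 = 1 := by
    rw [← Finset.sum_div, Finset.sum_product' R R
      fun b b' => sigma A (b * m + 1) ^ 2 * sigma A (b' * m + 1) ^ 2, ← Finset.sum_mul_sum, ← hW]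
    field_simp
  have h2 := Real.pow_arith_mean_le_arith_mean_pow (R ×ˢ R)
    (fun p => sigma A (p.1 * m + 1) ^ 2 * sigma A (p.2 * m + 1) ^ 2 / W ^ 2)
    (fun p => 16 * W ^ 2 * M p ^ 2) (fun p _ => by positivity) hβ (fun p _ => by positivity) r
  rw [pow_mul]
  refine (pow_le_pow_left₀ (sq_nonneg _) h1 r).trans ?_
  have h3 : ∑ p ∈ R ×ˢ R, 16 * (sigma A (p.1 * m + 1) ^ 2 * sigma A (p.2 * m + 1) ^ 2) * M p ^ 2
      = ∑ p ∈ R ×ˢ R, sigma A (p.1 * m + 1) ^ 2 * sigma A (p.2 * m + 1) ^ 2 / W ^ 2 *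
        (16 * W ^ 2 * M p ^ 2) := Finset.sum_congr rfl fun p _ => by field_simp
  rw [h3]
  refine h2.trans (Finset.sum_le_sum fun p _ => ?_)
  rw [← Finset.mul_sum]
  have h4 : (16 * W ^ 2 * M p ^ 2) ^ r = (4 * W) ^ (2 * r) * M p ^ (2 * r) := by
    rw [pow_mul, pow_mul, ← mul_pow]; ring
  rw [h4]
  calc _ = (4 * W) ^ (2 * r) * (sigma A (p.1 * m + 1) ^ 2 * sigma A (p.2 * m + 1) ^ 2 / W ^ 2) *
        M p ^ (2 * r) := by ring
    _ ≤ _ := mul_le_mul_of_nonneg_left (hM2 p) (by positivity)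

/-- The factors come from `W ≤ 2‖A‖²`, from the at most `5^m · 5^m` net points for a pair of blocks,
and from the moment bound at each of them. -/
theorem IsSubgaussian.lintegral_specNorm_gram_error_pow_le {D : Measure ℝ} {κ K : ℝ≥0}
    (h : IsSubgaussian D κ) (hκ : κ ≤ K) (hK : 1 ≤ K) (hA : 0 < specNorm A) (hm : 0 < m)
    (hsr : stableRank A ≤ m) {r : ℕ} (hr : 0 < r) (hrs : 2 * r ≤ s) :
    ∫⁻ S, ENNReal.ofReal (specNorm (Aᵀ * Sᵀ * S * A - Aᵀ * A) ^ (2 * r)) ∂(iidSketch s n D) ≤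
      ENNReal.ofReal ((8 * specNorm A ^ 2) ^ (2 * r) * 25 ^ m *
        (4 * (24 * K * Real.exp 10 * √((2 * r : ℕ) / s)) ^ (2 * r))) := by
  obtain ⟨svd⟩ := ThinSVD.exists A
  choose T hTc hT1 hT using fun b => exists_half_net (svd.finrank_blockSpan_le hm b)
  obtain ⟨W, hW⟩ : ∃ W, W = ∑ b ∈ Finset.range (min n d), sigma A (b * m + 1) ^ 2 := ⟨_, rfl⟩
  have hW2 : W ≤ 2 * specNorm A ^ 2 := hW ▸ sum_block_weight_le hA hsr _
  have hW0 : 0 < W := by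
    have h0 : 0 < min n d := by
      by_contra hne
      have : sigma A 1 = 0 := sigma_eq_zero_of_min_lt A (by omega)
      rw [specNorm_eq_sigma, this] at hA
      exact lt_irrefl _ hA
    have h1 := Finset.single_le_sum (f := fun b => sigma A (b * m + 1) ^ 2)
      (fun _ _ => sq_nonneg _) (Finset.mem_range.2 h0)
    simp only [zero_mul, zero_add, ← specNorm_eq_sigma] at h1
    rw [hW]
    exact lt_of_lt_of_le (by positivity) h1
  set R := Finset.range (min n d) with hR
  set ρ : ℝ := 4 * (24 * K * Real.exp 10 * √((2 * r : ℕ) / s)) ^ (2 * r) with hρ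
  have hρ0 : 0 ≤ ρ := by positivity
  set c : ℕ × ℕ → ℝ := fun p =>
    (4 * W) ^ (2 * r) * (sigma A (p.1 * m + 1) ^ 2 * sigma A (p.2 * m + 1) ^ 2 / W ^ 2) with hc
  have hc0 : ∀ p, 0 ≤ c p := fun p => by positivity
  have hcsum : ∑ p ∈ R ×ˢ R, c p = (4 * W) ^ (2 * r) := by
    simp only [hc]
    rw [← Finset.mul_sum, ← Finset.sum_div, Finset.sum_product' R R
      fun b b' => sigma A (b * m + 1) ^ 2 * sigma A (b' * m + 1) ^ 2, ← Finset.sum_mul_sum, ← hW]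
    field_simp
  have hmeas : ∀ x y : EuclideanSpace ℝ (Fin n), Measurable fun S : Matrix (Fin s) (Fin n) ℝ =>
      ENNReal.ofReal (|sketchForm S x y| ^ (2 * r)) := fun x y => by
    have := measurable_sketchForm (s := s) x y
    fun_prop
  calc _ ≤ ∫⁻ S : Matrix (Fin s) (Fin n) ℝ, ∑ p ∈ R ×ˢ R, ∑ t ∈ T p.1 ×ˢ T p.2,
        ENNReal.ofReal (c p) * ENNReal.ofReal (|sketchForm S t.1 t.2| ^ (2 * r))
          ∂(iidSketch s n D) := by
        refine lintegral_mono fun S => ?_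
        refine (ENNReal.ofReal_le_ofReal
          (specNorm_gram_error_pow_le svd S hT hr hW hW0)).trans (le_of_eq ?_)
        rw [ENNReal.ofReal_sum_of_nonneg fun p _ => Finset.sum_nonneg fun t _ =>
          mul_nonneg (hc0 p) (by positivity)]
        refine Finset.sum_congr rfl fun p _ => ?_
        rw [ENNReal.ofReal_sum_of_nonneg fun t _ => mul_nonneg (hc0 p) (by positivity)]
        exact Finset.sum_congr rfl fun t _ => ENNReal.ofReal_mul (hc0 p)
    _ = ∑ p ∈ R ×ˢ R, ∑ t ∈ T p.1 ×ˢ T p.2, ENNReal.ofReal (c p) *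
        ∫⁻ S : Matrix (Fin s) (Fin n) ℝ, ENNReal.ofReal (|sketchForm S t.1 t.2| ^ (2 * r))
          ∂(iidSketch s n D) := by
        rw [lintegral_finsetSum _ fun p _ => Finset.measurable_sum _ fun t _ =>
          (hmeas _ _).const_mul _]
        refine Finset.sum_congr rfl fun p _ => ?_
        rw [lintegral_finsetSum _ fun t _ => (hmeas _ _).const_mul _]
        exact Finset.sum_congr rfl fun t _ => lintegral_const_mul _ (hmeas _ _)
    _ ≤ ∑ p ∈ R ×ˢ R, ∑ t ∈ T p.1 ×ˢ T p.2, ENNReal.ofReal (c p) * ENNReal.ofReal ρ := by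
        refine Finset.sum_le_sum fun p _ => Finset.sum_le_sum fun t ht => mul_le_mul_right ?_ _
        obtain ⟨ht1, ht2⟩ := Finset.mem_product.1 ht
        exact h.lintegral_inner_sub_pow_le hκ hK (by omega) hrs (hT1 _ _ ht1) (hT1 _ _ ht2)
    _ = ENNReal.ofReal (∑ p ∈ R ×ˢ R, ((T p.1 ×ˢ T p.2).card : ℝ) * (c p * ρ)) := by
        rw [ENNReal.ofReal_sum_of_nonneg fun p _ => by have := hc0 p; positivity]
        refine Finset.sum_congr rfl fun p _ => ?_
        rw [Finset.sum_const, nsmul_eq_mul, ← ENNReal.ofReal_mul (hc0 p),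
          ENNReal.ofReal_mul (Nat.cast_nonneg _), ENNReal.ofReal_natCast]
    _ ≤ _ := by
        refine ENNReal.ofReal_le_ofReal ?_
        calc _ ≤ ∑ p ∈ R ×ˢ R, (25 : ℝ) ^ m * (c p * ρ) := by
              refine Finset.sum_le_sum fun p _ =>
                mul_le_mul_of_nonneg_right ?_ (mul_nonneg (hc0 p) hρ0)
              rw [Finset.card_product]
              have := Nat.mul_le_mul (hTc p.1) (hTc p.2)
              rw [← mul_pow] at this
              exact_mod_cast this
          _ = (4 * W) ^ (2 * r) * 25 ^ m * ρ := by
              rw [← Finset.mul_sum, ← Finset.sum_mul, hcsum]; ring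
          _ ≤ _ := by
              have : 4 * W ≤ 8 * specNorm A ^ 2 := by linarith
              gcongr

theorem IsSubgaussian.hasApproxGram_iidSketch {D : Measure ℝ} {κ K : ℝ≥0}
    (h : IsSubgaussian D κ) (hκ : κ ≤ K) (hK : 1 ≤ K) {k : ℕ} (hk : 1 ≤ k) (hr : k ≤ A.rank)
    (hgap : sigma A (k + 1) < sigma A k) {ν δ : ℝ} (hν : 0 < ν) (hν2 : ν < 1 / 2) (hδ : 0 < δ)
    (hδ2 : δ < 1 / 2)
    (hs : 16 * (960 * K * Real.exp 12) ^ 2 * ((stableRank A + Real.log (1 / δ)) /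
      (relGap A k ^ 2 * ν ^ 2)) ≤ s) :
    HasApproxGram (iidSketch s n D) A (sketchAccuracy A k ν) δ := by
  have hg := relGap_pos hk hr hgap
  have hg1 := relGap_le_one A hk
  have hε := half_mul_le_sketchAccuracy hν hν2 hg.le
  set ε := ν / 2 * relGap A k with hεdef
  have hε0 : 0 < ε := by positivity
  have hε1 : ε ≤ 1 := by nlinarith
  have hA : 0 < specNorm A := by
    rw [specNorm_eq_sigma]; exact sigma_pos_of_le_rank le_rfl (hk.trans hr)
  have hsr : 1 ≤ stableRank A := by
    rw [stableRank, one_le_div (by positivity)]; exact specNorm_sq_le_sum_sq A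
  have hlog : 0 ≤ Real.log (1 / δ) := Real.log_nonneg (by
    rw [le_div_iff₀ hδ]; linarith)
  have hK1 : (1 : ℝ) ≤ K := hK
  set Λ := stableRank A + Real.log (1 / δ) with hΛ
  set m := ⌈Λ⌉₊ with hm
  have hΛm : Λ ≤ m := Nat.le_ceil _
  have hm2 : (m : ℝ) ≤ 2 * Λ := by
    have := Nat.ceil_lt_add_one (show 0 ≤ Λ by linarith)
    linarith
  have hm0 : 0 < m := Nat.ceil_pos.2 (by linarith)
  have hm0' : (0 : ℝ) < m := Nat.cast_pos.2 hm0
  set X := 960 * (K : ℝ) * Real.exp 12 with hX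
  have hX1 : 1 ≤ X := by
    have : (1 : ℝ) ≤ Real.exp 12 := Real.one_le_exp (by norm_num)
    nlinarith
  have hs1 : 2 * m * (X / ε) ^ 2 ≤ s := by
    refine le_trans ?_ hs
    calc 2 * m * (X / ε) ^ 2 ≤ 2 * (2 * Λ) * (X / ε) ^ 2 := by gcongr
      _ = _ := by rw [hεdef]; field_simp; ring
  have hXε : 1 ≤ X / ε := by rw [one_le_div hε0]; linarith
  have hms : 2 * m ≤ s := by
    have : (2 * m : ℝ) ≤ s := by
      refine le_trans ?_ hs1
      exact le_mul_of_one_le_right (by positivity) (one_le_pow₀ hXε)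
    exact_mod_cast this
  have hs0 : (0 : ℝ) < s := by
    have : 0 < s := by omega
    exact_mod_cast this
  -- The moment order is `2m`, matched to the block size so that the net cardinality costs only a
  -- constant per factor.
  have hint := h.lintegral_specNorm_gram_error_pow_le hκ hK hA hm0 (by linarith) hm0 hms
  have hpos : 0 < (ε * specNorm A ^ 2) ^ (2 * m) := by positivity
  have hsub : {S : Matrix (Fin s) (Fin n) ℝ | sketchAccuracy A k ν * specNorm A ^ 2 ≤
      specNorm (Aᵀ * Sᵀ * S * A - Aᵀ * A)} ⊆
      {S | ENNReal.ofReal ((ε * specNorm A ^ 2) ^ (2 * m)) ≤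
        ENNReal.ofReal (specNorm (Aᵀ * Sᵀ * S * A - Aᵀ * A) ^ (2 * m))} := by
    intro S hS
    refine ENNReal.ofReal_le_ofReal (pow_le_pow_left₀ (by positivity) ?_ _)
    exact (mul_le_mul_of_nonneg_right hε (sq_nonneg _)).trans hS
  refine (measure_mono hsub).trans ?_
  refine (meas_ge_le_lintegral_div (AEMeasurable.ennreal_ofReal
    ((measurable_specNorm_gram_error A).pow_const _).aemeasurable)
    (ENNReal.ofReal_pos.2 hpos).ne' ENNReal.ofReal_ne_top).trans ?_
  refine (ENNReal.div_le_div_right hint _).trans ?_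
  rw [← ENNReal.ofReal_div_of_pos hpos]
  refine ENNReal.ofReal_le_ofReal ?_
  have hsqrt : √(((2 * m : ℕ) : ℝ) / s) ≤ ε / X := by
    refine Real.sqrt_le_iff.2 ⟨by positivity, ?_⟩
    rw [div_le_iff₀ hs0]
    have e : (ε / X) ^ 2 * (2 * m * (X / ε) ^ 2) = 2 * m := by field_simp
    calc ((2 * m : ℕ) : ℝ) = 2 * m := by push_cast; ring
      _ = (ε / X) ^ 2 * (2 * m * (X / ε) ^ 2) := e.symm
      _ ≤ _ := mul_le_mul_of_nonneg_left hs1 (by positivity)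
  have hexp : Real.exp (-(m : ℝ)) ≤ δ := by
    have : -(m : ℝ) ≤ Real.log δ := by
      rw [one_div, Real.log_inv] at hΛ; linarith
    calc _ ≤ Real.exp (Real.log δ) := Real.exp_le_exp.2 this
      _ = δ := Real.exp_log hδ
  -- Written as a power of order `2m`, the net size joins the other constants: `8 · 5 · 24 = 960`.
  have h25 : (25 : ℝ) ^ m = 5 ^ (2 * m) := by rw [pow_mul]; norm_num
  have h12 : Real.exp 12 = Real.exp 10 * Real.exp 2 := by rw [← Real.exp_add]; norm_num
  calc _ = 4 * (960 * K * Real.exp 10 * √(((2 * m : ℕ) : ℝ) / s) / ε) ^ (2 * m) := by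
        rw [h25, div_eq_iff hpos.ne', mul_left_comm, ← mul_pow, ← mul_pow, mul_assoc 4, ← mul_pow]
        congr 2
        field_simp
        ring
    _ ≤ 4 * (960 * K * Real.exp 10 * (ε / X) / ε) ^ (2 * m) := by gcongr
    -- Since `X` carries `e^12` against `e^10`, each of the `2m` factors is `e^{-2}`. The total
    -- `e^{-4m} ≤ δ⁴` leaves room for the 4.
    _ = 4 * (Real.exp (-(m : ℝ))) ^ 4 := by
        have e1 : 960 * (K : ℝ) * Real.exp 10 * (ε / X) / ε = Real.exp (-2) := by
          rw [hX, h12, Real.exp_neg]; field_simp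
        rw [e1, ← Real.exp_nat_mul, ← Real.exp_nat_mul]
        congr 2
        push_cast; ring
    _ ≤ 4 * δ ^ 4 := by gcongr
    _ ≤ δ := by
        have : δ ^ 3 ≤ (1 / 2) ^ 3 := by gcongr
        nlinarith

end Chaining

end SketchedPCR

/-! ### Assembly of the three statements. -/

theorem mainTheorem4 :
    (∀ (n d k s : ℕ) (A : Matrix (Fin n) (Fin d) ℝ), 1 ≤ k → ∀ (hr : k ≤ A.rank),
      sigma A (k + 1) < sigma A k →
      ∀ ν δ : ℝ, 0 < ν → ν < 1 / 2 → 0 < δ → δ < 1 / 2 →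
      ∀ (D : Measure (Matrix (Fin s) (Fin n) ℝ)), IsProbabilityMeasure D →
      HasApproxGram D A (sketchAccuracy A k ν) δ →
      ∃ E : Set (Matrix (Fin s) (Fin n) ℝ), MeasurableSet E ∧ ENNReal.ofReal (1 - δ) ≤ D E ∧
        ∀ S ∈ E, ∃ hs : k ≤ min s d, ∀ svdSA : ThinSVD (S * A),
          (∀ (svdA : ThinSVD A) (b : Fin n → ℝ),
            IsApproxPCR svdA (le_min_of_le_rank hr) b
              (sigma A (k + 1) / sigma A k * ν)
              (ν / ((√(1 - ν ^ 2) - ν) * sigma A k))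
              (compressedLS A (firstCols svdSA.V hs) b)) ∧
          (∀ (Ω : Type*) [MeasurableSpace Ω] (P : Measure Ω) [IsProbabilityMeasure P]
            (f : Fin n → ℝ) (ξ : Fin n → Ω → ℝ) (τ : ℝ) (xstar : Fin d → ℝ),
            IsNoise P ξ τ →
            IsOptimalPredictor P A (response f ξ) xstar →
            Integrable (fun ω => l2 (A *ᵥ compressedLS A
                (firstCols svdSA.V hs) (response f ξ ω)
                - A *ᵥ xstar) ^ 2 / n) P ∧
            excessRisk P A xstar (fun ω => compressedLS A
                (firstCols svdSA.V hs) (response f ξ ω))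
              ≤ (1 + ν) * l2 xstar ^ 2 * sigma A (k + 1) ^ 2 / n
                + τ ^ 2 * k / n)) ∧
    (∃ C : ℝ, 0 < C ∧
      ∀ (n d k s : ℕ) [NeZero s] (A : Matrix (Fin n) (Fin d) ℝ), 1 ≤ k → k ≤ A.rank →
      sigma A (k + 1) < sigma A k →
      ∀ ν δ : ℝ, 0 < ν → ν < 1 / 2 → 0 < δ → δ < 1 / 2 →
      C * (stableRank A ^ 2 / (relGap A k ^ 2 * ν ^ 2 * δ)) ≤ s →
      HasApproxGram (countSketch s n) A
        (sketchAccuracy A k ν) δ) ∧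
    (∀ κ : ℝ≥0, ∃ C : ℝ, 0 < C ∧
      ∀ (D : Measure ℝ), IsSubgaussian D κ →
      ∀ (n d k s : ℕ) (A : Matrix (Fin n) (Fin d) ℝ), 1 ≤ k → k ≤ A.rank →
      sigma A (k + 1) < sigma A k →
      ∀ ν δ : ℝ, 0 < ν → ν < 1 / 2 → 0 < δ → δ < 1 / 2 →
      C * ((stableRank A + Real.log (1 / δ)) /
        (relGap A k ^ 2 * ν ^ 2)) ≤ s →
      HasApproxGram (iidSketch s n D) A
        (sketchAccuracy A k ν) δ) := by
  -- Replacing `κ` by `max κ 1` provides the normalization `1 ≤ K` used in the moment bounds.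
  refine ⟨?_, ⟨8, by norm_num, ?_⟩, fun κ => ⟨16 * (960 * (max κ 1 : ℝ≥0) * Real.exp 12) ^ 2,
    by positivity, ?_⟩⟩
  · intro n d k s A hk hr hgap ν δ hν hν2 hδ hδ2 D hD hgram
    have hmeas : MeasurableSet {S : Matrix (Fin s) (Fin n) ℝ |
        sketchAccuracy A k ν * specNorm A ^ 2 ≤ specNorm (Aᵀ * Sᵀ * S * A - Aᵀ * A)} :=
      measurableSet_le measurable_const (measurable_specNorm_gram_error A)
    -- The good event depends on the Gram error alone, hence serves all `b`, all decompositions and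
    -- all noise models at once.
    refine ⟨_, hmeas.compl, ?_, fun S hS => ?_⟩
    · rw [prob_compl_eq_one_sub hmeas, ENNReal.ofReal_sub _ hδ.le, ENNReal.ofReal_one]
      exact tsub_le_tsub_left hgram 1
    · have hS' : specNorm (Aᵀ * Sᵀ * S * A - Aᵀ * A) < sketchAccuracy A k ν * specNorm A ^ 2 :=
        not_le.1 hS
      refine ⟨le_min_of_gram_error hk hr hgap hν hS', fun svdSA => ⟨fun svdA b => ?_, ?_⟩⟩
      · exact isApproxPCR_compressedLS hk hr hgap hν hS' hν2 svdA svdSA _ b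
      · intro Ω _ P _ f ξ τ xstar hξ hx
        exact excessRisk_compressedLS_le hk hr hgap hν hS' hν2 svdSA _ P f ξ τ xstar hξ hx
  · intro n d k s _ A hk hr hgap ν δ hν hν2 hδ _ hs
    exact hasApproxGram_countSketch hk hr hgap hν hν2 hδ hs
  · intro D hD n d k s A hk hr hgap ν δ hν hν2 hδ hδ2 hs
    exact hD.hasApproxGram_iidSketch (le_max_left κ 1) (le_max_right κ 1) hk hr hgap hν hν2 hδ hδ2 hs
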